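/- Let $n_1,n_2\ge 0$ be integers, $n=n_1+n_2+1$, and for $i=1,2$ let $N_i$ be a smooth $n_i$-dimensional manifold and $\psi_i:N_i\to\mathbb S^{2n_i+1}\subset\mathbb C^{n_i+1}$ a Legendrian immersion, i.e. a smooth immersion with $\psi_i^*\Lambda=0$, where $\Lambda_z(v)=\langle v,Jz\rangle$ and $J$ is multiplication by $i$. Manifolds carry the metrics induced by the immersions, and $H$ denotes the mean curvature vector. Call a Legendrian immersion into a unit sphere C-minimal if $\operatorname{div}JH=0$ and minimal if $H=0$; call a Lagrangian immersion into $\mathbb C^{n+1}$ H-minimal if $\operatorname{div}JH=0$. Let $I\subset\mathbb R$ be an open interval, $\mu\in\mathbb R$, and let $\gamma=(\gamma_1,\gamma_2):I\to\mathbb S^3\subset\mathbb C^2$ be a smooth curve with $$\gamma_j'(t)\,\overline{\gamma_j(t)}=(-1)^{j-1}\,i\,e^{i\mu t}\,\overline{\gamma_1(t)}^{\,n_1+1}\,\overline{\gamma_2(t)}^{\,n_2+1},\qquad j=1,2,\ t\in I.$$ Define $\psi:\mathbb R\times I\times N_1\times N_2\to\mathbb C^{n+1}=\mathbb C^{n_1+1}\times\mathbb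 C^{n_2+1}$ by $$\psi(s,t,p,q)=\bigl(s\,\gamma_1(t)\psi_1(p),\,s\,\gamma_2(t)\psi_2(q)\bigr).$$ Then $\psi$ is smooth with $\psi^*\omega=0$, it is an immersion at all points with $s\,\gamma_1(t)\,\gamma_2(t)\ne 0$, and it is the cone $s\,\phi$ whose link $\phi(t,p,q)=(\gamma_1(t)\psi_1(p),\gamma_2(t)\psi_2(q))$ is a Legendrian immersion into $\mathbb S^{2n+1}$ where $\gamma_1(t)\gamma_2(t)\neq 0$. Moreover, on the open set of all points where $\psi$ is an immersion: (a) if $\psi_1$ and $\psi_2$ are C-minimal, then $\psi$ is an H-minimal Lagrangian immersion; (b) if $\psi_1$ and $\psi_2$ are minimal, $N_1$ and $N_2$ are connected and $\mu=0$, then $\psi$ is special Lagrangian: there is a constant $\theta$ such that, for a suitable orientation, $dz_1\wedge\dots\wedge dz_{n+1}$ takes the value $e^{i\theta}$ on the images under $d\psi$ of all positively oriented orthonormal bases of tangent spaces. -/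

import Mathlib

open scoped Manifold ContDiff

noncomputable section

namespace LagCone

/-- Complex Euclidean space `ℂ^ι`, with the real inner product `inner ℝ v w = Re ∑ v_k conj(w_k)`;
the complex structure `J` is multiplication by `Complex.I`. -/
abbrev CSpace (ι : Type*) := EuclideanSpace ℂ ι

section Local

/-! ### Submanifold geometry of a parametrization `F : E → ℂ^ι`

`E` is the (finite-dimensional) coordinate space, and `F` is an immersion at the points where the
notions below are used. -/

variable {E : Type*} [NormedAddCommGroup E] [NormedSpace ℝ E] [FiniteDimensional ℝ E]
  {ι : Type*} [Fintype ι]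

/-- The matrix `g_{ij} = ⟨∂_i F, ∂_j F⟩` of the induced metric in a basis of the coordinate
space. -/
def metricMatrix (F : E → CSpace ι) (y : E) :
    Matrix (Fin (Module.finrank ℝ E)) (Fin (Module.finrank ℝ E)) ℝ :=
  fun i j => inner ℝ (fderiv ℝ F y (Module.finBasis ℝ E i)) (fderiv ℝ F y (Module.finBasis ℝ E j))

/-- The trace `g^{ij} B(∂_i, ∂_j)` of a bilinear map with respect to the induced metric. It is equal
to `∑ B(e_i, e_i)` for any basis `e` that is orthonormal in the induced metric. -/
def metricTrace {W : Type*} [AddCommGroup W] [Module ℝ W]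
    (F : E → CSpace ι) (y : E) (B : E → E → W) : W :=
  ∑ i, ∑ j, (metricMatrix F y)⁻¹ i j • B (Module.finBasis ℝ E i) (Module.finBasis ℝ E j)

/-- The image in `ℂ^ι` of the tangent space at the point `y`. -/
def tangentPlane (F : E → CSpace ι) (y : E) : Submodule ℝ (CSpace ι) :=
  LinearMap.range (fderiv ℝ F y : E →ₗ[ℝ] CSpace ι)

/-- The second fundamental form of an immersion into `ℂ^ι`: the component of `∂_u ∂_v F` that is
orthogonal to the tangent space. -/
def euclideanSecondForm (F : E → CSpace ι) (y u v : E) : CSpace ι :=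
  (tangentPlane F y)ᗮ.starProjection (fderiv ℝ (fderiv ℝ F) y u v)

/-- The second fundamental form of an immersion into the unit sphere of `ℂ^ι`: the component of
`∂_u ∂_v F` that is tangent to the sphere (orthogonal to `F y`) and orthogonal to the tangent
space of the immersion. -/
def sphericalSecondForm (F : E → CSpace ι) (y u v : E) : CSpace ι :=
  (tangentPlane F y ⊔ Submodule.span ℝ {F y})ᗮ.starProjection (fderiv ℝ (fderiv ℝ F) y u v)

/-- The mean curvature vector `H = (1 / dim) trace σ` of an immersion into `ℂ^ι`. -/
def euclideanMeanCurvature (F : E → CSpace ι) (y : E) : CSpace ι :=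
  (Module.finrank ℝ E : ℝ)⁻¹ • metricTrace F y (euclideanSecondForm F y)

/-- The mean curvature vector `H = (1 / dim) trace σ` of an immersion into the unit sphere. -/
def sphericalMeanCurvature (F : E → CSpace ι) (y : E) : CSpace ι :=
  (Module.finrank ℝ E : ℝ)⁻¹ • metricTrace F y (sphericalSecondForm F y)

/-- The divergence, in the induced metric, of a field `Z` of vectors that are tangent to the
immersed manifold (such as `JH`). The Levi-Civita connection of the induced metric is the
tangential part of the derivative in `ℂ^ι`, so the divergence is `g^{ij} ⟨∂_i Z, ∂_j F⟩`. -/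
def tangentialDivergence (F Z : E → CSpace ι) (y : E) : ℝ :=
  metricTrace F y (fun u v => inner ℝ (fderiv ℝ Z y u) (fderiv ℝ F y v))

end Local

section Global

/-! ### Immersed manifolds -/

variable {E : Type*} [NormedAddCommGroup E] [NormedSpace ℝ E] [FiniteDimensional ℝ E]
  {H : Type*} [TopologicalSpace H] (I : ModelWithCorners ℝ E H) [I.Boundaryless]
  {M : Type*} [TopologicalSpace M] [ChartedSpace H M]
  {ι : Type*} [Fintype ι] [DecidableEq ι]

/-- The coordinate expression of `f` in the chart at `x`. -/
def coordRep (f : M → CSpace ι) (x : M) : E → CSpace ι := f ∘ (extChartAt I x).symm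

/-- The differential `f_* v ∈ ℂ^ι` of `f` at `x`, applied to a tangent vector `v`. -/
def push (f : M → CSpace ι) (x : M) (v : TangentSpace I x) : CSpace ι :=
  mfderiv I 𝓘(ℝ, CSpace ι) f x v

/-- `f` is a Legendrian immersion of the open set `U` into the unit sphere of `ℂ^ι`:
`dim M = n`, `ℂ^ι = ℂ^(n+1)`, and `f^* Λ = 0` for the Liouville form `Λ_z(v) = ⟨v, J z⟩`. -/
structure IsLegendrianImmersionOn (f : M → CSpace ι) (U : Set M) : Prop where
  dim : Module.finrank ℝ E + 1 = Fintype.card ι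
  smooth : ContMDiffOn I 𝓘(ℝ, CSpace ι) ∞ f U
  mem_sphere : ∀ x ∈ U, f x ∈ Metric.sphere (0 : CSpace ι) 1
  immersion : ∀ x ∈ U, Function.Injective (push I f x)
  legendrian : ∀ x ∈ U, ∀ v : TangentSpace I x,
    inner ℝ (push I f x v) (Complex.I • f x) = 0

/-- A minimal Legendrian immersion: `H = 0`. -/
structure IsMinimalLegendrianOn (f : M → CSpace ι) (U : Set M) : Prop extends
    IsLegendrianImmersionOn I f U where
  minimal : ∀ x ∈ U, sphericalMeanCurvature (coordRep I f x) (extChartAt I x x) = 0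

/-- A C-minimal (contact minimal) Legendrian immersion: `div JH = 0`. -/
structure IsCMinimalLegendrianOn (f : M → CSpace ι) (U : Set M) : Prop extends
    IsLegendrianImmersionOn I f U where
  cminimal : ∀ x ∈ U, tangentialDivergence (coordRep I f x)
    (fun y => Complex.I • sphericalMeanCurvature (coordRep I f x) y) (extChartAt I x x) = 0

/-- `f^* ω = 0` at the point `x`, for the Kaehler form `ω(u, v) = ⟨J u, v⟩` of `ℂ^ι`. -/
def IsIsotropicAt (f : M → CSpace ι) (x : M) : Prop :=
  ∀ u v : TangentSpace I x,
    inner ℝ (Complex.I • push I f x u) (push I f x v) = 0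

/-- `f` is a Lagrangian immersion of the open set `U` into `ℂ^ι`. -/
structure IsLagrangianImmersionOn (f : M → CSpace ι) (U : Set M) : Prop where
  dim : Module.finrank ℝ E = Fintype.card ι
  smooth : ContMDiffOn I 𝓘(ℝ, CSpace ι) ∞ f U
  immersion : ∀ x ∈ U, Function.Injective (push I f x)
  isotropic : ∀ x ∈ U, IsIsotropicAt I f x

/-- An H-minimal (Hamiltonian minimal) Lagrangian immersion: `div JH = 0`. -/
structure IsHMinimalLagrangianOn (f : M → CSpace ι) (U : Set M) : Prop extends
    IsLagrangianImmersionOn I f U where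
  hminimal : ∀ x ∈ U, tangentialDivergence (coordRep I f x)
    (fun y => Complex.I • euclideanMeanCurvature (coordRep I f x) y) (extChartAt I x x) = 0

/-- The value `Ω₀(v)` of the complex volume form `dz_1 ∧ ⋯ ∧ dz_{n+1}` on a tuple of vectors. -/
def complexVolume (v : ι → CSpace ι) : ℂ := Matrix.det (Matrix.of fun k j => v j k)

/-- A special Lagrangian immersion: a Lagrangian immersion whose Lagrangian angle is a constant `θ`
for a suitable orientation. That is, at every point one of the two classes of orthonormal bases `e`
of the tangent space satisfies `Ω₀(f_* e) = exp(iθ)`, and the other one `Ω₀(f_* e) = -exp(iθ)`;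
the orientation that the first class defines is continuous, because the real form
`Re(exp(-iθ) f^* Ω₀)` is continuous and vanishes nowhere. -/
structure IsSpecialLagrangianOn (f : M → CSpace ι) (U : Set M) : Prop extends
    IsLagrangianImmersionOn I f U where
  phase : ∃ θ : ℝ, ∀ x ∈ U, ∀ e : ι → TangentSpace I x,
    Orthonormal ℝ (fun j => push I f x (e j)) →
      complexVolume (fun j => push I f x (e j)) = Complex.exp (Complex.I * θ) ∨
      complexVolume (fun j => push I f x (e j)) = -Complex.exp (Complex.I * θ)

end Global

section Construction

/-- The vector `(v, w)` of `ℂ^(n₁+1) × ℂ^(n₂+1) = ℂ^(n₁+n₂+2)`. -/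
def pair {ι₁ ι₂ : Type*} (v : CSpace ι₁) (w : CSpace ι₂) : CSpace (ι₁ ⊕ ι₂) :=
  WithLp.toLp 2 (Sum.elim (fun k => v k) (fun k => w k))

/-- The cone `C(φ)(s, p) = s φ(p)` with link `φ`. -/
def cone {M : Type*} {ι : Type*} (φ : M → CSpace ι) : ℝ × M → CSpace ι :=
  fun x => x.1 • φ x.2

/-- The model of the product manifold `ℝ × N₁ × N₂` with `dim N_i = n_i`. -/
abbrev linkModel (n₁ n₂ : ℕ) := 𝓘(ℝ, ℝ).prod ((𝓡 n₁).prod (𝓡 n₂))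

/-- The model of the product manifold `ℝ × ℝ × N₁ × N₂` with `dim N_i = n_i`. -/
abbrev coneModel (n₁ n₂ : ℕ) := 𝓘(ℝ, ℝ).prod (linkModel n₁ n₂)

variable {N₁ N₂ : Type*} {ι₁ ι₂ : Type*}

/-- The map `φ(t, p, q) = (γ₁(t) ψ₁(p), γ₂(t) ψ₂(q))`. -/
def linkMap (γ₁ γ₂ : ℝ → ℂ) (ψ₁ : N₁ → CSpace ι₁) (ψ₂ : N₂ → CSpace ι₂) :
    ℝ × N₁ × N₂ → CSpace (ι₁ ⊕ ι₂) :=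
  fun (t, p, q) => pair (γ₁ t • ψ₁ p) (γ₂ t • ψ₂ q)

/-- The map `ψ(s, t, p, q) = (s γ₁(t) ψ₁(p), s γ₂(t) ψ₂(q))`. -/
def coneMap (γ₁ γ₂ : ℝ → ℂ) (ψ₁ : N₁ → CSpace ι₁) (ψ₂ : N₂ → CSpace ι₂) :
    ℝ × ℝ × N₁ × N₂ → CSpace (ι₁ ⊕ ι₂) :=
  fun (s, t, p, q) => pair (((s : ℂ) * γ₁ t) • ψ₁ p) (((s : ℂ) * γ₂ t) • ψ₂ q)

/-- The subset `ℝ × J × N₁ × N₂` of `ℝ × ℝ × N₁ × N₂`. -/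
def coneDomain (N₁ N₂ : Type*) (J : Set ℝ) : Set (ℝ × ℝ × N₁ × N₂) := {x | x.2.1 ∈ J}

/-- The regular points of the map `coneMap` in `ℝ × J × N₁ × N₂`: those where its differential is
injective. -/
def regularSet {n₁ n₂ : ℕ}
    [TopologicalSpace N₁] [ChartedSpace (EuclideanSpace ℝ (Fin n₁)) N₁]
    [TopologicalSpace N₂] [ChartedSpace (EuclideanSpace ℝ (Fin n₂)) N₂]
    (γ₁ γ₂ : ℝ → ℂ) (ψ₁ : N₁ → CSpace (Fin (n₁ + 1))) (ψ₂ : N₂ → CSpace (Fin (n₂ + 1)))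
    (J : Set ℝ) : Set (ℝ × ℝ × N₁ × N₂) :=
  {x | x ∈ coneDomain N₁ N₂ J ∧
    Function.Injective (push (coneModel n₁ n₂) (coneMap γ₁ γ₂ ψ₁ ψ₂) x)}

end Construction

end LagCone

end

noncomputable section

namespace LagCone

section FrameTrace

set_option linter.unusedSectionVars false

variable {E : Type*} [NormedAddCommGroup E] [NormedSpace ℝ E] [FiniteDimensional ℝ E]
  {E' : Type*} [NormedAddCommGroup E'] [NormedSpace ℝ E'] [FiniteDimensional ℝ E']
  {V : Type*} [NormedAddCommGroup V] [InnerProductSpace ℝ V]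
  {V' : Type*} [NormedAddCommGroup V'] [InnerProductSpace ℝ V']
  {W : Type*} [AddCommGroup W] [Module ℝ W]
  {W' : Type*} [AddCommGroup W'] [Module ℝ W']

/-- The trace of a bilinear map with respect to the inner product that is pulled back by the
injective linear map `L`. -/
def frameTrace (L : E →L[ℝ] V) (B : E →ₗ[ℝ] E →ₗ[ℝ] W) : W :=
  ∑ i, ∑ j, (Matrix.of fun i j => inner ℝ (L (Module.finBasis ℝ E i))
    (L (Module.finBasis ℝ E j)))⁻¹ i j • B (Module.finBasis ℝ E i) (Module.finBasis ℝ E j)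

theorem frameTrace_eq_sum {κ : Type*} [Fintype κ] (L : E →L[ℝ] V)
    (B : E →ₗ[ℝ] E →ₗ[ℝ] W) (b : Module.Basis κ ℝ E) (hb : Orthonormal ℝ (fun a => L (b a))) :
    frameTrace L B = ∑ a, B (b a) (b a) := by
  classical
  set f := Module.finBasis ℝ E with hf
  set P : Matrix _ _ ℝ := b.toMatrix f with hP
  set Q : Matrix _ _ ℝ := f.toMatrix b with hQ
  have hPQ : P * Q = 1 := b.toMatrix_mul_toMatrix_flip f
  have hQP : Q * P = 1 := f.toMatrix_mul_toMatrix_flip b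
  have hG : (Matrix.of fun i j => inner ℝ (L (f i)) (L (f j))) = P.transpose * P := by
    ext i j
    have h1 : ∀ i, L (f i) = ∑ k, P k i • L (b k) := fun i => by
      have := congrArg L (b.sum_toMatrix_smul_self f i)
      rw [← this]
      simp only [map_sum, map_smul, hP]
    rw [Matrix.of_apply, h1 i, h1 j, hb.inner_sum]
    simp [Matrix.mul_apply]
  have hinv : (P.transpose * P)⁻¹ = Q * Q.transpose := by
    apply Matrix.inv_eq_right_inv
    rw [Matrix.mul_assoc, ← Matrix.mul_assoc P, hPQ, Matrix.one_mul, ← Matrix.transpose_mul, hQP,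
      Matrix.transpose_one]
  have hbf : ∀ a, b a = ∑ i, Q i a • f i := fun a => (f.sum_toMatrix_smul_self b a).symm
  rw [frameTrace, ← hf, hG, hinv]
  calc _ = ∑ i, ∑ j, ∑ a, (Q i a * Q j a) • B (f i) (f j) := by
        simp only [Matrix.mul_apply, Matrix.transpose_apply, Finset.sum_smul]
    _ = ∑ a, ∑ i, ∑ j, (Q i a * Q j a) • B (f i) (f j) := by
        simp_rw [Finset.sum_comm (s := Finset.univ (α := Fin (Module.finrank ℝ E)))
          (t := Finset.univ (α := κ))]
    _ = _ := by
        refine Finset.sum_congr rfl fun a _ => ?_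
        rw [hbf a]
        simp only [map_sum, map_smul, LinearMap.sum_apply, LinearMap.smul_apply, Finset.smul_sum,
          smul_smul]
        rw [Finset.sum_comm]
        refine Finset.sum_congr rfl fun i _ => Finset.sum_congr rfl fun j _ => ?_
        rw [mul_comm]

theorem exists_orthonormal_frame (L : E →L[ℝ] V) (hL : Function.Injective L) :
    ∃ b : Module.Basis (Fin (Module.finrank ℝ E)) ℝ E, Orthonormal ℝ (fun a => L (b a)) := by
  let e : E ≃ₗ[ℝ] LinearMap.range (L : E →ₗ[ℝ] V) := LinearEquiv.ofInjective _ hL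
  have hfin : Module.finrank ℝ (LinearMap.range (L : E →ₗ[ℝ] V)) = Module.finrank ℝ E :=
    e.symm.finrank_eq
  let o : OrthonormalBasis (Fin (Module.finrank ℝ E)) ℝ (LinearMap.range (L : E →ₗ[ℝ] V)) :=
    (stdOrthonormalBasis ℝ _).reindex (finCongr hfin)
  refine ⟨o.toBasis.map e.symm, ?_⟩
  have h : (fun a => L (o.toBasis.map e.symm a)) = fun a => ((o a : _) : V) := by
    funext a
    rw [Module.Basis.map_apply, OrthonormalBasis.coe_toBasis]
    exact congrArg Subtype.val (e.apply_symm_apply (o a))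
  rw [h]
  exact o.orthonormal.comp_linearIsometry (Submodule.subtypeₗᵢ _)

theorem frameTrace_of_subsingleton [Subsingleton E] (L : E →L[ℝ] V)
    (B : E →ₗ[ℝ] E →ₗ[ℝ] W) : frameTrace L B = 0 := by
  refine Finset.sum_eq_zero fun i _ => Finset.sum_eq_zero fun j _ => ?_
  rw [Subsingleton.elim (Module.finBasis ℝ E i) 0]
  simp

theorem frameTrace_add (L : E →L[ℝ] V) (B B' : E →ₗ[ℝ] E →ₗ[ℝ] W) :
    frameTrace L (B + B') = frameTrace L B + frameTrace L B' := by
  simp [frameTrace, Finset.sum_add_distrib]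

theorem frameTrace_smul (L : E →L[ℝ] V) (c : ℝ) (B : E →ₗ[ℝ] E →ₗ[ℝ] W) :
    frameTrace L (c • B) = c • frameTrace L B := by
  simp only [frameTrace, LinearMap.smul_apply, Finset.smul_sum]
  refine Finset.sum_congr rfl fun i _ => Finset.sum_congr rfl fun j _ => ?_
  rw [smul_comm]

theorem map_frameTrace (L : E →L[ℝ] V) (T : W →ₗ[ℝ] W') (B : E →ₗ[ℝ] E →ₗ[ℝ] W) :
    T (frameTrace L B) = frameTrace L (B.compr₂ T) := by
  simp [frameTrace]

theorem frameTrace_scale (L : E →L[ℝ] V) (L' : E →L[ℝ] V') (hL' : Function.Injective L')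
    {c : ℝ} (hc : 0 < c ∨ Subsingleton E)
    (h : ∀ u v, inner ℝ (L u) (L v) = c * inner ℝ (L' u) (L' v)) (B : E →ₗ[ℝ] E →ₗ[ℝ] W) :
    frameTrace L B = c⁻¹ • frameTrace L' B := by
  rcases hc with hc | hs
  · obtain ⟨b, hb⟩ := exists_orthonormal_frame L' hL'
    have hs : 0 < Real.sqrt c := Real.sqrt_pos.2 hc
    have hs2 : (Real.sqrt c)⁻¹ * (Real.sqrt c)⁻¹ = c⁻¹ := by
      rw [← mul_inv, Real.mul_self_sqrt hc.le]
    let b' := b.isUnitSMul (w := fun _ => (Real.sqrt c)⁻¹)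
      (fun _ => (isUnit_iff_ne_zero.2 (inv_pos.2 hs).ne'))
    have hb' : ∀ i, b' i = (Real.sqrt c)⁻¹ • b i := fun i => b.isUnitSMul_apply _ i
    rw [frameTrace_eq_sum L' B b hb, frameTrace_eq_sum L B b', Finset.smul_sum]
    · refine Finset.sum_congr rfl fun i _ => ?_
      rw [hb']
      simp [smul_smul, hs2]
    · rw [orthonormal_iff_ite] at hb ⊢
      intro i j
      rw [h, hb', hb']
      simp only [map_smul, inner_smul_left, inner_smul_right, hb]
      split_ifs
      · simp only [conj_trivial, mul_one, hs2]
        exact mul_inv_cancel₀ hc.ne'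
      · simp
  · simp [frameTrace_of_subsingleton]

theorem frameTrace_real (L : ℝ →L[ℝ] V) (hL : L 1 ≠ 0) (B : ℝ →ₗ[ℝ] ℝ →ₗ[ℝ] W) :
    frameTrace L B = (‖L 1‖ ^ 2)⁻¹ • B 1 1 := by
  have hB : frameTrace (ContinuousLinearMap.id ℝ ℝ) B = B 1 1 := by
    rw [frameTrace_eq_sum _ B (Module.Basis.singleton Unit ℝ)]
    · simp
    · rw [orthonormal_iff_ite]
      intro i j
      simp
  rw [frameTrace_scale L (ContinuousLinearMap.id ℝ ℝ) Function.injective_id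
    (c := ‖L 1‖ ^ 2) (Or.inl (by positivity)) _ B, hB]
  intro u v
  have : ∀ u, L u = u • L 1 := fun u => by rw [← map_smul]; simp
  rw [this u, this v, inner_smul_left, inner_smul_right, real_inner_self_eq_norm_sq]
  simp
  ring

theorem frameTrace_prod (L : E × E' →L[ℝ] V) (hL : Function.Injective L)
    (h : ∀ u v, inner ℝ (L (u, 0)) (L (0, v)) = 0)
    (B : E × E' →ₗ[ℝ] E × E' →ₗ[ℝ] W) :
    frameTrace L B =
      frameTrace (L.comp (ContinuousLinearMap.inl ℝ E E'))
        (B.compl₁₂ (LinearMap.inl ℝ E E') (LinearMap.inl ℝ E E')) +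
      frameTrace (L.comp (ContinuousLinearMap.inr ℝ E E'))
        (B.compl₁₂ (LinearMap.inr ℝ E E') (LinearMap.inr ℝ E E')) := by
  obtain ⟨b, hb⟩ := exists_orthonormal_frame (L.comp (ContinuousLinearMap.inl ℝ E E'))
    (hL.comp (Prod.mk_left_injective _))
  obtain ⟨b', hb'⟩ := exists_orthonormal_frame (L.comp (ContinuousLinearMap.inr ℝ E E'))
    (hL.comp (Prod.mk_right_injective _))
  rw [frameTrace_eq_sum _ _ b hb, frameTrace_eq_sum _ _ b' hb',
    frameTrace_eq_sum _ _ (b.prod b'), Fintype.sum_sum_type]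
  · simp
  · rw [orthonormal_iff_ite] at hb hb' ⊢
    rintro (i | i) (j | j)
    · simpa using hb i j
    · simpa using h (b i) (b' j)
    · simpa [real_inner_comm] using h (b j) (b' i)
    · simpa using hb' i j

/-- The bilinear form `⟨A u, L v⟩`. -/
def pairing (A L : E →L[ℝ] V) : E →ₗ[ℝ] E →ₗ[ℝ] ℝ :=
  LinearMap.mk₂ ℝ (fun u v => inner ℝ (A u) (L v))
    (fun u u' v => by simp [inner_add_left]) (fun c u v => by simp [inner_smul_left])
    (fun u v v' => by simp [inner_add_right]) (fun c u v => by simp [inner_smul_right])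

@[simp] theorem pairing_apply (A L : E →L[ℝ] V) (u v : E) :
    pairing A L u v = inner ℝ (A u) (L v) := rfl

theorem frameTrace_pairing_self (L : E →L[ℝ] V) (hL : Function.Injective L) :
    frameTrace L (pairing L L) = Module.finrank ℝ E := by
  obtain ⟨b, hb⟩ := exists_orthonormal_frame L hL
  rw [frameTrace_eq_sum _ _ b hb]
  simp [hb.1]

/-- The bilinear map `⟨w, L u⟩ v`, whose trace is mapped by `L` to the tangential part of `w`. -/
def tangentForm (L : E →L[ℝ] V) (w : V) : E →ₗ[ℝ] E →ₗ[ℝ] E :=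
  LinearMap.mk₂ ℝ (fun u v => (inner ℝ w (L u) : ℝ) • v)
    (fun u u' v => by simp [inner_add_right, add_smul])
    (fun c u v => by simp [inner_smul_right, mul_smul])
    (fun u v v' => by simp) (fun c u v => smul_comm _ _ _)

@[simp] theorem tangentForm_apply (L : E →L[ℝ] V) (w : V) (u v : E) :
    tangentForm L w u v = (inner ℝ w (L u) : ℝ) • v := rfl

theorem inner_tangentForm (L : E →L[ℝ] V) (hL : Function.Injective L) (w : V) (v : E) :
    inner ℝ (L (frameTrace L (tangentForm L w))) (L v) = inner ℝ w (L v) := by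
  obtain ⟨b, hb⟩ := exists_orthonormal_frame L hL
  rw [frameTrace_eq_sum _ _ b hb]
  obtain ⟨c, rfl⟩ : ∃ c : Fin (Module.finrank ℝ E) → ℝ, v = ∑ i, c i • b i :=
    ⟨fun i => b.repr v i, (b.sum_repr v).symm⟩
  simp only [tangentForm_apply, map_sum, map_smul, inner_sum, inner_smul_right]
  refine Finset.sum_congr rfl fun i _ => ?_
  congr 1
  simpa using hb.inner_left_fintype (fun a => inner ℝ w (L (b a))) i

end FrameTrace

section Differentiability

variable {X : Type*} [NormedAddCommGroup X] [NormedSpace ℝ X]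

theorem differentiableAt_det {κ : Type*} [Fintype κ] [DecidableEq κ] {A : X → Matrix κ κ ℝ}
    {x : X} (hA : ∀ i j, DifferentiableAt ℝ (fun x => A x i j) x) :
    DifferentiableAt ℝ (fun x => (A x).det) x := by
  simp only [Matrix.det_apply]
  refine DifferentiableAt.fun_sum fun σ _ => DifferentiableAt.const_smul ?_ _
  exact (HasFDerivAt.finsetProd fun i _ => (hA (σ i) i).hasFDerivAt).differentiableAt

theorem differentiableAt_inv_apply {κ : Type*} [Fintype κ] [DecidableEq κ]
    {A : X → Matrix κ κ ℝ} {x : X} (hA : ∀ i j, DifferentiableAt ℝ (fun x => A x i j) x)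
    (h : IsUnit (A x).det) (i j : κ) : DifferentiableAt ℝ (fun x => (A x)⁻¹ i j) x := by
  simp only [Matrix.inv_def, Matrix.smul_apply, Matrix.adjugate_apply, Ring.inverse_eq_inv',
    smul_eq_mul]
  refine ((differentiableAt_det hA).inv h.ne_zero).mul (differentiableAt_det fun k l => ?_)
  simp only [Matrix.updateRow_apply]
  split_ifs
  · exact differentiableAt_const _
  · exact hA k l

variable {E : Type*} [NormedAddCommGroup E] [NormedSpace ℝ E] [FiniteDimensional ℝ E]
  {V : Type*} [NormedAddCommGroup V] [InnerProductSpace ℝ V]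
  {W : Type*} [NormedAddCommGroup W] [NormedSpace ℝ W]

theorem differentiableAt_frameTrace {L : X → E →L[ℝ] V} {B : X → E →ₗ[ℝ] E →ₗ[ℝ] W} {x : X}
    (hL : DifferentiableAt ℝ L x) (hinj : Function.Injective (L x))
    (hB : ∀ u v, DifferentiableAt ℝ (fun x => B x u v) x) :
    DifferentiableAt ℝ (fun x => frameTrace (L x) (B x)) x := by
  refine DifferentiableAt.fun_sum fun i _ => DifferentiableAt.fun_sum fun j _ =>
    DifferentiableAt.smul (differentiableAt_inv_apply (fun k l => ?_) ?_ i j) (hB _ _)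
  · exact (hL.clm_apply (differentiableAt_const _)).inner ℝ
      (hL.clm_apply (differentiableAt_const _))
  · have hli : LinearIndependent ℝ (fun i => L x (Module.finBasis ℝ E i)) :=
      (Module.finBasis ℝ E).linearIndependent.map' (L x : E →ₗ[ℝ] V)
        (LinearMap.ker_eq_bot.2 hinj)
    exact (Matrix.posDef_gram_iff_linearIndependent.2 hli).det_pos.ne'.isUnit

end Differentiability

section Hermitian

variable {ι : Type*} [Fintype ι]

theorem inner_real_eq_re (x y : CSpace ι) : inner ℝ x y = (inner ℂ x y).re := by
  simp [PiLp.inner_apply]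

theorem inner_I_smul_left (x y : CSpace ι) :
    inner ℝ (Complex.I • x) y = (inner ℂ x y).im := by
  rw [inner_real_eq_re, inner_smul_left]
  simp

theorem inner_I_smul_right (x y : CSpace ι) :
    inner ℝ x (Complex.I • y) = -(inner ℂ x y).im := by
  rw [inner_real_eq_re, inner_smul_right]
  simp

end Hermitian

section LocalLegendrian

set_option linter.unusedSectionVars false

variable {E : Type*} [NormedAddCommGroup E] [NormedSpace ℝ E] [FiniteDimensional ℝ E]
  {ι : Type*} [Fintype ι]

/-- A Legendrian immersion into the unit sphere, defined on an open set of the coordinate space. -/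
structure IsLocalLegendrian (f : E → CSpace ι) (U : Set E) : Prop where
  isOpen : IsOpen U
  smooth : ContDiffOn ℝ ∞ f U
  norm_eq : ∀ y ∈ U, ‖f y‖ = 1
  immersion : ∀ y ∈ U, Function.Injective (fderiv ℝ f y)
  legendrian : ∀ y ∈ U, ∀ v, inner ℝ (fderiv ℝ f y v) (Complex.I • f y) = 0

/-- The second derivative as a bilinear map. -/
def hessian (f : E → CSpace ι) (y : E) : E →ₗ[ℝ] E →ₗ[ℝ] CSpace ι :=
  (fderiv ℝ (fderiv ℝ f) y).toLinearMap₁₂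

@[simp] theorem hessian_apply (f : E → CSpace ι) (y u v : E) :
    hessian f y u v = fderiv ℝ (fderiv ℝ f) y u v := rfl

/-- The trace of the second derivative in the induced metric. -/
def hessianTrace (f : E → CSpace ι) (y : E) : CSpace ι :=
  frameTrace (fderiv ℝ f y) (hessian f y)

/-- The trace of the spherical second fundamental form. -/
def sphericalTrace (f : E → CSpace ι) (y : E) : CSpace ι :=
  (tangentPlane f y ⊔ Submodule.span ℝ {f y})ᗮ.starProjection (hessianTrace f y)

theorem euclideanMeanCurvature_eq (f : E → CSpace ι) (y : E) :
    euclideanMeanCurvature f y = (Module.finrank ℝ E : ℝ)⁻¹ •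
      (tangentPlane f y)ᗮ.starProjection (hessianTrace f y) := by
  simp only [euclideanMeanCurvature, hessianTrace]
  congr 1
  exact (map_frameTrace (fderiv ℝ f y)
    ((tangentPlane f y)ᗮ.starProjection : CSpace ι →ₗ[ℝ] CSpace ι) (hessian f y)).symm

theorem sphericalMeanCurvature_eq (f : E → CSpace ι) (y : E) :
    sphericalMeanCurvature f y = (Module.finrank ℝ E : ℝ)⁻¹ • sphericalTrace f y := by
  simp only [sphericalMeanCurvature, sphericalTrace, hessianTrace]
  congr 1
  exact (map_frameTrace (fderiv ℝ f y)
    ((tangentPlane f y ⊔ Submodule.span ℝ {f y})ᗮ.starProjection : CSpace ι →ₗ[ℝ] CSpace ι)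
    (hessian f y)).symm

theorem sphericalTrace_eq_smul (f : E → CSpace ι) (y : E) :
    sphericalTrace f y = (Module.finrank ℝ E : ℝ) • sphericalMeanCurvature f y := by
  rw [sphericalMeanCurvature_eq, smul_smul]
  rcases eq_or_ne (Module.finrank ℝ E) 0 with h | h
  · have : Subsingleton E := Module.finrank_zero_iff.1 h
    simp [sphericalTrace, hessianTrace, frameTrace_of_subsingleton]
  · rw [mul_inv_cancel₀ (by exact_mod_cast h), one_smul]

namespace IsLocalLegendrian

variable {f : E → CSpace ι} {U : Set E} {y : E}

theorem contDiffAt (h : IsLocalLegendrian f U) (hy : y ∈ U) : ContDiffAt ℝ ∞ f y :=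
  h.smooth.contDiffAt (h.isOpen.mem_nhds hy)

theorem hasFDerivAt (h : IsLocalLegendrian f U) (hy : y ∈ U) :
    HasFDerivAt f (fderiv ℝ f y) y :=
  ((h.contDiffAt hy).differentiableAt (by simp)).hasFDerivAt

theorem contDiffAt_fderiv (h : IsLocalLegendrian f U) (hy : y ∈ U) :
    ContDiffAt ℝ ∞ (fderiv ℝ f) y :=
  (h.contDiffAt hy).fderiv_right (by simp)

theorem hasFDerivAt_fderiv (h : IsLocalLegendrian f U) (hy : y ∈ U) (v : E) :
    HasFDerivAt (fun y => fderiv ℝ f y v) ((fderiv ℝ (fderiv ℝ f) y).flip v) y := by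
  have := ((h.contDiffAt_fderiv hy).differentiableAt (by simp)).hasFDerivAt.clm_apply
    (hasFDerivAt_const v y)
  rwa [ContinuousLinearMap.comp_zero, zero_add] at this

theorem hessian_symm (h : IsLocalLegendrian f U) (hy : y ∈ U) (u v : E) :
    fderiv ℝ (fderiv ℝ f) y u v = fderiv ℝ (fderiv ℝ f) y v u :=
  (h.contDiffAt hy).isSymmSndFDerivAt (by rw [minSmoothness_of_isRCLikeNormedField]; exact WithTop.coe_le_coe.2 (OrderTop.le_top (2 : ℕ∞))) u v

theorem inner_self_eq (h : IsLocalLegendrian f U) (hy : y ∈ U) : inner ℂ (f y) (f y) = 1 := by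
  rw [inner_self_eq_norm_sq_to_K, h.norm_eq y hy]
  simp

theorem inner_fderiv_self (h : IsLocalLegendrian f U) (hy : y ∈ U) (v : E) :
    inner ℂ (fderiv ℝ f y v) (f y) = 0 := by
  have h1 : inner ℝ (fderiv ℝ f y v) (f y) = 0 := by
    have hd := ((h.hasFDerivAt hy).inner ℝ (h.hasFDerivAt hy))
    have he : (fun t => inner ℝ (f t) (f t)) =ᶠ[nhds y] fun _ => (1 : ℝ) := by
      filter_upwards [h.isOpen.mem_nhds hy] with z hz
      rw [real_inner_self_eq_norm_sq, h.norm_eq z hz, one_pow]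
    have := DFunLike.congr_fun ((hd.congr_of_eventuallyEq he.symm).unique
      (hasFDerivAt_const (1 : ℝ) y)) v
    simp [fderivInnerCLM_apply, real_inner_comm] at this
    linarith [real_inner_comm (f y) (fderiv ℝ f y v)]
  have h2 := h.legendrian y hy v
  rw [inner_real_eq_re] at h1
  rw [inner_I_smul_right] at h2
  exact Complex.ext h1 (by simpa using h2)

theorem inner_self_fderiv (h : IsLocalLegendrian f U) (hy : y ∈ U) (v : E) :
    inner ℂ (f y) (fderiv ℝ f y v) = 0 := by
  rw [← inner_conj_symm, h.inner_fderiv_self hy, map_zero]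

theorem inner_hessian_self (h : IsLocalLegendrian f U) (hy : y ∈ U) (u v : E) :
    inner ℂ (fderiv ℝ (fderiv ℝ f) y u v) (f y) =
      -inner ℂ (fderiv ℝ f y v) (fderiv ℝ f y u) := by
  have hd := (h.hasFDerivAt_fderiv hy v).inner ℂ (h.hasFDerivAt hy)
  have he : (fun t => inner ℂ (fderiv ℝ f t v) (f t)) =ᶠ[nhds y] fun _ => (0 : ℂ) := by
    filter_upwards [h.isOpen.mem_nhds hy] with z hz using h.inner_fderiv_self hz v
  have := DFunLike.congr_fun ((hd.congr_of_eventuallyEq he.symm).unique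
    (hasFDerivAt_const (0 : ℂ) y)) u
  simp [fderivInnerCLM_apply] at this
  linear_combination this

theorem inner_fderiv_fderiv (h : IsLocalLegendrian f U) (hy : y ∈ U) (u v : E) :
    inner ℂ (fderiv ℝ f y u) (fderiv ℝ f y v) =
      (inner ℝ (fderiv ℝ f y u) (fderiv ℝ f y v) : ℝ) := by
  have h1 := h.inner_hessian_self hy u v
  rw [h.hessian_symm hy, h.inner_hessian_self hy, neg_inj] at h1
  refine Complex.ext (by simp [inner_real_eq_re]) ?_
  have h2 := congrArg Complex.im (inner_conj_symm (𝕜 := ℂ) (fderiv ℝ f y u) (fderiv ℝ f y v))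
  rw [← h1, Complex.conj_im] at h2
  simp only [Complex.ofReal_im]
  linarith

theorem inner_hessian_fderiv_im (h : IsLocalLegendrian f U) (hy : y ∈ U) (u v w : E) :
    (inner ℂ (fderiv ℝ (fderiv ℝ f) y u v) (fderiv ℝ f y w)).im =
      (inner ℂ (fderiv ℝ (fderiv ℝ f) y u w) (fderiv ℝ f y v)).im := by
  have hd := (h.hasFDerivAt_fderiv hy v).inner ℂ (h.hasFDerivAt_fderiv hy w)
  have hd' := Complex.imCLM.hasFDerivAt.comp y hd
  have he : Complex.imCLM ∘ (fun t => inner ℂ (fderiv ℝ f t v) (fderiv ℝ f t w)) =ᶠ[nhds y]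
      fun _ => (0 : ℝ) := by
    filter_upwards [h.isOpen.mem_nhds hy] with z hz
    simp [h.inner_fderiv_fderiv hz]
  have := DFunLike.congr_fun ((hd'.congr_of_eventuallyEq he.symm).unique
    (hasFDerivAt_const (0 : ℝ) y)) u
  simp [fderivInnerCLM_apply] at this
  have h2 := congrArg Complex.im
    (inner_conj_symm (𝕜 := ℂ) (fderiv ℝ f y v) (fderiv ℝ (fderiv ℝ f) y u w))
  rw [Complex.conj_im] at h2
  linarith

theorem inner_hessianTrace_self (h : IsLocalLegendrian f U) (hy : y ∈ U) :
    inner ℂ (hessianTrace f y) (f y) = -(Module.finrank ℝ E : ℂ) := by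
  obtain ⟨b, hb⟩ := exists_orthonormal_frame _ (h.immersion y hy)
  rw [hessianTrace, frameTrace_eq_sum _ _ b hb, sum_inner]
  simp [h.inner_hessian_self hy, hb.1]

theorem sphericalTrace_eq (h : IsLocalLegendrian f U) (hy : y ∈ U) :
    sphericalTrace f y = hessianTrace f y + (Module.finrank ℝ E : ℝ) • f y -
      fderiv ℝ f y (frameTrace (fderiv ℝ f y)
        (tangentForm (fderiv ℝ f y) (hessianTrace f y))) := by
  have hτ := h.inner_hessianTrace_self hy
  have hn := h.norm_eq y hy
  refine Submodule.eq_starProjection_of_mem_orthogonal'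
    (z := fderiv ℝ f y (frameTrace (fderiv ℝ f y)
        (tangentForm (fderiv ℝ f y) (hessianTrace f y))) - (Module.finrank ℝ E : ℝ) • f y) ?_
    (Submodule.le_orthogonal_orthogonal _ ?_) (by abel)
  · rw [← Submodule.inf_orthogonal, Submodule.mem_inf]
    constructor
    · rw [Submodule.mem_orthogonal']
      rintro _ ⟨v, rfl⟩
      simp only [ContinuousLinearMap.coe_coe, inner_sub_left, inner_add_left,
        inner_tangentForm _ (h.immersion y hy), inner_smul_left]
      rw [inner_real_eq_re (f y), h.inner_self_fderiv hy]
      simp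
    · rw [Submodule.mem_orthogonal_singleton_iff_inner_left]
      simp only [inner_sub_left, inner_add_left, inner_smul_left,
        real_inner_self_eq_norm_sq, hn]
      rw [inner_real_eq_re, inner_real_eq_re, h.inner_fderiv_self hy, hτ]
      simp
  · exact Submodule.sub_mem _ (Submodule.mem_sup_left ⟨_, rfl⟩)
      (Submodule.mem_sup_right (Submodule.smul_mem _ _ (Submodule.mem_span_singleton_self _)))

theorem inner_sphericalTrace_self (h : IsLocalLegendrian f U) (hy : y ∈ U) :
    inner ℂ (sphericalTrace f y) (f y) = 0 := by
  rw [h.sphericalTrace_eq hy, inner_sub_left, inner_add_left, h.inner_hessianTrace_self hy,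
    h.inner_fderiv_self hy, RCLike.real_smul_eq_coe_smul (K := ℂ), inner_smul_left,
    h.inner_self_eq hy]
  simp

theorem inner_sphericalTrace_fderiv (h : IsLocalLegendrian f U) (hy : y ∈ U) (v : E) :
    inner ℝ (sphericalTrace f y) (fderiv ℝ f y v) = 0 := by
  rw [h.sphericalTrace_eq hy, inner_sub_left, inner_add_left,
    inner_tangentForm _ (h.immersion y hy), inner_smul_left, inner_real_eq_re (f y),
    h.inner_self_fderiv hy]
  simp

theorem differentiableAt_sphericalTrace (h : IsLocalLegendrian f U) (hy : y ∈ U) :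
    DifferentiableAt ℝ (sphericalTrace f) y := by
  have hD : DifferentiableAt ℝ (fderiv ℝ f) y :=
    (h.contDiffAt_fderiv hy).differentiableAt (by simp)
  have hD2 : DifferentiableAt ℝ (fderiv ℝ (fderiv ℝ f)) y :=
    ((h.contDiffAt_fderiv hy).fderiv_right (m := ∞) (by simp)).differentiableAt (by simp)
  have hτ : DifferentiableAt ℝ (hessianTrace f) y := by
    refine differentiableAt_frameTrace hD (h.immersion y hy) fun u v => ?_
    simp only [hessian_apply]
    exact (hD2.clm_apply (differentiableAt_const u)).clm_apply (differentiableAt_const v)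
  have key : DifferentiableAt ℝ (fun y => hessianTrace f y + (Module.finrank ℝ E : ℝ) • f y -
      fderiv ℝ f y (frameTrace (fderiv ℝ f y)
        (tangentForm (fderiv ℝ f y) (hessianTrace f y)))) y := by
    have hT : DifferentiableAt ℝ (fun y => frameTrace (fderiv ℝ f y)
        (tangentForm (fderiv ℝ f y) (hessianTrace f y))) y := by
      refine differentiableAt_frameTrace hD (h.immersion y hy) fun u v => ?_
      have h1 : DifferentiableAt ℝ (fun y => (inner ℝ (hessianTrace f y) (fderiv ℝ f y u) : ℝ)) y :=
        DifferentiableAt.inner ℝ hτ (h.hasFDerivAt_fderiv hy u).differentiableAt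
      exact h1.smul_const v
    have hf : DifferentiableAt ℝ (fun y => (Module.finrank ℝ E : ℝ) • f y) y :=
      (h.hasFDerivAt hy).differentiableAt.fun_const_smul _
    exact (hτ.add hf).sub (hD.clm_apply hT)
  refine key.congr_of_eventuallyEq ?_
  filter_upwards [h.isOpen.mem_nhds hy] with z hz using h.sphericalTrace_eq hz

end IsLocalLegendrian

end LocalLegendrian

section Pair

set_option linter.unusedSectionVars false

variable {ι₁ ι₂ : Type*} [Fintype ι₁] [Fintype ι₂]

theorem inner_pair (v v' : CSpace ι₁) (w w' : CSpace ι₂) :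
    inner ℂ (pair v w) (pair v' w') = inner ℂ v v' + inner ℂ w w' := by
  simp [pair, PiLp.inner_apply, Fintype.sum_sum_type]

theorem inner_real_pair (v v' : CSpace ι₁) (w w' : CSpace ι₂) :
    inner ℝ (pair v w) (pair v' w') = inner ℝ v v' + inner ℝ w w' := by
  simp [inner_real_eq_re, inner_pair]

@[simp] theorem pair_inl (v : CSpace ι₁) (w : CSpace ι₂) (k : ι₁) :
    pair v w (Sum.inl k) = v k := rfl

@[simp] theorem pair_inr (v : CSpace ι₁) (w : CSpace ι₂) (k : ι₂) :
    pair v w (Sum.inr k) = w k := rfl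

theorem pair_ext {x y : CSpace (ι₁ ⊕ ι₂)} (h₁ : ∀ k, x (Sum.inl k) = y (Sum.inl k))
    (h₂ : ∀ k, x (Sum.inr k) = y (Sum.inr k)) : x = y := by
  ext (k | k)
  exacts [h₁ k, h₂ k]

theorem pair_add (v v' : CSpace ι₁) (w w' : CSpace ι₂) :
    pair (v + v') (w + w') = pair v w + pair v' w' :=
  pair_ext (fun _ => by simp) (fun _ => by simp)

theorem pair_real_smul (c : ℝ) (v : CSpace ι₁) (w : CSpace ι₂) :
    pair (c • v) (c • w) = c • pair v w :=
  pair_ext (fun _ => by simp) (fun _ => by simp)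

/-- The map `pair` as a continuous linear map. -/
def pairCLM (ι₁ ι₂ : Type*) [Fintype ι₁] [Fintype ι₂] :
    CSpace ι₁ × CSpace ι₂ →L[ℝ] CSpace (ι₁ ⊕ ι₂) :=
  LinearMap.toContinuousLinearMap
    { toFun := fun x => pair x.1 x.2
      map_add' := fun _ _ => pair_add _ _ _ _
      map_smul' := fun _ _ => pair_real_smul _ _ _ }

@[simp] theorem pairCLM_apply (x : CSpace ι₁ × CSpace ι₂) :
    pairCLM ι₁ ι₂ x = pair x.1 x.2 := rfl

end Pair

section Warped

set_option linter.unusedSectionVars false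

variable {E₁ : Type*} [NormedAddCommGroup E₁] [NormedSpace ℝ E₁]
  {E₂ : Type*} [NormedAddCommGroup E₂] [NormedSpace ℝ E₂]
  {ι₁ ι₂ : Type*} [Fintype ι₁] [Fintype ι₂]

/-- The map `(s, t, y₁, y₂) ↦ (a(s) c₁(t) f₁(y₁), a(s) c₂(t) f₂(y₂))`. -/
def warped (a : ℝ → ℝ) (c₁ c₂ : ℝ → ℂ) (f₁ : E₁ → CSpace ι₁) (f₂ : E₂ → CSpace ι₂) :
    ℝ × ℝ × E₁ × E₂ → CSpace (ι₁ ⊕ ι₂) :=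
  fun p => pair (((a p.1 : ℂ) * c₁ p.2.1) • f₁ p.2.2.1) (((a p.1 : ℂ) * c₂ p.2.1) • f₂ p.2.2.2)

/-- The derivative of one component of `warped`. -/
def componentDeriv {E : Type*} [NormedAddCommGroup E] [NormedSpace ℝ E] {ι : Type*} [Fintype ι]
    (a a' : ℝ) (c c' : ℂ) (x : CSpace ι) (L : E →L[ℝ] CSpace ι) :
    ℝ × ℝ × E →L[ℝ] CSpace ι :=
  (ContinuousLinearMap.fst ℝ ℝ (ℝ × E)).smulRight (((a' : ℂ) * c) • x) +
    ((ContinuousLinearMap.fst ℝ ℝ E).comp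
      (ContinuousLinearMap.snd ℝ ℝ (ℝ × E))).smulRight (((a : ℂ) * c') • x) +
    ((a : ℂ) * c) • (L.comp ((ContinuousLinearMap.snd ℝ ℝ E).comp
      (ContinuousLinearMap.snd ℝ ℝ (ℝ × E))))

theorem componentDeriv_apply {E : Type*} [NormedAddCommGroup E] [NormedSpace ℝ E] {ι : Type*}
    [Fintype ι] (a a' : ℝ) (c c' : ℂ) (x : CSpace ι) (L : E →L[ℝ] CSpace ι) (v : ℝ × ℝ × E) :
    componentDeriv a a' c c' x L v =
      ((v.1 : ℂ) * a' * c + v.2.1 * a * c') • x + ((a : ℂ) * c) • L v.2.2 := by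
  simp only [componentDeriv, add_apply, ContinuousLinearMap.smulRight_apply,
    smul_apply, ContinuousLinearMap.comp_apply, ContinuousLinearMap.coe_fst',
    ContinuousLinearMap.coe_snd', RCLike.real_smul_eq_coe_smul (K := ℂ), smul_smul, add_smul]
  simp [mul_assoc]

theorem hasFDerivAt_component {E : Type*} [NormedAddCommGroup E] [NormedSpace ℝ E] {ι : Type*}
    [Fintype ι] {a : ℝ → ℝ} {c : ℝ → ℂ} {f : E → CSpace ι} {a' : ℝ} {c' : ℂ}
    {L : E →L[ℝ] CSpace ι} {s t : ℝ} {y : E} (ha : HasDerivAt a a' s) (hc : HasDerivAt c c' t)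
    (hf : HasFDerivAt f L y) :
    HasFDerivAt (fun p : ℝ × ℝ × E => ((a p.1 : ℂ) * c p.2.1) • f p.2.2)
      (componentDeriv (a s) a' (c t) c' (f y) L) (s, t, y) := by
  have h1 : HasFDerivAt (fun p : ℝ × ℝ × E => (a p.1 : ℂ))
      (Complex.ofRealCLM.comp ((ContinuousLinearMap.toSpanSingleton ℝ a').comp
        (ContinuousLinearMap.fst ℝ ℝ (ℝ × E)))) (s, t, y) :=
    Complex.ofRealCLM.hasFDerivAt.comp _ (ha.hasFDerivAt.comp (s, t, y) hasFDerivAt_fst)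
  have h2 : HasFDerivAt (fun p : ℝ × ℝ × E => c p.2.1)
      ((ContinuousLinearMap.toSpanSingleton ℝ c').comp ((ContinuousLinearMap.fst ℝ ℝ E).comp
        (ContinuousLinearMap.snd ℝ ℝ (ℝ × E)))) (s, t, y) :=
    hc.hasFDerivAt.comp (s, t, y) (hasFDerivAt_fst.comp (s, t, y) hasFDerivAt_snd)
  have h3 : HasFDerivAt (fun p : ℝ × ℝ × E => f p.2.2)
      (L.comp ((ContinuousLinearMap.snd ℝ ℝ E).comp
        (ContinuousLinearMap.snd ℝ ℝ (ℝ × E)))) (s, t, y) :=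
    hf.comp (s, t, y) (hasFDerivAt_snd.comp (s, t, y) hasFDerivAt_snd)
  refine ((h1.mul h2).smul h3).congr_fderiv ?_
  refine ContinuousLinearMap.ext fun v => ?_
  rw [componentDeriv_apply]
  simp only [add_apply, smul_apply,
    ContinuousLinearMap.comp_apply, ContinuousLinearMap.smulRight_apply,
    ContinuousLinearMap.toSpanSingleton_apply, ContinuousLinearMap.coe_fst',
    ContinuousLinearMap.coe_snd', Complex.ofRealCLM_apply, smul_eq_mul, Complex.real_smul,
    Complex.ofReal_mul]
  rw [add_comm]
  congr 2
  ring

/-- The derivative of `warped`. -/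
def warpedDeriv (a a' : ℝ) (c₁ c₁' c₂ c₂' : ℂ) (x₁ : CSpace ι₁) (x₂ : CSpace ι₂)
    (L₁ : E₁ →L[ℝ] CSpace ι₁) (L₂ : E₂ →L[ℝ] CSpace ι₂) :
    ℝ × ℝ × E₁ × E₂ →L[ℝ] CSpace (ι₁ ⊕ ι₂) :=
  (pairCLM ι₁ ι₂).comp
    ((componentDeriv a a' c₁ c₁' x₁ (L₁.comp (ContinuousLinearMap.fst ℝ E₁ E₂))).prod
      (componentDeriv a a' c₂ c₂' x₂ (L₂.comp (ContinuousLinearMap.snd ℝ E₁ E₂))))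

theorem warpedDeriv_apply (a a' : ℝ) (c₁ c₁' c₂ c₂' : ℂ) (x₁ : CSpace ι₁) (x₂ : CSpace ι₂)
    (L₁ : E₁ →L[ℝ] CSpace ι₁) (L₂ : E₂ →L[ℝ] CSpace ι₂) (v : ℝ × ℝ × E₁ × E₂) :
    warpedDeriv a a' c₁ c₁' c₂ c₂' x₁ x₂ L₁ L₂ v =
      pair (((v.1 : ℂ) * a' * c₁ + v.2.1 * a * c₁') • x₁ + ((a : ℂ) * c₁) • L₁ v.2.2.1)
        (((v.1 : ℂ) * a' * c₂ + v.2.1 * a * c₂') • x₂ + ((a : ℂ) * c₂) • L₂ v.2.2.2) := by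
  simp [warpedDeriv, componentDeriv_apply]

theorem hasFDerivAt_warped {a : ℝ → ℝ} {c₁ c₂ : ℝ → ℂ} {f₁ : E₁ → CSpace ι₁}
    {f₂ : E₂ → CSpace ι₂} {a' : ℝ} {c₁' c₂' : ℂ} {L₁ : E₁ →L[ℝ] CSpace ι₁}
    {L₂ : E₂ →L[ℝ] CSpace ι₂} {p : ℝ × ℝ × E₁ × E₂} (ha : HasDerivAt a a' p.1)
    (hc₁ : HasDerivAt c₁ c₁' p.2.1) (hc₂ : HasDerivAt c₂ c₂' p.2.1)
    (hf₁ : HasFDerivAt f₁ L₁ p.2.2.1) (hf₂ : HasFDerivAt f₂ L₂ p.2.2.2) :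
    HasFDerivAt (warped a c₁ c₂ f₁ f₂)
      (warpedDeriv (a p.1) a' (c₁ p.2.1) c₁' (c₂ p.2.1) c₂' (f₁ p.2.2.1) (f₂ p.2.2.2) L₁ L₂) p := by
  have h1 : HasFDerivAt (fun q : E₁ × E₂ => f₁ q.1)
      (L₁.comp (ContinuousLinearMap.fst ℝ E₁ E₂)) p.2.2 := hf₁.comp p.2.2 hasFDerivAt_fst
  have h2 : HasFDerivAt (fun q : E₁ × E₂ => f₂ q.2)
      (L₂.comp (ContinuousLinearMap.snd ℝ E₁ E₂)) p.2.2 := hf₂.comp p.2.2 hasFDerivAt_snd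
  exact (pairCLM ι₁ ι₂).hasFDerivAt.comp p
    ((hasFDerivAt_component ha hc₁ h1).prodMk (hasFDerivAt_component ha hc₂ h2))

end Warped

section ConePoint

variable {E₁ : Type*} [NormedAddCommGroup E₁] [NormedSpace ℝ E₁]
  {E₂ : Type*} [NormedAddCommGroup E₂] [NormedSpace ℝ E₂]
  {ι₁ ι₂ : Type*} [Fintype ι₁] [Fintype ι₂]

/-- The first order data of a Legendrian immersion at a point. -/
structure IsLegendrianJet {E : Type*} [NormedAddCommGroup E] [NormedSpace ℝ E] {ι : Type*}
    [Fintype ι] (x : CSpace ι) (L : E →L[ℝ] CSpace ι) : Prop where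
  inner_self : inner ℂ x x = 1
  inner_left : ∀ u, inner ℂ (L u) x = 0
  inner_real : ∀ u v, inner ℂ (L u) (L v) = (inner ℝ (L u) (L v) : ℝ)
  injective : Function.Injective L

theorem IsLegendrianJet.inner_right {E : Type*} [NormedAddCommGroup E] [NormedSpace ℝ E]
    {ι : Type*} [Fintype ι] {x : CSpace ι} {L : E →L[ℝ] CSpace ι} (h : IsLegendrianJet x L)
    (u : E) : inner ℂ x (L u) = 0 := by
  rw [← inner_conj_symm, h.inner_left, map_zero]

theorem IsLocalLegendrian.jet {E : Type*} [NormedAddCommGroup E] [NormedSpace ℝ E]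
    [FiniteDimensional ℝ E] {ι : Type*} [Fintype ι] {f : E → CSpace ι} {U : Set E} {y : E}
    (h : IsLocalLegendrian f U) (hy : y ∈ U) : IsLegendrianJet (f y) (fderiv ℝ f y) :=
  ⟨h.inner_self_eq hy, h.inner_fderiv_self hy, h.inner_fderiv_fderiv hy, h.immersion y hy⟩

/-- The first order data at a point of a Legendrian curve in the unit sphere of `ℂ²`. -/
structure IsCurveJet (g₁ g₁' g₂ g₂' : ℂ) : Prop where
  norm_eq : ‖g₁‖ ^ 2 + ‖g₂‖ ^ 2 = 1
  legendrian : g₁' * (starRingEnd ℂ) g₁ + g₂' * (starRingEnd ℂ) g₂ = 0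

variable {s : ℝ} {g₁ g₁' g₂ g₂' : ℂ} {x₁ : CSpace ι₁} {x₂ : CSpace ι₂}
  {L₁ : E₁ →L[ℝ] CSpace ι₁} {L₂ : E₂ →L[ℝ] CSpace ι₂}

theorem inner_warpedDeriv (hg : IsCurveJet g₁ g₁' g₂ g₂') (h₁ : IsLegendrianJet x₁ L₁)
    (h₂ : IsLegendrianJet x₂ L₂) (u v : ℝ × ℝ × E₁ × E₂) :
    inner ℂ (warpedDeriv s 1 g₁ g₁' g₂ g₂' x₁ x₂ L₁ L₂ u)
      (warpedDeriv s 1 g₁ g₁' g₂ g₂' x₁ x₂ L₁ L₂ v) =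
      ((u.1 * v.1 + s ^ 2 * (‖g₁'‖ ^ 2 + ‖g₂'‖ ^ 2) * (u.2.1 * v.2.1) +
        s ^ 2 * ‖g₁‖ ^ 2 * inner ℝ (L₁ u.2.2.1) (L₁ v.2.2.1) +
        s ^ 2 * ‖g₂‖ ^ 2 * inner ℝ (L₂ u.2.2.2) (L₂ v.2.2.2) : ℝ) : ℂ) := by
  have e1 := congrArg (fun x : ℝ => (x : ℂ)) hg.norm_eq
  have e2 := hg.legendrian
  have e3 := congrArg (starRingEnd ℂ) hg.legendrian
  simp only [map_add, map_mul, Complex.conj_conj, map_zero] at e3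
  push_cast at e1
  rw [← Complex.conj_mul', ← Complex.conj_mul'] at e1
  rw [warpedDeriv_apply, warpedDeriv_apply, inner_pair]
  simp only [inner_add_left, inner_add_right, inner_smul_left, inner_smul_right, h₁.inner_self,
    h₂.inner_self, h₁.inner_left, h₂.inner_left, h₁.inner_right, h₂.inner_right, h₁.inner_real,
    h₂.inner_real]
  push_cast
  rw [← Complex.conj_mul' g₁, ← Complex.conj_mul' g₂, ← Complex.conj_mul' g₁',
    ← Complex.conj_mul' g₂']
  simp only [map_add, map_mul, Complex.conj_ofReal, map_one]
  linear_combination (u.1 * v.1 : ℂ) * e1 + (u.1 * v.2.1 * s : ℂ) * e2 +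
    (u.2.1 * v.1 * s : ℂ) * e3

theorem inner_real_warpedDeriv (hg : IsCurveJet g₁ g₁' g₂ g₂') (h₁ : IsLegendrianJet x₁ L₁)
    (h₂ : IsLegendrianJet x₂ L₂) (u v : ℝ × ℝ × E₁ × E₂) :
    inner ℝ (warpedDeriv s 1 g₁ g₁' g₂ g₂' x₁ x₂ L₁ L₂ u)
      (warpedDeriv s 1 g₁ g₁' g₂ g₂' x₁ x₂ L₁ L₂ v) =
      u.1 * v.1 + s ^ 2 * (‖g₁'‖ ^ 2 + ‖g₂'‖ ^ 2) * (u.2.1 * v.2.1) +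
        s ^ 2 * ‖g₁‖ ^ 2 * inner ℝ (L₁ u.2.2.1) (L₁ v.2.2.1) +
        s ^ 2 * ‖g₂‖ ^ 2 * inner ℝ (L₂ u.2.2.2) (L₂ v.2.2.2) := by
  rw [inner_real_eq_re, inner_warpedDeriv hg h₁ h₂, Complex.ofReal_re]

theorem warpedDeriv_isotropic (hg : IsCurveJet g₁ g₁' g₂ g₂') (h₁ : IsLegendrianJet x₁ L₁)
    (h₂ : IsLegendrianJet x₂ L₂) (u v : ℝ × ℝ × E₁ × E₂) :
    inner ℝ (Complex.I • warpedDeriv s 1 g₁ g₁' g₂ g₂' x₁ x₂ L₁ L₂ u)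
      (warpedDeriv s 1 g₁ g₁' g₂ g₂' x₁ x₂ L₁ L₂ v) = 0 := by
  rw [inner_I_smul_left, inner_warpedDeriv hg h₁ h₂, Complex.ofReal_im]

theorem warpedDeriv_injective (hg : IsCurveJet g₁ g₁' g₂ g₂') (h₁ : IsLegendrianJet x₁ L₁)
    (h₂ : IsLegendrianJet x₂ L₂) (hs : s ≠ 0) (hρ : ‖g₁'‖ ^ 2 + ‖g₂'‖ ^ 2 ≠ 0)
    (hg₁ : g₁ ≠ 0 ∨ Subsingleton E₁) (hg₂ : g₂ ≠ 0 ∨ Subsingleton E₂) :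
    Function.Injective (warpedDeriv s 1 g₁ g₁' g₂ g₂' x₁ x₂ L₁ L₂) := by
  rw [injective_iff_map_eq_zero]
  rintro v hv
  have h := inner_real_warpedDeriv (s := s) hg h₁ h₂ v v
  rw [hv, inner_zero_left] at h
  have hs2 : 0 < s ^ 2 := by positivity
  have hρ' : 0 < ‖g₁'‖ ^ 2 + ‖g₂'‖ ^ 2 := lt_of_le_of_ne (by positivity) hρ.symm
  have t2 : 0 ≤ s ^ 2 * (‖g₁'‖ ^ 2 + ‖g₂'‖ ^ 2) * (v.2.1 * v.2.1) :=
    mul_nonneg (by positivity) (mul_self_nonneg _)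
  have t3 : 0 ≤ s ^ 2 * ‖g₁‖ ^ 2 * inner ℝ (L₁ v.2.2.1) (L₁ v.2.2.1) :=
    mul_nonneg (by positivity) real_inner_self_nonneg
  have t4 : 0 ≤ s ^ 2 * ‖g₂‖ ^ 2 * inner ℝ (L₂ v.2.2.2) (L₂ v.2.2.2) :=
    mul_nonneg (by positivity) real_inner_self_nonneg
  have t1 := mul_self_nonneg v.1
  have z1 : v.1 = 0 := mul_self_eq_zero.1 (by linarith)
  have z2 : v.2.1 = 0 := by
    have : s ^ 2 * (‖g₁'‖ ^ 2 + ‖g₂'‖ ^ 2) * (v.2.1 * v.2.1) = 0 := by linarith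
    exact mul_self_eq_zero.1 ((mul_eq_zero.1 this).resolve_left (mul_pos hs2 hρ').ne')
  have z3 : v.2.2.1 = 0 := by
    rcases hg₁ with hg₁ | hg₁
    · have : s ^ 2 * ‖g₁‖ ^ 2 * inner ℝ (L₁ v.2.2.1) (L₁ v.2.2.1) = 0 := by linarith
      have := (mul_eq_zero.1 this).resolve_left (by positivity)
      exact h₁.injective (by rw [inner_self_eq_zero.1 this, map_zero])
    · exact Subsingleton.elim _ _
  have z4 : v.2.2.2 = 0 := by
    rcases hg₂ with hg₂ | hg₂
    · have : s ^ 2 * ‖g₂‖ ^ 2 * inner ℝ (L₂ v.2.2.2) (L₂ v.2.2.2) = 0 := by linarith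
      have := (mul_eq_zero.1 this).resolve_left (by positivity)
      exact h₂.injective (by rw [inner_self_eq_zero.1 this, map_zero])
    · exact Subsingleton.elim _ _
  exact Prod.ext z1 (Prod.ext z2 (Prod.ext z3 z4))

variable [FiniteDimensional ℝ E₁] [FiniteDimensional ℝ E₂]

theorem frameTrace_warpedDeriv {W : Type*} [AddCommGroup W] [Module ℝ W]
    (hg : IsCurveJet g₁ g₁' g₂ g₂') (h₁ : IsLegendrianJet x₁ L₁)
    (h₂ : IsLegendrianJet x₂ L₂) (hs : s ≠ 0) (hρ : ‖g₁'‖ ^ 2 + ‖g₂'‖ ^ 2 ≠ 0)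
    (hg₁ : g₁ ≠ 0 ∨ Subsingleton E₁) (hg₂ : g₂ ≠ 0 ∨ Subsingleton E₂)
    (B : ℝ × ℝ × E₁ × E₂ →ₗ[ℝ] ℝ × ℝ × E₁ × E₂ →ₗ[ℝ] W)
    (B₁ : E₁ →ₗ[ℝ] E₁ →ₗ[ℝ] W) (B₂ : E₂ →ₗ[ℝ] E₂ →ₗ[ℝ] W)
    (hB₁ : ∀ u v, B (0, 0, u, 0) (0, 0, v, 0) = B₁ u v)
    (hB₂ : ∀ u v, B (0, 0, 0, u) (0, 0, 0, v) = B₂ u v) :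
    frameTrace (warpedDeriv s 1 g₁ g₁' g₂ g₂' x₁ x₂ L₁ L₂) B =
      B (1, 0, 0, 0) (1, 0, 0, 0) +
      (s ^ 2 * (‖g₁'‖ ^ 2 + ‖g₂'‖ ^ 2))⁻¹ • B (0, 1, 0, 0) (0, 1, 0, 0) +
      (s ^ 2 * ‖g₁‖ ^ 2)⁻¹ • frameTrace L₁ B₁ + (s ^ 2 * ‖g₂‖ ^ 2)⁻¹ • frameTrace L₂ B₂ := by
  have hinj := warpedDeriv_injective hg h₁ h₂ hs hρ hg₁ hg₂
  have hin := inner_real_warpedDeriv (s := s) hg h₁ h₂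
  set L := warpedDeriv s 1 g₁ g₁' g₂ g₂' x₁ x₂ L₁ L₂
  rw [frameTrace_prod L hinj, frameTrace_prod (L.comp (ContinuousLinearMap.inr _ _ _)),
    frameTrace_prod ((L.comp (ContinuousLinearMap.inr _ _ _)).comp
      (ContinuousLinearMap.inr _ _ _)), frameTrace_real, frameTrace_real,
    frameTrace_scale _ L₁ h₁.injective (c := s ^ 2 * ‖g₁‖ ^ 2),
    frameTrace_scale _ L₂ h₂.injective (c := s ^ 2 * ‖g₂‖ ^ 2), ← add_assoc, ← add_assoc]
  · congr 1
    · congr 1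
      · congr 1
        · have : ‖L (1, 0, 0, 0)‖ ^ 2 = 1 := by
            rw [← real_inner_self_eq_norm_sq, hin]
            simp
          change (‖L (1, 0, 0, 0)‖ ^ 2)⁻¹ • B (1, 0, 0, 0) (1, 0, 0, 0) = _
          rw [this, inv_one, one_smul]
        · have : ‖L (0, 1, 0, 0)‖ ^ 2 = s ^ 2 * (‖g₁'‖ ^ 2 + ‖g₂'‖ ^ 2) := by
            rw [← real_inner_self_eq_norm_sq, hin]
            simp
          change (‖L (0, 1, 0, 0)‖ ^ 2)⁻¹ • B (0, 1, 0, 0) (0, 1, 0, 0) = _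
          rw [this]
      · congr 2
        ext u v
        simpa using hB₁ u v
    · congr 2
      ext u v
      simpa using hB₂ u v
  · exact hg₂.imp (fun h => by positivity) id
  · intro u v
    simp [hin]
  · exact hg₁.imp (fun h => by positivity) id
  · intro u v
    simp [hin]
  · intro h0
    have := hinj (a₁ := (0, 1, 0, 0)) (h0.trans (map_zero L).symm)
    simp at this
  · intro h0
    have := hinj (a₁ := (1, 0, 0, 0)) (h0.trans (map_zero L).symm)
    simp at this
  · exact (hinj.comp (Prod.mk_right_injective _)).comp (Prod.mk_right_injective _)
  · intro u v
    simp [hin]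
  · exact hinj.comp (Prod.mk_right_injective _)
  · intro u v
    simp [hin]
  · intro u v
    simp [hin]

end ConePoint

section ConeCurve

/-- The squared speed of a curve in `ℂ²`. -/
def speedSq (γ₁ γ₂ : ℝ → ℂ) (t : ℝ) : ℝ := ‖deriv γ₁ t‖ ^ 2 + ‖deriv γ₂ t‖ ^ 2

/-- A Legendrian curve in the unit sphere of `ℂ²` on an open set, with the second order equation
that makes the cone over the composed link have a closed mean curvature. The functions `c₁`, `c₂`
stand for the inverses of the conjugates of `γ₁`, `γ₂`, in so far as these are needed. -/
structure IsConeCurve (n₁ n₂ : ℕ) (μ : ℝ) (γ₁ γ₂ c₁ c₂ : ℝ → ℂ) (T : Set ℝ) : Prop where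
  isOpen : IsOpen T
  smooth₁ : ContDiffOn ℝ ∞ γ₁ T
  smooth₂ : ContDiffOn ℝ ∞ γ₂ T
  jet : ∀ t ∈ T, IsCurveJet (γ₁ t) (deriv γ₁ t) (γ₂ t) (deriv γ₂ t)
  speed : ∀ t ∈ T, speedSq γ₁ γ₂ t ≠ 0
  accel₁ : ∀ t ∈ T, deriv (deriv γ₁) t = Complex.I * μ * deriv γ₁ t +
    speedSq γ₁ γ₂ t * (-(n₁ + n₂ + 1 : ℂ) * γ₁ t + n₁ * c₁ t)
  accel₂ : ∀ t ∈ T, deriv (deriv γ₂) t = Complex.I * μ * deriv γ₂ t +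
    speedSq γ₁ γ₂ t * (-(n₁ + n₂ + 1 : ℂ) * γ₂ t + n₂ * c₂ t)
  differentiable₁ : ∀ t ∈ T, DifferentiableAt ℝ c₁ t
  differentiable₂ : ∀ t ∈ T, DifferentiableAt ℝ c₂ t
  inv₁ : ∀ t ∈ T, n₁ = 0 ∨ c₁ t * (starRingEnd ℂ) (γ₁ t) = 1
  inv₂ : ∀ t ∈ T, n₂ = 0 ∨ c₂ t * (starRingEnd ℂ) (γ₂ t) = 1

theorem eq_div_norm_sq {c g : ℂ} (h : c * (starRingEnd ℂ) g = 1) :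
    c = g * ((‖g‖ ^ 2 : ℝ) : ℂ)⁻¹ := by
  have hg : g ≠ 0 := by
    rintro rfl
    simp at h
  have hn : ((‖g‖ ^ 2 : ℝ) : ℂ) ≠ 0 := by
    exact_mod_cast (by positivity : ‖g‖ ^ 2 ≠ 0)
  have := Complex.conj_mul' g
  field_simp
  push_cast
  linear_combination g * h - c * this

/-- The rate of rotation `-μ γ' / |γ'|²`, which is a component of `J H`. -/
def rotation (μ : ℝ) (γ₁ γ₂ γ : ℝ → ℂ) (t : ℝ) : ℂ :=
  -(μ : ℂ) * ((speedSq γ₁ γ₂ t : ℂ)⁻¹ * deriv γ t)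

namespace IsConeCurve

variable {n₁ n₂ : ℕ} {μ : ℝ} {γ₁ γ₂ c₁ c₂ : ℝ → ℂ} {T : Set ℝ} {t : ℝ}

theorem hasDerivAt₁ (h : IsConeCurve n₁ n₂ μ γ₁ γ₂ c₁ c₂ T) (ht : t ∈ T) :
    HasDerivAt γ₁ (deriv γ₁ t) t :=
  ((h.smooth₁.contDiffAt (h.isOpen.mem_nhds ht)).differentiableAt (by simp)).hasDerivAt

theorem hasDerivAt₂ (h : IsConeCurve n₁ n₂ μ γ₁ γ₂ c₁ c₂ T) (ht : t ∈ T) :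
    HasDerivAt γ₂ (deriv γ₂ t) t :=
  ((h.smooth₂.contDiffAt (h.isOpen.mem_nhds ht)).differentiableAt (by simp)).hasDerivAt

theorem hasDerivAt_deriv₁ (h : IsConeCurve n₁ n₂ μ γ₁ γ₂ c₁ c₂ T) (ht : t ∈ T) :
    HasDerivAt (deriv γ₁) (deriv (deriv γ₁) t) t :=
  (((h.smooth₁.deriv_of_isOpen h.isOpen (m := ∞) (by simp)).contDiffAt
    (h.isOpen.mem_nhds ht)).differentiableAt (by simp)).hasDerivAt

theorem hasDerivAt_deriv₂ (h : IsConeCurve n₁ n₂ μ γ₁ γ₂ c₁ c₂ T) (ht : t ∈ T) :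
    HasDerivAt (deriv γ₂) (deriv (deriv γ₂) t) t :=
  (((h.smooth₂.deriv_of_isOpen h.isOpen (m := ∞) (by simp)).contDiffAt
    (h.isOpen.mem_nhds ht)).differentiableAt (by simp)).hasDerivAt

theorem differentiableAt_speedSq (h : IsConeCurve n₁ n₂ μ γ₁ γ₂ c₁ c₂ T) (ht : t ∈ T) :
    DifferentiableAt ℝ (fun t => (speedSq γ₁ γ₂ t : ℂ)) t := by
  have h1 := (h.hasDerivAt_deriv₁ ht).differentiableAt.norm_sq ℝ
  have h2 := (h.hasDerivAt_deriv₂ ht).differentiableAt.norm_sq ℝ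
  exact (Complex.ofRealCLM.differentiableAt).comp t (h1.add h2)

theorem hasDerivAt_rotation₁ (h : IsConeCurve n₁ n₂ μ γ₁ γ₂ c₁ c₂ T) (ht : t ∈ T) :
    HasDerivAt (rotation μ γ₁ γ₂ γ₁) (deriv (rotation μ γ₁ γ₂ γ₁) t) t :=
  ((((h.differentiableAt_speedSq ht).inv (by exact_mod_cast h.speed t ht)).mul
    (h.hasDerivAt_deriv₁ ht).differentiableAt).const_mul _).hasDerivAt

theorem hasDerivAt_rotation₂ (h : IsConeCurve n₁ n₂ μ γ₁ γ₂ c₁ c₂ T) (ht : t ∈ T) :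
    HasDerivAt (rotation μ γ₁ γ₂ γ₂) (deriv (rotation μ γ₁ γ₂ γ₂) t) t :=
  ((((h.differentiableAt_speedSq ht).inv (by exact_mod_cast h.speed t ht)).mul
    (h.hasDerivAt_deriv₂ ht).differentiableAt).const_mul _).hasDerivAt

theorem coeff₁ (h : IsConeCurve n₁ n₂ μ γ₁ γ₂ c₁ c₂ T) (ht : t ∈ T) :
    n₁ = 0 ∨ c₁ t = γ₁ t * ((‖γ₁ t‖ ^ 2 : ℝ) : ℂ)⁻¹ :=
  (h.inv₁ t ht).imp_right eq_div_norm_sq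

theorem coeff₂ (h : IsConeCurve n₁ n₂ μ γ₁ γ₂ c₁ c₂ T) (ht : t ∈ T) :
    n₂ = 0 ∨ c₂ t = γ₂ t * ((‖γ₂ t‖ ^ 2 : ℝ) : ℂ)⁻¹ :=
  (h.inv₂ t ht).imp_right eq_div_norm_sq

theorem ne_zero₁ (h : IsConeCurve n₁ n₂ μ γ₁ γ₂ c₁ c₂ T) (ht : t ∈ T) :
    n₁ = 0 ∨ γ₁ t ≠ 0 :=
  (h.inv₁ t ht).imp_right fun h0 h1 => by simp [h1] at h0

theorem ne_zero₂ (h : IsConeCurve n₁ n₂ μ γ₁ γ₂ c₁ c₂ T) (ht : t ∈ T) :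
    n₂ = 0 ∨ γ₂ t ≠ 0 :=
  (h.inv₂ t ht).imp_right fun h0 h1 => by simp [h1] at h0

theorem speedSq_eq (γ₁ γ₂ : ℝ → ℂ) (t : ℝ) : (speedSq γ₁ γ₂ t : ℂ) =
    (starRingEnd ℂ) (deriv γ₁ t) * deriv γ₁ t + (starRingEnd ℂ) (deriv γ₂ t) * deriv γ₂ t := by
  rw [Complex.conj_mul', Complex.conj_mul', speedSq]
  push_cast
  rfl

theorem rotation_inner (h : IsConeCurve n₁ n₂ μ γ₁ γ₂ c₁ c₂ T) (ht : t ∈ T) :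
    (starRingEnd ℂ) (rotation μ γ₁ γ₂ γ₁ t) * deriv γ₁ t +
      (starRingEnd ℂ) (rotation μ γ₁ γ₂ γ₂ t) * deriv γ₂ t = -μ := by
  have hs : (speedSq γ₁ γ₂ t : ℂ) ≠ 0 := by exact_mod_cast h.speed t ht
  simp only [rotation, map_mul, map_neg, map_inv₀, Complex.conj_ofReal]
  have := speedSq_eq γ₁ γ₂ t
  field_simp
  linear_combination (μ : ℂ) * this

theorem rotation_orthogonal (h : IsConeCurve n₁ n₂ μ γ₁ γ₂ c₁ c₂ T) (ht : t ∈ T) :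
    (starRingEnd ℂ) (rotation μ γ₁ γ₂ γ₁ t) * γ₁ t +
      (starRingEnd ℂ) (rotation μ γ₁ γ₂ γ₂ t) * γ₂ t = 0 := by
  have := congrArg (starRingEnd ℂ) (h.jet t ht).legendrian
  simp only [map_add, map_mul, Complex.conj_conj, map_zero] at this
  simp only [rotation, map_mul, map_neg, map_inv₀, Complex.conj_ofReal]
  linear_combination (-(μ : ℂ) * (speedSq γ₁ γ₂ t : ℂ)⁻¹) * this

theorem deriv_rotation_inner (h : IsConeCurve n₁ n₂ μ γ₁ γ₂ c₁ c₂ T) (ht : t ∈ T) :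
    (starRingEnd ℂ) (deriv (rotation μ γ₁ γ₂ γ₁) t) * deriv γ₁ t +
      (starRingEnd ℂ) (deriv (rotation μ γ₁ γ₂ γ₂) t) * deriv γ₂ t =
    μ * (Complex.I * μ + n₁ * ((starRingEnd ℂ) (deriv γ₁ t) * c₁ t) +
      n₂ * ((starRingEnd ℂ) (deriv γ₂ t) * c₂ t)) := by
  have hs : (speedSq γ₁ γ₂ t : ℂ) ≠ 0 := by exact_mod_cast h.speed t ht
  have e1 := (Complex.conjCLE.hasFDerivAt.comp_hasDerivAt t (h.hasDerivAt_rotation₁ ht)).mul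
    (h.hasDerivAt_deriv₁ ht)
  have e2 := (Complex.conjCLE.hasFDerivAt.comp_hasDerivAt t (h.hasDerivAt_rotation₂ ht)).mul
    (h.hasDerivAt_deriv₂ ht)
  have he : ((fun t => (starRingEnd ℂ) (rotation μ γ₁ γ₂ γ₁ t) * deriv γ₁ t +
      (starRingEnd ℂ) (rotation μ γ₁ γ₂ γ₂ t) * deriv γ₂ t)) =ᶠ[nhds t] fun _ => (-μ : ℂ) := by
    filter_upwards [h.isOpen.mem_nhds ht] with r hr using h.rotation_inner hr
  have key := ((e1.add e2).congr_of_eventuallyEq he.symm).unique (hasDerivAt_const t (-μ : ℂ))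
  simp only [Complex.conjCLE_apply, ContinuousLinearEquiv.coe_coe, Function.comp_apply] at key
  have hl := congrArg (starRingEnd ℂ) (h.jet t ht).legendrian
  simp only [map_add, map_mul, Complex.conj_conj, map_zero] at hl
  have h1 : (starRingEnd ℂ) (rotation μ γ₁ γ₂ γ₁ t) * deriv (deriv γ₁) t +
      (starRingEnd ℂ) (rotation μ γ₁ γ₂ γ₂ t) * deriv (deriv γ₂) t =
      -(μ * (Complex.I * μ + n₁ * ((starRingEnd ℂ) (deriv γ₁ t) * c₁ t) +
      n₂ * ((starRingEnd ℂ) (deriv γ₂ t) * c₂ t))) := by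
    rw [h.accel₁ t ht, h.accel₂ t ht]
    simp only [rotation, map_mul, map_neg, map_inv₀, Complex.conj_ofReal]
    have := speedSq_eq γ₁ γ₂ t
    field_simp
    linear_combination (μ ^ 2 * Complex.I : ℂ) * this +
      (μ * speedSq γ₁ γ₂ t * (n₁ + n₂ + 1) : ℂ) * hl
  linear_combination key - h1

end IsConeCurve

end ConeCurve

section ConeGeometry

set_option linter.unusedSectionVars false

variable {E₁ : Type*} [NormedAddCommGroup E₁] [NormedSpace ℝ E₁] [FiniteDimensional ℝ E₁]
  {E₂ : Type*} [NormedAddCommGroup E₂] [NormedSpace ℝ E₂] [FiniteDimensional ℝ E₂]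
  {ι₁ ι₂ : Type*} [Fintype ι₁] [Fintype ι₂]
  {μ : ℝ} {γ₁ γ₂ c₁ c₂ : ℝ → ℂ} {T : Set ℝ}
  {f₁ : E₁ → CSpace ι₁} {f₂ : E₂ → CSpace ι₂} {U₁ : Set E₁} {U₂ : Set E₂}

/-- The domain of the local cone, without the vertex. -/
def warpedDomain (T : Set ℝ) (U₁ : Set E₁) (U₂ : Set E₂) : Set (ℝ × ℝ × E₁ × E₂) :=
  {0}ᶜ ×ˢ T ×ˢ U₁ ×ˢ U₂

theorem fderiv_coneMap {p : ℝ × ℝ × E₁ × E₂} (h₁ : DifferentiableAt ℝ γ₁ p.2.1)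
    (h₂ : DifferentiableAt ℝ γ₂ p.2.1) (hf₁ : DifferentiableAt ℝ f₁ p.2.2.1)
    (hf₂ : DifferentiableAt ℝ f₂ p.2.2.2) :
    fderiv ℝ (coneMap γ₁ γ₂ f₁ f₂) p = warpedDeriv p.1 1 (γ₁ p.2.1) (deriv γ₁ p.2.1) (γ₂ p.2.1)
      (deriv γ₂ p.2.1) (f₁ p.2.2.1) (f₂ p.2.2.2) (fderiv ℝ f₁ p.2.2.1) (fderiv ℝ f₂ p.2.2.2) :=
  (hasFDerivAt_warped (hasDerivAt_id _) h₁.hasDerivAt h₂.hasDerivAt hf₁.hasFDerivAt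
    hf₂.hasFDerivAt).fderiv

/-- The linear map `v ↦ (z v, 0)`. -/
def smulInl (ι₁ ι₂ : Type*) [Fintype ι₁] [Fintype ι₂] (z : ℂ) :
    CSpace ι₁ →ₗ[ℝ] CSpace (ι₁ ⊕ ι₂) where
  toFun v := pair (z • v) 0
  map_add' v w := by rw [smul_add, ← pair_add, add_zero]
  map_smul' c v := by rw [smul_comm, RingHom.id_apply, ← pair_real_smul, smul_zero]

/-- The linear map `v ↦ (0, z v)`. -/
def smulInr (ι₁ ι₂ : Type*) [Fintype ι₁] [Fintype ι₂] (z : ℂ) :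
    CSpace ι₂ →ₗ[ℝ] CSpace (ι₁ ⊕ ι₂) where
  toFun v := pair 0 (z • v)
  map_add' v w := by rw [smul_add, ← pair_add, add_zero]
  map_smul' c v := by rw [smul_comm, RingHom.id_apply, ← pair_real_smul, smul_zero]

theorem smulInl_apply (z : ℂ) (v : CSpace ι₁) : smulInl ι₁ ι₂ z v = pair (z • v) 0 := rfl

theorem smulInr_apply (z : ℂ) (v : CSpace ι₂) : smulInr ι₁ ι₂ z v = pair 0 (z • v) := rfl

section

variable {n₁ n₂ : ℕ} (hγ : IsConeCurve n₁ n₂ μ γ₁ γ₂ c₁ c₂ T)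
  (h₁ : IsLocalLegendrian f₁ U₁) (h₂ : IsLocalLegendrian f₂ U₂)

include hγ h₁ h₂

theorem isOpen_warpedDomain : IsOpen (warpedDomain T U₁ U₂) :=
  isOpen_compl_singleton.prod (hγ.isOpen.prod (h₁.isOpen.prod h₂.isOpen))

theorem fderiv_cone {p : ℝ × ℝ × E₁ × E₂} (hp : p ∈ warpedDomain T U₁ U₂) :
    fderiv ℝ (coneMap γ₁ γ₂ f₁ f₂) p = warpedDeriv p.1 1 (γ₁ p.2.1) (deriv γ₁ p.2.1) (γ₂ p.2.1)
      (deriv γ₂ p.2.1) (f₁ p.2.2.1) (f₂ p.2.2.2) (fderiv ℝ f₁ p.2.2.1) (fderiv ℝ f₂ p.2.2.2) :=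
  fderiv_coneMap (hγ.hasDerivAt₁ hp.2.1).differentiableAt (hγ.hasDerivAt₂ hp.2.1).differentiableAt
    (h₁.hasFDerivAt hp.2.2.1).differentiableAt (h₂.hasFDerivAt hp.2.2.2).differentiableAt

theorem hasFDerivAt_fderiv_cone {p : ℝ × ℝ × E₁ × E₂} (hp : p ∈ warpedDomain T U₁ U₂)
    (v : ℝ × ℝ × E₁ × E₂) {L : ℝ × ℝ × E₁ × E₂ →L[ℝ] CSpace (ι₁ ⊕ ι₂)}
    (hL : HasFDerivAt (fun q : ℝ × ℝ × E₁ × E₂ => warpedDeriv q.1 1 (γ₁ q.2.1) (deriv γ₁ q.2.1)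
      (γ₂ q.2.1) (deriv γ₂ q.2.1) (f₁ q.2.2.1) (f₂ q.2.2.2) (fderiv ℝ f₁ q.2.2.1)
      (fderiv ℝ f₂ q.2.2.2) v) L p) (u : ℝ × ℝ × E₁ × E₂) :
    hessian (coneMap γ₁ γ₂ f₁ f₂) p u v = L u := by
  have hopen := (isOpen_warpedDomain hγ h₁ h₂).mem_nhds hp
  have hsm : ContDiffAt ℝ ∞ (coneMap γ₁ γ₂ f₁ f₂) p := by
    have a1 : ContDiffAt ℝ ∞ (fun q : ℝ × ℝ × E₁ × E₂ => (q.1 : ℂ)) p :=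
      Complex.ofRealCLM.contDiff.contDiffAt.comp p contDiffAt_fst
    have a2 : ContDiffAt ℝ ∞ (fun q : ℝ × ℝ × E₁ × E₂ => γ₁ q.2.1) p :=
      (hγ.smooth₁.contDiffAt (hγ.isOpen.mem_nhds hp.2.1)).comp p
        (contDiffAt_fst.comp p contDiffAt_snd)
    have a3 : ContDiffAt ℝ ∞ (fun q : ℝ × ℝ × E₁ × E₂ => γ₂ q.2.1) p :=
      (hγ.smooth₂.contDiffAt (hγ.isOpen.mem_nhds hp.2.1)).comp p
        (contDiffAt_fst.comp p contDiffAt_snd)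
    have a4 : ContDiffAt ℝ ∞ (fun q : ℝ × ℝ × E₁ × E₂ => f₁ q.2.2.1) p :=
      (h₁.contDiffAt hp.2.2.1).comp p
        (contDiffAt_fst.comp p (contDiffAt_snd.comp p contDiffAt_snd))
    have a5 : ContDiffAt ℝ ∞ (fun q : ℝ × ℝ × E₁ × E₂ => f₂ q.2.2.2) p :=
      (h₂.contDiffAt hp.2.2.2).comp p
        (contDiffAt_snd.comp p (contDiffAt_snd.comp p contDiffAt_snd))
    exact (pairCLM ι₁ ι₂).contDiff.contDiffAt.comp p
      (((a1.mul a2).smul a4).prodMk ((a1.mul a3).smul a5))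
  have hd : DifferentiableAt ℝ (fderiv ℝ (coneMap γ₁ γ₂ f₁ f₂)) p :=
    (hsm.fderiv_right (m := ∞) (by simp)).differentiableAt (by simp)
  have hd' := hd.hasFDerivAt.clm_apply (hasFDerivAt_const v p)
  rw [ContinuousLinearMap.comp_zero, zero_add] at hd'
  have he : (fun q => fderiv ℝ (coneMap γ₁ γ₂ f₁ f₂) q v) =ᶠ[nhds p]
      (fun q : ℝ × ℝ × E₁ × E₂ => warpedDeriv q.1 1 (γ₁ q.2.1) (deriv γ₁ q.2.1)
      (γ₂ q.2.1) (deriv γ₂ q.2.1) (f₁ q.2.2.1) (f₂ q.2.2.2) (fderiv ℝ f₁ q.2.2.1)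
      (fderiv ℝ f₂ q.2.2.2) v) := by
    filter_upwards [hopen] with q hq
    rw [fderiv_cone hγ h₁ h₂ hq]
  exact DFunLike.congr_fun (hd'.unique (hL.congr_of_eventuallyEq he)) u

theorem hessian_cone_radial {p : ℝ × ℝ × E₁ × E₂} (hp : p ∈ warpedDomain T U₁ U₂) :
    hessian (coneMap γ₁ γ₂ f₁ f₂) p (1, 0, 0, 0) (1, 0, 0, 0) = 0 := by
  have h := hasFDerivAt_warped (p := p) (hasDerivAt_const p.1 (1 : ℝ)) (hγ.hasDerivAt₁ hp.2.1)
    (hγ.hasDerivAt₂ hp.2.1) (h₁.hasFDerivAt hp.2.2.1) (h₂.hasFDerivAt hp.2.2.2)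
  rw [hasFDerivAt_fderiv_cone hγ h₁ h₂ hp _ (h.congr_of_eventuallyEq (.of_eq ?_))]
  · rw [warpedDeriv_apply]
    exact pair_ext (fun _ => by simp) (fun _ => by simp)
  · funext q
    simp [warpedDeriv_apply, warped]

theorem hessian_cone_curve {p : ℝ × ℝ × E₁ × E₂} (hp : p ∈ warpedDomain T U₁ U₂) :
    hessian (coneMap γ₁ γ₂ f₁ f₂) p (0, 1, 0, 0) (0, 1, 0, 0) =
      pair (((p.1 : ℂ) * deriv (deriv γ₁) p.2.1) • f₁ p.2.2.1)
        (((p.1 : ℂ) * deriv (deriv γ₂) p.2.1) • f₂ p.2.2.2) := by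
  have h := hasFDerivAt_warped (p := p) (hasDerivAt_id p.1) (hγ.hasDerivAt_deriv₁ hp.2.1)
    (hγ.hasDerivAt_deriv₂ hp.2.1) (h₁.hasFDerivAt hp.2.2.1) (h₂.hasFDerivAt hp.2.2.2)
  rw [hasFDerivAt_fderiv_cone hγ h₁ h₂ hp _ (h.congr_of_eventuallyEq (.of_eq ?_))]
  · simp [warpedDeriv_apply]
  · funext q
    simp [warpedDeriv_apply, warped]

theorem hessian_cone_left {p : ℝ × ℝ × E₁ × E₂} (hp : p ∈ warpedDomain T U₁ U₂) (u v : E₁) :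
    hessian (coneMap γ₁ γ₂ f₁ f₂) p (0, 0, u, 0) (0, 0, v, 0) =
      ((hessian f₁ p.2.2.1).compr₂ (smulInl ι₁ ι₂ (p.1 * γ₁ p.2.1))) u v := by
  have h := hasFDerivAt_warped (p := p) (hasDerivAt_id p.1) (hγ.hasDerivAt₁ hp.2.1)
    (hγ.hasDerivAt₂ hp.2.1) (h₁.hasFDerivAt_fderiv hp.2.2.1 v)
    (hasFDerivAt_const (0 : CSpace ι₂) p.2.2.2)
  rw [hasFDerivAt_fderiv_cone hγ h₁ h₂ hp _ (h.congr_of_eventuallyEq (.of_eq ?_))]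
  · simp [warpedDeriv_apply, smulInl_apply]
  · funext q
    simp [warpedDeriv_apply, warped]

theorem hessian_cone_right {p : ℝ × ℝ × E₁ × E₂} (hp : p ∈ warpedDomain T U₁ U₂) (u v : E₂) :
    hessian (coneMap γ₁ γ₂ f₁ f₂) p (0, 0, 0, u) (0, 0, 0, v) =
      ((hessian f₂ p.2.2.2).compr₂ (smulInr ι₁ ι₂ (p.1 * γ₂ p.2.1))) u v := by
  have h := hasFDerivAt_warped (p := p) (hasDerivAt_id p.1) (hγ.hasDerivAt₁ hp.2.1)
    (hγ.hasDerivAt₂ hp.2.1) (hasFDerivAt_const (0 : CSpace ι₁) p.2.2.1)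
    (h₂.hasFDerivAt_fderiv hp.2.2.2 v)
  rw [hasFDerivAt_fderiv_cone hγ h₁ h₂ hp _ (h.congr_of_eventuallyEq (.of_eq ?_))]
  · simp [warpedDeriv_apply, smulInr_apply]
  · funext q
    simp [warpedDeriv_apply, warped]

end

/-- The trace of the second fundamental form of the cone. -/
def coneTrace (μ : ℝ) (γ₁ γ₂ c₁ c₂ : ℝ → ℂ) (f₁ : E₁ → CSpace ι₁) (f₂ : E₂ → CSpace ι₂) :
    ℝ × ℝ × E₁ × E₂ → CSpace (ι₁ ⊕ ι₂) :=
  -(Complex.I • (warped (·⁻¹) (rotation μ γ₁ γ₂ γ₁) (rotation μ γ₁ γ₂ γ₂) f₁ f₂ +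
    warped (·⁻¹) c₁ c₂ (fun y => Complex.I • sphericalTrace f₁ y)
      (fun y => Complex.I • sphericalTrace f₂ y)))

theorem coneTrace_apply (p : ℝ × ℝ × E₁ × E₂) :
    coneTrace μ γ₁ γ₂ c₁ c₂ f₁ f₂ p =
      (p.1 : ℂ)⁻¹ • pair (-(Complex.I * rotation μ γ₁ γ₂ γ₁ p.2.1) • f₁ p.2.2.1 +
          c₁ p.2.1 • sphericalTrace f₁ p.2.2.1)
        (-(Complex.I * rotation μ γ₁ γ₂ γ₂ p.2.1) • f₂ p.2.2.2 +
          c₂ p.2.1 • sphericalTrace f₂ p.2.2.2) := by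
  refine pair_ext (fun k => ?_) (fun k => ?_)
  · simp [coneTrace, warped]
    linear_combination (-(p.1 : ℂ)⁻¹ * c₁ p.2.1 * sphericalTrace f₁ p.2.2.1 k) * Complex.I_mul_I
  · simp [coneTrace, warped]
    linear_combination (-(p.1 : ℂ)⁻¹ * c₂ p.2.1 * sphericalTrace f₂ p.2.2.2 k) * Complex.I_mul_I

theorem trace_coefficient {E : Type*} [NormedAddCommGroup E] [NormedSpace ℝ E]
    [FiniteDimensional ℝ E] {ι : Type*} [Fintype ι] {f : E → CSpace ι} {U : Set E} {y : E}
    (h : IsLocalLegendrian f U) (hy : y ∈ U) {s ρ N : ℝ} {g a c κ : ℂ} (hs : s ≠ 0) (hρ : ρ ≠ 0)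
    (hc : Module.finrank ℝ E = 0 ∨ c = g * ((‖g‖ ^ 2 : ℝ) : ℂ)⁻¹)
    (ha : a = ρ * (κ + (-N * g + Module.finrank ℝ E * c))) (k : ι) :
    ((s ^ 2 * ρ)⁻¹ : ℝ) * (s * a * f y k) +
        ((s ^ 2 * ‖g‖ ^ 2)⁻¹ : ℝ) * (s * g * hessianTrace f y k) =
      (s : ℂ)⁻¹ * (κ * f y k + c * sphericalTrace f y k) +
        ((-(N / s) : ℝ) * g * f y k + s * g * (fderiv ℝ f y ((s ^ 2 * ‖g‖ ^ 2)⁻¹ •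
          frameTrace (fderiv ℝ f y) (tangentForm (fderiv ℝ f y) (hessianTrace f y)))) k) := by
  have hs' : (s : ℂ) ≠ 0 := by exact_mod_cast hs
  have hρ' : (ρ : ℂ) ≠ 0 := by exact_mod_cast hρ
  have hsp := congrArg (fun x : CSpace ι => x k) (h.sphericalTrace_eq hy)
  simp only [PiLp.sub_apply, PiLp.add_apply, PiLp.smul_apply, Complex.real_smul] at hsp
  rw [map_smul, PiLp.smul_apply, Complex.real_smul]
  rcases hc with h0 | hc
  · have : Subsingleton E := Module.finrank_zero_iff.1 h0
    have h1 : hessianTrace f y = 0 := by rw [hessianTrace, frameTrace_of_subsingleton]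
    rw [frameTrace_of_subsingleton, map_zero, h1, h0] at hsp
    rw [frameTrace_of_subsingleton, map_zero, h1]
    simp at hsp
    simp [hsp, ha, h0]
    field_simp
  · rw [hsp, ha, hc]
    push_cast
    rcases eq_or_ne g 0 with rfl | hg
    · simp
      field_simp
    · have : (‖g‖ : ℂ) ≠ 0 := by simpa using hg
      field_simp
      ring

variable (hγ : IsConeCurve (Module.finrank ℝ E₁) (Module.finrank ℝ E₂) μ γ₁ γ₂ c₁ c₂ T)
  (h₁ : IsLocalLegendrian f₁ U₁) (h₂ : IsLocalLegendrian f₂ U₂)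

include hγ h₁ h₂

theorem frameTrace_cone {W : Type*} [AddCommGroup W] [Module ℝ W]
    {p : ℝ × ℝ × E₁ × E₂} (hp : p ∈ warpedDomain T U₁ U₂)
    (B : ℝ × ℝ × E₁ × E₂ →ₗ[ℝ] ℝ × ℝ × E₁ × E₂ →ₗ[ℝ] W)
    (B₁ : E₁ →ₗ[ℝ] E₁ →ₗ[ℝ] W) (B₂ : E₂ →ₗ[ℝ] E₂ →ₗ[ℝ] W)
    (hB₁ : ∀ u v, B (0, 0, u, 0) (0, 0, v, 0) = B₁ u v)
    (hB₂ : ∀ u v, B (0, 0, 0, u) (0, 0, 0, v) = B₂ u v) :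
    frameTrace (fderiv ℝ (coneMap γ₁ γ₂ f₁ f₂) p) B =
      B (1, 0, 0, 0) (1, 0, 0, 0) +
      (p.1 ^ 2 * speedSq γ₁ γ₂ p.2.1)⁻¹ • B (0, 1, 0, 0) (0, 1, 0, 0) +
      (p.1 ^ 2 * ‖γ₁ p.2.1‖ ^ 2)⁻¹ • frameTrace (fderiv ℝ f₁ p.2.2.1) B₁ +
      (p.1 ^ 2 * ‖γ₂ p.2.1‖ ^ 2)⁻¹ • frameTrace (fderiv ℝ f₂ p.2.2.2) B₂ := by
  rw [fderiv_cone hγ h₁ h₂ hp]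
  exact frameTrace_warpedDeriv (hγ.jet _ hp.2.1) (h₁.jet hp.2.2.1) (h₂.jet hp.2.2.2) hp.1
    (hγ.speed _ hp.2.1) ((hγ.ne_zero₁ hp.2.1).symm.imp_right Module.finrank_zero_iff.1)
    ((hγ.ne_zero₂ hp.2.1).symm.imp_right Module.finrank_zero_iff.1) B B₁ B₂ hB₁ hB₂

theorem hessianTrace_cone {p : ℝ × ℝ × E₁ × E₂} (hp : p ∈ warpedDomain T U₁ U₂) :
    ∃ v, hessianTrace (coneMap γ₁ γ₂ f₁ f₂) p =
      coneTrace μ γ₁ γ₂ c₁ c₂ f₁ f₂ p + fderiv ℝ (coneMap γ₁ γ₂ f₁ f₂) p v := by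
  have hρ := hγ.speed _ hp.2.1
  have hρ' : (speedSq γ₁ γ₂ p.2.1 : ℂ) ≠ 0 := by exact_mod_cast hρ
  refine ⟨(-((Module.finrank ℝ E₁ + Module.finrank ℝ E₂ + 1 : ℝ) / p.1), 0,
    (p.1 ^ 2 * ‖γ₁ p.2.1‖ ^ 2)⁻¹ • frameTrace (fderiv ℝ f₁ p.2.2.1)
      (tangentForm (fderiv ℝ f₁ p.2.2.1) (hessianTrace f₁ p.2.2.1)),
    (p.1 ^ 2 * ‖γ₂ p.2.1‖ ^ 2)⁻¹ • frameTrace (fderiv ℝ f₂ p.2.2.2)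
      (tangentForm (fderiv ℝ f₂ p.2.2.2) (hessianTrace f₂ p.2.2.2))), ?_⟩
  rw [hessianTrace, frameTrace_cone hγ h₁ h₂ hp _ _ _ (hessian_cone_left hγ h₁ h₂ hp)
    (hessian_cone_right hγ h₁ h₂ hp), hessian_cone_radial hγ h₁ h₂ hp,
    hessian_cone_curve hγ h₁ h₂ hp, ← map_frameTrace, ← map_frameTrace, fderiv_cone hγ h₁ h₂ hp,
    coneTrace_apply, warpedDeriv_apply, smulInl_apply, smulInr_apply, ← hessianTrace,
    ← hessianTrace]
  refine pair_ext (fun k => ?_) (fun k => ?_)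
  · have := trace_coefficient h₁ hp.2.2.1 hp.1 hρ (hγ.coeff₁ hp.2.1)
      (κ := -(Complex.I * rotation μ γ₁ γ₂ γ₁ p.2.1))
      (N := Module.finrank ℝ E₁ + Module.finrank ℝ E₂ + 1) (a := deriv (deriv γ₁) p.2.1) ?_ k
    · simp only [PiLp.add_apply, PiLp.smul_apply, pair_inl, zero_add, Complex.real_smul,
        PiLp.zero_apply, mul_zero, add_zero, smul_eq_mul]
      simpa using this
    · rw [hγ.accel₁ _ hp.2.1, rotation]
      push_cast
      field_simp
  · have := trace_coefficient h₂ hp.2.2.2 hp.1 hρ (hγ.coeff₂ hp.2.1)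
      (κ := -(Complex.I * rotation μ γ₁ γ₂ γ₂ p.2.1))
      (N := Module.finrank ℝ E₁ + Module.finrank ℝ E₂ + 1) (a := deriv (deriv γ₂) p.2.1) ?_ k
    · simp only [PiLp.add_apply, PiLp.smul_apply, pair_inr, zero_add, Complex.real_smul,
        PiLp.zero_apply, mul_zero, add_zero, smul_eq_mul]
      simpa using this
    · rw [hγ.accel₂ _ hp.2.1, rotation]
      push_cast
      field_simp

theorem coneTrace_orthogonal {p : ℝ × ℝ × E₁ × E₂} (hp : p ∈ warpedDomain T U₁ U₂)
    (v : ℝ × ℝ × E₁ × E₂) :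
    inner ℝ (coneTrace μ γ₁ γ₂ c₁ c₂ f₁ f₂ p) (fderiv ℝ (coneMap γ₁ γ₂ f₁ f₂) p v) = 0 := by
  have e1 := hγ.rotation_inner hp.2.1
  have e2 := hγ.rotation_orthogonal hp.2.1
  have a1 := h₁.inner_sphericalTrace_self hp.2.2.1
  have a2 := h₂.inner_sphericalTrace_self hp.2.2.2
  have b1 : (starRingEnd ℂ (c₁ p.2.1) * γ₁ p.2.1 *
      inner ℂ (sphericalTrace f₁ p.2.2.1) (fderiv ℝ f₁ p.2.2.1 v.2.2.1)).re = 0 := by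
    rcases hγ.inv₁ _ hp.2.1 with h0 | h0
    · have : Subsingleton E₁ := Module.finrank_zero_iff.1 h0
      rw [Subsingleton.elim v.2.2.1 0]
      simp
    · have := congrArg (starRingEnd ℂ) h0
      simp only [map_mul, Complex.conj_conj, map_one] at this
      rw [this, one_mul, ← inner_real_eq_re, h₁.inner_sphericalTrace_fderiv hp.2.2.1]
  have b2 : (starRingEnd ℂ (c₂ p.2.1) * γ₂ p.2.1 *
      inner ℂ (sphericalTrace f₂ p.2.2.2) (fderiv ℝ f₂ p.2.2.2 v.2.2.2)).re = 0 := by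
    rcases hγ.inv₂ _ hp.2.1 with h0 | h0
    · have : Subsingleton E₂ := Module.finrank_zero_iff.1 h0
      rw [Subsingleton.elim v.2.2.2 0]
      simp
    · have := congrArg (starRingEnd ℂ) h0
      simp only [map_mul, Complex.conj_conj, map_one] at this
      rw [this, one_mul, ← inner_real_eq_re, h₂.inner_sphericalTrace_fderiv hp.2.2.2]
  have hs : (p.1 : ℂ) ≠ 0 := by exact_mod_cast hp.1
  rw [fderiv_cone hγ h₁ h₂ hp, coneTrace_apply, warpedDeriv_apply, inner_real_eq_re,
    inner_smul_left, inner_pair]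
  simp only [inner_add_left, inner_add_right, inner_smul_left, inner_smul_right,
    (h₁.jet hp.2.2.1).inner_self, (h₂.jet hp.2.2.2).inner_self, a1, a2,
    (h₁.jet hp.2.2.1).inner_right, (h₂.jet hp.2.2.2).inner_right]
  have : (starRingEnd ℂ) (p.1 : ℂ)⁻¹ = (p.1 : ℂ)⁻¹ := by simp
  rw [this, ← add_zero (0 : ℝ)]
  nth_rewrite 1 [← b1]
  rw [← b2, ← Complex.add_re]
  have h3 : ((Complex.I * (-(μ : ℂ) * v.2.1)) : ℂ).re = 0 := by simp
  rw [← add_zero (_ + _ : ℂ).re, ← h3, ← Complex.add_re]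
  congr 1
  simp only [map_neg, map_mul, Complex.conj_I]
  push_cast
  field_simp
  linear_combination (Complex.I * v.1) * e2 + (Complex.I * v.2.1 * p.1) * e1

theorem euclideanMeanCurvature_cone {p : ℝ × ℝ × E₁ × E₂} (hp : p ∈ warpedDomain T U₁ U₂) :
    euclideanMeanCurvature (coneMap γ₁ γ₂ f₁ f₂) p =
      (Module.finrank ℝ (ℝ × ℝ × E₁ × E₂) : ℝ)⁻¹ • coneTrace μ γ₁ γ₂ c₁ c₂ f₁ f₂ p := by
  obtain ⟨v, hv⟩ := hessianTrace_cone hγ h₁ h₂ hp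
  have hz : fderiv ℝ (coneMap γ₁ γ₂ f₁ f₂) p v ∈ tangentPlane (coneMap γ₁ γ₂ f₁ f₂) p := ⟨v, rfl⟩
  rw [euclideanMeanCurvature_eq, Submodule.eq_starProjection_of_mem_orthogonal' ?_
    (Submodule.le_orthogonal_orthogonal _ hz) hv]
  rw [Submodule.mem_orthogonal']
  rintro _ ⟨w, rfl⟩
  exact coneTrace_orthogonal hγ h₁ h₂ hp w

theorem frameTrace_rotation {p : ℝ × ℝ × E₁ × E₂} (hp : p ∈ warpedDomain T U₁ U₂) :
    frameTrace (fderiv ℝ (coneMap γ₁ γ₂ f₁ f₂) p) (pairing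
      (fderiv ℝ (warped (·⁻¹) (rotation μ γ₁ γ₂ γ₁) (rotation μ γ₁ γ₂ γ₂) f₁ f₂) p)
      (fderiv ℝ (coneMap γ₁ γ₂ f₁ f₂) p)) = 0 := by
  have hs : p.1 ≠ 0 := hp.1
  have hs' : (p.1 : ℂ) ≠ 0 := by exact_mod_cast hs
  have hA := (hasFDerivAt_warped (p := p) (hasDerivAt_inv hs) (hγ.hasDerivAt_rotation₁ hp.2.1)
    (hγ.hasDerivAt_rotation₂ hp.2.1) (h₁.hasFDerivAt hp.2.2.1) (h₂.hasFDerivAt hp.2.2.2)).fderiv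
  have j1 := h₁.jet hp.2.2.1
  have j2 := h₂.jet hp.2.2.2
  have hF := fderiv_cone hγ h₁ h₂ hp
  rw [frameTrace_cone hγ h₁ h₂ hp _
    ((starRingEnd ℂ (rotation μ γ₁ γ₂ γ₁ p.2.1) * γ₁ p.2.1).re •
      pairing (fderiv ℝ f₁ p.2.2.1) (fderiv ℝ f₁ p.2.2.1))
    ((starRingEnd ℂ (rotation μ γ₁ γ₂ γ₂ p.2.1) * γ₂ p.2.1).re •
      pairing (fderiv ℝ f₂ p.2.2.2) (fderiv ℝ f₂ p.2.2.2)), frameTrace_smul, frameTrace_smul,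
    frameTrace_pairing_self _ j1.injective, frameTrace_pairing_self _ j2.injective]
  · have r0 : pairing
        (fderiv ℝ (warped (·⁻¹) (rotation μ γ₁ γ₂ γ₁) (rotation μ γ₁ γ₂ γ₂) f₁ f₂) p)
        (fderiv ℝ (coneMap γ₁ γ₂ f₁ f₂) p) (1, 0, 0, 0) (1, 0, 0, 0) = 0 := by
      have e := hγ.rotation_orthogonal hp.2.1
      rw [pairing_apply, hA, hF, warpedDeriv_apply, warpedDeriv_apply, inner_real_eq_re, inner_pair]
      simp only [map_zero, smul_zero, add_zero, inner_smul_left, inner_smul_right, j1.inner_self,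
        j2.inner_self]
      rw [← Complex.zero_re]
      congr 1
      simp
      linear_combination (-((p.1 : ℂ) ^ 2)⁻¹) * e
    have r1 : pairing
        (fderiv ℝ (warped (·⁻¹) (rotation μ γ₁ γ₂ γ₁) (rotation μ γ₁ γ₂ γ₂) f₁ f₂) p)
        (fderiv ℝ (coneMap γ₁ γ₂ f₁ f₂) p) (0, 1, 0, 0) (0, 1, 0, 0) =
        (μ * (Complex.I * μ +
          Module.finrank ℝ E₁ * ((starRingEnd ℂ) (deriv γ₁ p.2.1) * c₁ p.2.1) +
          Module.finrank ℝ E₂ * ((starRingEnd ℂ) (deriv γ₂ p.2.1) * c₂ p.2.1))).re := by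
      rw [← hγ.deriv_rotation_inner hp.2.1, pairing_apply, hA, hF, warpedDeriv_apply,
        warpedDeriv_apply, inner_real_eq_re, inner_pair]
      simp only [map_zero, smul_zero, add_zero, inner_smul_left, inner_smul_right, j1.inner_self,
        j2.inner_self]
      congr 1
      simp
      field_simp
    rw [r0, r1]
    have d1 : (Module.finrank ℝ E₁ : ℂ) * ((starRingEnd ℂ) (deriv γ₁ p.2.1) * c₁ p.2.1) =
        Module.finrank ℝ E₁ * ((starRingEnd ℂ) (deriv γ₁ p.2.1) * γ₁ p.2.1) *
          ((‖γ₁ p.2.1‖ ^ 2 : ℝ) : ℂ)⁻¹ := by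
      rcases hγ.coeff₁ hp.2.1 with h | h
      · simp [h]
      · rw [h]
        ring
    have d2 : (Module.finrank ℝ E₂ : ℂ) * ((starRingEnd ℂ) (deriv γ₂ p.2.1) * c₂ p.2.1) =
        Module.finrank ℝ E₂ * ((starRingEnd ℂ) (deriv γ₂ p.2.1) * γ₂ p.2.1) *
          ((‖γ₂ p.2.1‖ ^ 2 : ℝ) : ℂ)⁻¹ := by
      rcases hγ.coeff₂ hp.2.1 with h | h
      · simp [h]
      · rw [h]
        ring
    rw [d1, d2]
    simp only [rotation, map_mul, Complex.conj_ofReal, ← Complex.ofReal_inv,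
      ← Complex.ofReal_neg, ← Complex.ofReal_natCast, smul_eq_mul]
    simp only [mul_assoc, Complex.re_ofReal_mul, Complex.add_re, mul_comm _ (Complex.ofReal _),
      Complex.I_re, mul_zero, mul_inv]
    ring
  · intro u v
    rw [pairing_apply, hA, hF, warpedDeriv_apply, warpedDeriv_apply, inner_real_eq_re, inner_pair]
    simp [j1.inner_real]
    field_simp
  · intro u v
    rw [pairing_apply, hA, hF, warpedDeriv_apply, warpedDeriv_apply, inner_real_eq_re, inner_pair]
    simp [j2.inner_real]
    field_simp

theorem frameTrace_sphericalTrace {p : ℝ × ℝ × E₁ × E₂} (hp : p ∈ warpedDomain T U₁ U₂) :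
    frameTrace (fderiv ℝ (coneMap γ₁ γ₂ f₁ f₂) p) (pairing
      (fderiv ℝ (warped (·⁻¹) c₁ c₂ (fun y => Complex.I • sphericalTrace f₁ y)
        (fun y => Complex.I • sphericalTrace f₂ y)) p)
      (fderiv ℝ (coneMap γ₁ γ₂ f₁ f₂) p)) =
      (p.1 ^ 2 * ‖γ₁ p.2.1‖ ^ 2)⁻¹ * frameTrace (fderiv ℝ f₁ p.2.2.1)
        (pairing (fderiv ℝ (fun y => Complex.I • sphericalTrace f₁ y) p.2.2.1)
          (fderiv ℝ f₁ p.2.2.1)) +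
      (p.1 ^ 2 * ‖γ₂ p.2.1‖ ^ 2)⁻¹ * frameTrace (fderiv ℝ f₂ p.2.2.2)
        (pairing (fderiv ℝ (fun y => Complex.I • sphericalTrace f₂ y) p.2.2.2)
          (fderiv ℝ f₂ p.2.2.2)) := by
  have hs : p.1 ≠ 0 := hp.1
  have hs' : (p.1 : ℂ) ≠ 0 := by exact_mod_cast hs
  have hA := (hasFDerivAt_warped (p := p) (hasDerivAt_inv hs)
    (hγ.differentiable₁ _ hp.2.1).hasDerivAt (hγ.differentiable₂ _ hp.2.1).hasDerivAt
    ((h₁.differentiableAt_sphericalTrace hp.2.2.1).fun_const_smul Complex.I).hasFDerivAt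
    ((h₂.differentiableAt_sphericalTrace hp.2.2.2).fun_const_smul Complex.I).hasFDerivAt).fderiv
  have a1 := h₁.inner_sphericalTrace_self hp.2.2.1
  have a2 := h₂.inner_sphericalTrace_self hp.2.2.2
  have hF := fderiv_cone hγ h₁ h₂ hp
  rw [frameTrace_cone hγ h₁ h₂ hp _
    (pairing (fderiv ℝ (fun y => Complex.I • sphericalTrace f₁ y) p.2.2.1) (fderiv ℝ f₁ p.2.2.1))
    (pairing (fderiv ℝ (fun y => Complex.I • sphericalTrace f₂ y) p.2.2.2)
      (fderiv ℝ f₂ p.2.2.2))]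
  · rw [pairing_apply, pairing_apply, hA, hF, warpedDeriv_apply, warpedDeriv_apply,
      warpedDeriv_apply, warpedDeriv_apply, inner_real_pair, inner_real_pair]
    simp [inner_real_eq_re, a1, a2]
  · intro u v
    rcases hγ.inv₁ _ hp.2.1 with h0 | h0
    · have : Subsingleton E₁ := Module.finrank_zero_iff.1 h0
      have hz : ((0, 0, 0, 0) : ℝ × ℝ × E₁ × E₂) = 0 := rfl
      rw [Subsingleton.elim u 0, hz, map_zero, map_zero]
      rfl
    · have := congrArg (starRingEnd ℂ) h0
      simp only [map_mul, Complex.conj_conj, map_one] at this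
      rw [pairing_apply, pairing_apply, hA, hF, warpedDeriv_apply, warpedDeriv_apply,
        inner_real_eq_re, inner_real_eq_re, inner_pair]
      congr 1
      simp
      field_simp
      linear_combination (inner ℂ (fderiv ℝ (fun y => Complex.I • sphericalTrace f₁ y) p.2.2.1 u)
        (fderiv ℝ f₁ p.2.2.1 v)) * this
  · intro u v
    rcases hγ.inv₂ _ hp.2.1 with h0 | h0
    · have : Subsingleton E₂ := Module.finrank_zero_iff.1 h0
      have hz : ((0, 0, 0, 0) : ℝ × ℝ × E₁ × E₂) = 0 := rfl
      rw [Subsingleton.elim u 0, hz, map_zero, map_zero]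
      rfl
    · have := congrArg (starRingEnd ℂ) h0
      simp only [map_mul, Complex.conj_conj, map_one] at this
      rw [pairing_apply, pairing_apply, hA, hF, warpedDeriv_apply, warpedDeriv_apply,
        inner_real_eq_re, inner_real_eq_re, inner_pair]
      congr 1
      simp
      field_simp
      linear_combination (inner ℂ (fderiv ℝ (fun y => Complex.I • sphericalTrace f₂ y) p.2.2.2 u)
        (fderiv ℝ f₂ p.2.2.2 v)) * this

omit hγ h₁ h₂ in
theorem tangentialDivergence_eq {E : Type*} [NormedAddCommGroup E] [NormedSpace ℝ E]
    [FiniteDimensional ℝ E] {ι : Type*} [Fintype ι] (F Z : E → CSpace ι) (y : E) :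
    tangentialDivergence F Z y =
      frameTrace (fderiv ℝ F y) (pairing (fderiv ℝ Z y) (fderiv ℝ F y)) := rfl

omit hγ h₁ h₂ in
theorem frameTrace_pairing_sphericalTrace {E : Type*} [NormedAddCommGroup E] [NormedSpace ℝ E]
    [FiniteDimensional ℝ E] {ι : Type*} [Fintype ι] (f : E → CSpace ι) (y : E)
    (h : tangentialDivergence f (fun y => Complex.I • sphericalMeanCurvature f y) y = 0) :
    frameTrace (fderiv ℝ f y) (pairing (fderiv ℝ (fun y => Complex.I • sphericalTrace f y) y)
      (fderiv ℝ f y)) = 0 := by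
  rcases eq_or_ne (Module.finrank ℝ E) 0 with h0 | h0
  · have : Subsingleton E := Module.finrank_zero_iff.1 h0
    rw [frameTrace_of_subsingleton]
  · have hn : (Module.finrank ℝ E : ℝ) ≠ 0 := by exact_mod_cast h0
    have he : (fun y => Complex.I • sphericalTrace f y) =
        (Module.finrank ℝ E : ℝ) • fun y => Complex.I • sphericalMeanCurvature f y := by
      funext z
      rw [sphericalTrace_eq_smul, Pi.smul_apply, smul_comm]
    have hp : pairing ((Module.finrank ℝ E : ℝ) •
        fderiv ℝ (fun y => Complex.I • sphericalMeanCurvature f y) y) (fderiv ℝ f y) =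
        (Module.finrank ℝ E : ℝ) • pairing
          (fderiv ℝ (fun y => Complex.I • sphericalMeanCurvature f y) y) (fderiv ℝ f y) := by
      ext u v
      simp [inner_smul_left]
    rw [he, fderiv_const_smul_field, Pi.smul_apply, hp, frameTrace_smul, ← tangentialDivergence_eq, h, smul_zero]

theorem tangentialDivergence_cone {p : ℝ × ℝ × E₁ × E₂} (hp : p ∈ warpedDomain T U₁ U₂)
    (hd₁ : tangentialDivergence f₁ (fun y => Complex.I • sphericalMeanCurvature f₁ y)
      p.2.2.1 = 0)
    (hd₂ : tangentialDivergence f₂ (fun y => Complex.I • sphericalMeanCurvature f₂ y)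
      p.2.2.2 = 0) :
    tangentialDivergence (coneMap γ₁ γ₂ f₁ f₂)
      (fun q => Complex.I • euclideanMeanCurvature (coneMap γ₁ γ₂ f₁ f₂) q) p = 0 := by
  set A := warped (E₁ := E₁) (E₂ := E₂) (·⁻¹) (rotation μ γ₁ γ₂ γ₁) (rotation μ γ₁ γ₂ γ₂) f₁ f₂
    with hA
  set A' := warped (·⁻¹) c₁ c₂ (fun y => Complex.I • sphericalTrace f₁ y)
    (fun y => Complex.I • sphericalTrace f₂ y) with hA'
  have he : (fun q => Complex.I • euclideanMeanCurvature (coneMap γ₁ γ₂ f₁ f₂) q) =ᶠ[nhds p]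
      (Module.finrank ℝ (ℝ × ℝ × E₁ × E₂) : ℝ)⁻¹ • (A + A') := by
    filter_upwards [(isOpen_warpedDomain hγ h₁ h₂).mem_nhds hp] with q hq
    rw [euclideanMeanCurvature_cone hγ h₁ h₂ hq, Pi.smul_apply, coneTrace, smul_comm, Pi.neg_apply,
      Pi.smul_apply, smul_neg, smul_smul, Complex.I_mul_I, neg_one_smul, neg_neg]
  have hs : p.1 ≠ 0 := hp.1
  have d1 : DifferentiableAt ℝ A p := (hasFDerivAt_warped (p := p) (hasDerivAt_inv hs)
    (hγ.hasDerivAt_rotation₁ hp.2.1) (hγ.hasDerivAt_rotation₂ hp.2.1) (h₁.hasFDerivAt hp.2.2.1)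
    (h₂.hasFDerivAt hp.2.2.2)).differentiableAt
  have d2 : DifferentiableAt ℝ A' p := (hasFDerivAt_warped (p := p) (hasDerivAt_inv hs)
    (hγ.differentiable₁ _ hp.2.1).hasDerivAt (hγ.differentiable₂ _ hp.2.1).hasDerivAt
    ((h₁.differentiableAt_sphericalTrace hp.2.2.1).fun_const_smul Complex.I).hasFDerivAt
    ((h₂.differentiableAt_sphericalTrace hp.2.2.2).fun_const_smul
      Complex.I).hasFDerivAt).differentiableAt
  have hp' : pairing ((Module.finrank ℝ (ℝ × ℝ × E₁ × E₂) : ℝ)⁻¹ • (fderiv ℝ A p + fderiv ℝ A' p))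
      (fderiv ℝ (coneMap γ₁ γ₂ f₁ f₂) p) = (Module.finrank ℝ (ℝ × ℝ × E₁ × E₂) : ℝ)⁻¹ •
      (pairing (fderiv ℝ A p) (fderiv ℝ (coneMap γ₁ γ₂ f₁ f₂) p) +
        pairing (fderiv ℝ A' p) (fderiv ℝ (coneMap γ₁ γ₂ f₁ f₂) p)) := by
    refine LinearMap.ext fun u => LinearMap.ext fun v => ?_
    simp [inner_smul_left, inner_add_left]
  rw [tangentialDivergence_eq, he.fderiv_eq, fderiv_const_smul_field, Pi.smul_apply,
    fderiv_add d1 d2, hp',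
    frameTrace_smul, frameTrace_add, frameTrace_rotation hγ h₁ h₂ hp,
    frameTrace_sphericalTrace hγ h₁ h₂ hp, frameTrace_pairing_sphericalTrace _ _ hd₁,
    frameTrace_pairing_sphericalTrace _ _ hd₂]
  simp

end ConeGeometry

section ReducedCurve

/-- A curve in the unit sphere of `ℂ²` with `a' = e conj(a)^n conj(b)^(m+1)` and
`b' = -e conj(a)^(n+1) conj(b)^m`, where `e` rotates in the unit circle with velocity `μ`. -/
structure IsReducedCurve (n m : ℕ) (μ : ℝ) (e a b : ℝ → ℂ) (T : Set ℝ) : Prop where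
  isOpen : IsOpen T
  smooth₁ : ContDiffOn ℝ ∞ a T
  smooth₂ : ContDiffOn ℝ ∞ b T
  norm_eq : ∀ t ∈ T, ‖a t‖ ^ 2 + ‖b t‖ ^ 2 = 1
  deriv₁ : ∀ t ∈ T, deriv a t = e t * (starRingEnd ℂ) (a t) ^ n * (starRingEnd ℂ) (b t) ^ (m + 1)
  deriv₂ : ∀ t ∈ T,
    deriv b t = -(e t * (starRingEnd ℂ) (a t) ^ (n + 1) * (starRingEnd ℂ) (b t) ^ m)
  hasDerivAt_phase : ∀ t ∈ T, HasDerivAt e (Complex.I * μ * e t) t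
  norm_phase : ∀ t ∈ T, ‖e t‖ = 1
  ne_zero₁ : ∀ t ∈ T, n = 0 ∨ a t ≠ 0
  ne_zero₂ : ∀ t ∈ T, m = 0 ∨ b t ≠ 0

/-- The inverse of the conjugate of `a`, unless `n = 0`. -/
def conjInv (n : ℕ) (a : ℝ → ℂ) (t : ℝ) : ℂ :=
  if n = 0 then 0 else ((starRingEnd ℂ) (a t))⁻¹

theorem conjInv_mul {n : ℕ} {a : ℝ → ℂ} {t : ℝ} (h : n = 0 ∨ a t ≠ 0) :
    n = 0 ∨ conjInv n a t * (starRingEnd ℂ) (a t) = 1 := by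
  by_cases hn : n = 0
  · exact Or.inl hn
  · refine Or.inr ?_
    rw [conjInv, if_neg hn, inv_mul_cancel₀]
    simpa using h.resolve_left hn

theorem hasDerivAt_conj {f : ℝ → ℂ} {f' : ℂ} {t : ℝ} (h : HasDerivAt f f' t) :
    HasDerivAt (fun t => (starRingEnd ℂ) (f t)) ((starRingEnd ℂ) f') t :=
  Complex.conjCLE.hasFDerivAt.comp_hasDerivAt t h

theorem differentiableAt_conjInv {n : ℕ} {a : ℝ → ℂ} {t : ℝ} (ha : DifferentiableAt ℝ a t)
    (h : n = 0 ∨ a t ≠ 0) : DifferentiableAt ℝ (conjInv n a) t := by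
  by_cases hn : n = 0
  · have : conjInv n a = fun _ => 0 := by
      funext t
      simp [conjInv, hn]
    rw [this]
    exact differentiableAt_const _
  · have : conjInv n a = fun t => ((starRingEnd ℂ) (a t))⁻¹ := by
      funext t
      simp [conjInv, hn]
    rw [this]
    exact (hasDerivAt_conj ha.hasDerivAt).differentiableAt.fun_inv
      (by simpa using h.resolve_left hn)

namespace IsReducedCurve

variable {n m : ℕ} {μ : ℝ} {e a b : ℝ → ℂ} {T : Set ℝ} {t : ℝ}

theorem symm (h : IsReducedCurve n m μ e a b T) : IsReducedCurve m n μ (-e) b a T where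
  isOpen := h.isOpen
  smooth₁ := h.smooth₂
  smooth₂ := h.smooth₁
  norm_eq t ht := by rw [add_comm, h.norm_eq t ht]
  deriv₁ t ht := by
    rw [h.deriv₂ t ht, Pi.neg_apply]
    ring
  deriv₂ t ht := by
    rw [h.deriv₁ t ht, Pi.neg_apply]
    ring
  hasDerivAt_phase t ht := by
    simpa using (h.hasDerivAt_phase t ht).neg
  norm_phase t ht := by simpa using h.norm_phase t ht
  ne_zero₁ := h.ne_zero₂
  ne_zero₂ := h.ne_zero₁

theorem hasDerivAt (h : IsReducedCurve n m μ e a b T) (ht : t ∈ T) : HasDerivAt a (deriv a t) t :=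
  ((h.smooth₁.contDiffAt (h.isOpen.mem_nhds ht)).differentiableAt (by simp)).hasDerivAt

theorem jet (h : IsReducedCurve n m μ e a b T) (ht : t ∈ T) :
    IsCurveJet (a t) (deriv a t) (b t) (deriv b t) := by
  refine ⟨h.norm_eq t ht, ?_⟩
  rw [h.deriv₁ t ht, h.deriv₂ t ht]
  ring

theorem norm_mul_conj (h : IsReducedCurve n m μ e a b T) (ht : t ∈ T) :
    a t * (starRingEnd ℂ) (a t) + b t * (starRingEnd ℂ) (b t) = 1 := by
  rw [Complex.mul_conj', Complex.mul_conj']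
  exact_mod_cast h.norm_eq t ht

theorem phase_mul_conj (h : IsReducedCurve n m μ e a b T) (ht : t ∈ T) :
    e t * (starRingEnd ℂ) (e t) = 1 := by
  rw [Complex.mul_conj', h.norm_phase t ht]
  simp

theorem conj_deriv₁ (h : IsReducedCurve n m μ e a b T) (ht : t ∈ T) :
    (starRingEnd ℂ) (deriv a t) = (starRingEnd ℂ) (e t) * a t ^ n * b t ^ (m + 1) := by
  simp [h.deriv₁ t ht]

theorem conj_deriv₂ (h : IsReducedCurve n m μ e a b T) (ht : t ∈ T) :
    (starRingEnd ℂ) (deriv b t) = -((starRingEnd ℂ) (e t) * a t ^ (n + 1) * b t ^ m) := by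
  simp [h.deriv₂ t ht]

theorem speedSq_eq (h : IsReducedCurve n m μ e a b T) (ht : t ∈ T) :
    (speedSq a b t : ℂ) = (a t * (starRingEnd ℂ) (a t)) ^ n *
      (b t * (starRingEnd ℂ) (b t)) ^ m := by
  rw [IsConeCurve.speedSq_eq, h.conj_deriv₁ ht, h.conj_deriv₂ ht, h.deriv₁ t ht, h.deriv₂ t ht]
  have h1 := h.phase_mul_conj ht
  have h2 := h.norm_mul_conj ht
  rw [mul_pow, mul_pow]
  linear_combination (a t ^ n * (starRingEnd ℂ) (a t) ^ n * (b t ^ m * (starRingEnd ℂ) (b t) ^ m)) *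
    (h1 * (a t * (starRingEnd ℂ) (a t) + b t * (starRingEnd ℂ) (b t)) + h2)

theorem speedSq_ne_zero (h : IsReducedCurve n m μ e a b T) (ht : t ∈ T) : speedSq a b t ≠ 0 := by
  have : (speedSq a b t : ℂ) ≠ 0 := by
    rw [h.speedSq_eq ht]
    refine mul_ne_zero ?_ ?_
    · rcases h.ne_zero₁ t ht with h | h
      · simp [h]
      · simp [h]
    · rcases h.ne_zero₂ t ht with h | h
      · simp [h]
      · simp [h]
  exact_mod_cast this

theorem accel (h : IsReducedCurve n m μ e a b T) (ht : t ∈ T) :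
    deriv (deriv a) t = Complex.I * μ * deriv a t +
      speedSq a b t * (-(n + m + 1 : ℂ) * a t + n * conjInv n a t) := by
  have ha := hasDerivAt_conj (h.hasDerivAt ht)
  have hb := hasDerivAt_conj (h.symm.hasDerivAt ht)
  have hd := ((h.hasDerivAt_phase t ht).mul (ha.pow n)).mul (hb.pow (m + 1))
  have he : deriv a =ᶠ[nhds t]
      fun t => e t * (starRingEnd ℂ) (a t) ^ n * (starRingEnd ℂ) (b t) ^ (m + 1) := by
    filter_upwards [h.isOpen.mem_nhds ht] with r hr using h.deriv₁ r hr
  rw [(hd.congr_of_eventuallyEq he).deriv, h.conj_deriv₁ ht, h.conj_deriv₂ ht, h.deriv₁ t ht,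
    h.speedSq_eq ht]
  have h1 := h.phase_mul_conj ht
  have h2 := h.norm_mul_conj ht
  have hX : (n : ℂ) * (starRingEnd ℂ) (a t) ^ (n - 1) =
      n * conjInv n a t * (starRingEnd ℂ) (a t) ^ n := by
    rcases conjInv_mul (h.ne_zero₁ t ht) with h0 | h0
    · simp [h0]
    · rcases n with _ | k
      · simp
      · rw [pow_succ]
        simp only [Nat.add_sub_cancel]
        linear_combination (-(((k + 1 : ℕ) : ℂ) * (starRingEnd ℂ) (a t) ^ k)) * h0
  have hc : (n : ℂ) * conjInv n a t * (starRingEnd ℂ) (a t) = n := by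
    rcases conjInv_mul (h.ne_zero₁ t ht) with h0 | h0
    · simp [h0]
    · linear_combination (n : ℂ) * h0
  simp only [Pi.pow_apply, Pi.mul_apply, Nat.add_sub_cancel, mul_pow, Nat.cast_add, Nat.cast_one]
  set A := (starRingEnd ℂ) (a t)
  set B := (starRingEnd ℂ) (b t)
  set P := a t ^ n * A ^ n * (b t ^ m * B ^ m)
  linear_combination (e t * (starRingEnd ℂ) (e t) * a t ^ n * b t ^ (m + 1) * B ^ (m + 1)) * hX +
    (P * (n * conjInv n a t * b t * B - (m + 1) * a t)) * h1 +
    (P * n * conjInv n a t) * h2 - (P * a t) * hc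

theorem isConeCurve (h : IsReducedCurve n m μ e a b T) :
    IsConeCurve n m μ a b (conjInv n a) (conjInv m b) T where
  isOpen := h.isOpen
  smooth₁ := h.smooth₁
  smooth₂ := h.smooth₂
  jet t ht := h.jet ht
  speed t ht := h.speedSq_ne_zero ht
  accel₁ t ht := h.accel ht
  accel₂ t ht := by
    rw [h.symm.accel ht, speedSq, speedSq, add_comm (‖deriv b t‖ ^ 2), add_comm (m : ℂ)]
  differentiable₁ t ht := differentiableAt_conjInv (h.hasDerivAt ht).differentiableAt
    (h.ne_zero₁ t ht)
  differentiable₂ t ht := differentiableAt_conjInv (h.symm.hasDerivAt ht).differentiableAt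
    (h.ne_zero₂ t ht)
  inv₁ t ht := conjInv_mul (h.ne_zero₁ t ht)
  inv₂ t ht := conjInv_mul (h.ne_zero₂ t ht)

end IsReducedCurve

theorem eventually_deriv_eq_of_mul_conj {g w : ℝ → ℂ} {n : ℕ} {t : ℝ}
    (hg : ContDiffAt ℝ ∞ g t) (hw : ContinuousAt w t)
    (h : ∀ᶠ r in nhds t, deriv g r * (starRingEnd ℂ) (g r) = w r * (starRingEnd ℂ) (g r) ^ (n + 1))
    (hne : g t ≠ 0 ∨ deriv g t ≠ 0) :
    ∀ᶠ r in nhds t, deriv g r = w r * (starRingEnd ℂ) (g r) ^ n := by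
  have hcancel : ∀ r, g r ≠ 0 →
      deriv g r * (starRingEnd ℂ) (g r) = w r * (starRingEnd ℂ) (g r) ^ (n + 1) →
      deriv g r = w r * (starRingEnd ℂ) (g r) ^ n := by
    intro r hr he
    rw [pow_succ, ← mul_assoc] at he
    exact mul_right_cancel₀ (by simpa using hr) he
  by_cases h0 : g t = 0
  · have hd := (hg.differentiableAt (by simp)).hasDerivAt
    have hp : ∀ᶠ r in nhdsWithin t {t}ᶜ, deriv g r = w r * (starRingEnd ℂ) (g r) ^ n := by
      filter_upwards [hd.eventually_ne (c := 0) (hne.resolve_left (not_not.2 h0)),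
        h.filter_mono nhdsWithin_le_nhds] with r hr he using hcancel r hr he
    have hcd : ContinuousAt (deriv g) t := by
      have h2 : ContDiffAt ℝ ∞ (fun r => fderiv ℝ g r 1) t :=
        (hg.fderiv_right (m := ∞) (by simp)).clm_apply contDiffAt_const
      exact h2.continuousAt
    have hcw : ContinuousAt (fun r => w r * (starRingEnd ℂ) (g r) ^ n) t :=
      hw.mul ((Complex.continuous_conj.continuousAt.comp hg.continuousAt).pow n)
    have ht : deriv g t = w t * (starRingEnd ℂ) (g t) ^ n :=
      tendsto_nhds_unique_of_eventuallyEq (hcd.mono_left nhdsWithin_le_nhds)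
        (hcw.mono_left nhdsWithin_le_nhds) hp
    rw [eventually_nhdsWithin_iff] at hp
    filter_upwards [hp] with r hr
    by_cases hrt : r = t
    · rw [hrt, ht]
    · exact hr hrt
  · filter_upwards [h, hg.continuousAt.eventually_ne h0] with r he hr using hcancel r hr he

theorem exists_isReducedCurve {n₁ n₂ : ℕ} {J : Set ℝ} (hJ : IsOpen J) {γ₁ γ₂ : ℝ → ℂ}
    (hγ₁ : ContDiffOn ℝ ∞ γ₁ J) (hγ₂ : ContDiffOn ℝ ∞ γ₂ J)
    (hsphere : ∀ t ∈ J, ‖γ₁ t‖ ^ 2 + ‖γ₂ t‖ ^ 2 = 1) (μ : ℝ)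
    (hode₁ : ∀ t ∈ J, deriv γ₁ t * (starRingEnd ℂ) (γ₁ t) =
      Complex.I * Complex.exp (Complex.I * (μ * t)) *
        (starRingEnd ℂ) (γ₁ t) ^ (n₁ + 1) * (starRingEnd ℂ) (γ₂ t) ^ (n₂ + 1))
    (hode₂ : ∀ t ∈ J, deriv γ₂ t * (starRingEnd ℂ) (γ₂ t) =
      -(Complex.I * Complex.exp (Complex.I * (μ * t)) *
        (starRingEnd ℂ) (γ₁ t) ^ (n₁ + 1) * (starRingEnd ℂ) (γ₂ t) ^ (n₂ + 1)))
    {t : ℝ} (ht : t ∈ J) (h₁ : n₁ = 0 ∨ γ₁ t ≠ 0) (h₂ : n₂ = 0 ∨ γ₂ t ≠ 0)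
    (h₁' : γ₁ t ≠ 0 ∨ deriv γ₁ t ≠ 0) (h₂' : γ₂ t ≠ 0 ∨ deriv γ₂ t ≠ 0) :
    ∃ T, t ∈ T ∧ IsReducedCurve n₁ n₂ μ
      (fun t => Complex.I * Complex.exp (Complex.I * (μ * t))) γ₁ γ₂ T := by
  have hn := hJ.mem_nhds ht
  have d1 := hγ₁.contDiffAt hn
  have d2 := hγ₂.contDiffAt hn
  have hphase : ∀ r : ℝ, HasDerivAt (fun t : ℝ => Complex.I * Complex.exp (Complex.I * (μ * t)))
      (Complex.I * μ * (Complex.I * Complex.exp (Complex.I * (μ * r)))) r := by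
    intro r
    have := ((Complex.ofRealCLM.hasDerivAt (x := r)).const_mul (Complex.I * μ)).cexp.const_mul
      Complex.I
    refine (this.congr_deriv ?_).congr_of_eventuallyEq (.of_forall fun z => ?_)
    · simp only [Complex.ofRealCLM_apply, Complex.ofReal_one]
      ring_nf
    · simp only [Complex.ofRealCLM_apply, mul_assoc]
  have e1 := eventually_deriv_eq_of_mul_conj (n := n₁) (w := fun r => Complex.I *
    Complex.exp (Complex.I * (μ * r)) * (starRingEnd ℂ) (γ₂ r) ^ (n₂ + 1)) d1
    ((hphase t).continuousAt.mul
      ((Complex.continuous_conj.continuousAt.comp d2.continuousAt).pow _))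
    (by
      filter_upwards [hn] with r hr
      rw [hode₁ r hr]
      ring) h₁'
  have e2 := eventually_deriv_eq_of_mul_conj (n := n₂) (w := fun r => -(Complex.I *
    Complex.exp (Complex.I * (μ * r)) * (starRingEnd ℂ) (γ₁ r) ^ (n₁ + 1))) d2
    ((hphase t).continuousAt.mul
      ((Complex.continuous_conj.continuousAt.comp d1.continuousAt).pow _)).neg
    (by
      filter_upwards [hn] with r hr
      rw [hode₂ r hr]
      ring) h₂'
  have e3 : ∀ᶠ r in nhds t, n₁ = 0 ∨ γ₁ r ≠ 0 := by
    rcases h₁ with h | h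
    · exact .of_forall fun _ => Or.inl h
    · exact (d1.continuousAt.eventually_ne h).mono fun _ => Or.inr
  have e4 : ∀ᶠ r in nhds t, n₂ = 0 ∨ γ₂ r ≠ 0 := by
    rcases h₂ with h | h
    · exact .of_forall fun _ => Or.inl h
    · exact (d2.continuousAt.eventually_ne h).mono fun _ => Or.inr
  obtain ⟨T, hT, hTo, htT⟩ := eventually_nhds_iff.1 (((e1.and e2).and (e3.and e4)).and
    (Filter.eventually_mem_set.2 hn))
  exact ⟨T, htT,
    { isOpen := hTo
      smooth₁ := hγ₁.mono fun r hr => (hT r hr).2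
      smooth₂ := hγ₂.mono fun r hr => (hT r hr).2
      norm_eq := fun r hr => hsphere r (hT r hr).2
      deriv₁ := fun r hr => by
        rw [(hT r hr).1.1.1]
        ring
      deriv₂ := fun r hr => by
        rw [(hT r hr).1.1.2]
        ring
      hasDerivAt_phase := fun r _ => hphase r
      norm_phase := fun r _ => by
        rw [norm_mul, Complex.norm_I, one_mul, ← Complex.ofReal_mul, mul_comm,
          Complex.norm_exp_ofReal_mul_I]
      ne_zero₁ := fun r hr => (hT r hr).1.2.1
      ne_zero₂ := fun r hr => (hT r hr).1.2.2 }⟩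

end ReducedCurve

section Charts

set_option linter.unusedSectionVars false

variable {E : Type*} [NormedAddCommGroup E] [NormedSpace ℝ E]
  {H : Type*} [TopologicalSpace H] {I : ModelWithCorners ℝ E H} [I.Boundaryless]
  {M : Type*} [TopologicalSpace M] [ChartedSpace H M] {ι : Type*} [Fintype ι]

theorem push_eq_fderiv {f : M → CSpace ι} {x : M} (hf : MDifferentiableAt I 𝓘(ℝ, CSpace ι) f x) :
    push I f x = fderiv ℝ (coordRep I f x) (extChartAt I x x) := by
  funext v
  have key : ∀ L : E →L[ℝ] CSpace ι, HasFDerivWithinAt (coordRep I f x) L (Set.range I)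
      (extChartAt I x x) → L = fderiv ℝ (coordRep I f x) (extChartAt I x x) := by
    intro L h
    rw [I.range_eq_univ, hasFDerivWithinAt_univ] at h
    exact h.fderiv.symm
  exact DFunLike.congr_fun (key _ hf.hasMFDerivAt.2) v

theorem coordRep_apply_self (f : M → CSpace ι) (x : M) :
    coordRep I f x (extChartAt I x x) = f x :=
  congrArg f (extChartAt_to_inv x)

variable [IsManifold I ∞ M]

theorem exists_fderiv_coordRep {f : M → CSpace ι} (hf : ContMDiff I 𝓘(ℝ, CSpace ι) ∞ f) (x : M)
    {y : E} (hy : y ∈ (extChartAt I x).target) :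
    ∃ A : E → TangentSpace I ((extChartAt I x).symm y), Function.Injective A ∧
      ∀ v, fderiv ℝ (coordRep I f x) y v = push I f ((extChartAt I x).symm y) (A v) := by
  have : IsManifold I 1 M := .of_le (n := ∞) (by exact_mod_cast le_top)
  have hsymm : MDifferentiableAt 𝓘(ℝ, E) I (extChartAt I x).symm y :=
    ((contMDiffOn_extChartAt_symm (n := ∞) x).contMDiffAt
      ((isOpen_extChartAt_target x).mem_nhds hy)).mdifferentiableAt (by simp)
  have hinv := isInvertible_mfderivWithin_extChartAt_symm (I := I) hy
  rw [I.range_eq_univ, mfderivWithin_univ] at hinv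
  obtain ⟨A, hA⟩ := hinv
  refine ⟨mfderiv 𝓘(ℝ, E) I (extChartAt I x).symm y, hA ▸ A.injective, fun v => ?_⟩
  rw [← mfderiv_eq_fderiv, coordRep, mfderiv_comp y ((hf _).mdifferentiableAt (by simp)) hsymm]
  rfl

theorem contDiffOn_coordRep {f : M → CSpace ι} (hf : ContMDiff I 𝓘(ℝ, CSpace ι) ∞ f) (x : M) :
    ContDiffOn ℝ ∞ (coordRep I f x) (extChartAt I x).target :=
  contMDiffOn_iff_contDiffOn.1 (hf.comp_contMDiffOn (contMDiffOn_extChartAt_symm x))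

theorem IsLegendrianImmersionOn.isLocalLegendrian [FiniteDimensional ℝ E] {f : M → CSpace ι}
    (h : IsLegendrianImmersionOn I f Set.univ) (x : M) :
    IsLocalLegendrian (coordRep I f x) (extChartAt I x).target where
  isOpen := isOpen_extChartAt_target x
  smooth := contDiffOn_coordRep (contMDiffOn_univ.1 h.smooth) x
  norm_eq y _ := mem_sphere_zero_iff_norm.1 (h.mem_sphere _ (Set.mem_univ ((extChartAt I x).symm y)))
  immersion y hy := by
    obtain ⟨A, hA, hA'⟩ := exists_fderiv_coordRep (contMDiffOn_univ.1 h.smooth) x hy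
    intro u v huv
    rw [hA', hA'] at huv
    exact hA (h.immersion _ (Set.mem_univ _) huv)
  legendrian y hy v := by
    obtain ⟨A, -, hA'⟩ := exists_fderiv_coordRep (contMDiffOn_univ.1 h.smooth) x hy
    rw [hA']
    exact h.legendrian _ (Set.mem_univ _) _

end Charts

section Regularity

variable {E₁ : Type*} [NormedAddCommGroup E₁] [NormedSpace ℝ E₁]
  {E₂ : Type*} [NormedAddCommGroup E₂] [NormedSpace ℝ E₂]
  {ι₁ ι₂ : Type*} [Fintype ι₁] [Fintype ι₂]
  {s : ℝ} {g₁ g₁' g₂ g₂' : ℂ} {x₁ : CSpace ι₁} {x₂ : CSpace ι₂}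
  {L₁ : E₁ →L[ℝ] CSpace ι₁} {L₂ : E₂ →L[ℝ] CSpace ι₂}

theorem nondegenerate_of_warpedDeriv_injective
    (h : Function.Injective (warpedDeriv s 1 g₁ g₁' g₂ g₂' x₁ x₂ L₁ L₂)) :
    s ≠ 0 ∧ (g₁ ≠ 0 ∨ Subsingleton E₁) ∧ (g₂ ≠ 0 ∨ Subsingleton E₂) ∧ (g₁' ≠ 0 ∨ g₂' ≠ 0) := by
  rw [injective_iff_map_eq_zero] at h
  have hz : pair (0 : CSpace ι₁) (0 : CSpace ι₂) = 0 :=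
    pair_ext (fun _ => by simp) (fun _ => by simp)
  refine ⟨?_, ?_, ?_, ?_⟩
  · rintro rfl
    have := h (0, 1, 0, 0) (by simp [warpedDeriv_apply, hz])
    simp at this
  · by_contra! hg
    obtain ⟨u, hu⟩ := @exists_ne _ hg.2 (0 : E₁)
    have := h (0, 0, u, 0) (by simp [warpedDeriv_apply, hz, hg.1])
    simp [hu] at this
  · by_contra! hg
    obtain ⟨u, hu⟩ := @exists_ne _ hg.2 (0 : E₂)
    have := h (0, 0, 0, u) (by simp [warpedDeriv_apply, hz, hg.1])
    simp [hu] at this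
  · by_contra! hg
    have := h (0, 1, 0, 0) (by simp [warpedDeriv_apply, hz, hg.1, hg.2])
    simp at this

end Regularity

section Smoothness

set_option linter.unusedSectionVars false

variable {n₁ n₂ : ℕ}
  {N₁ : Type*} [TopologicalSpace N₁] [ChartedSpace (EuclideanSpace ℝ (Fin n₁)) N₁]
  {N₂ : Type*} [TopologicalSpace N₂] [ChartedSpace (EuclideanSpace ℝ (Fin n₂)) N₂]
  {ι₁ ι₂ : Type*} [Fintype ι₁] [Fintype ι₂]
  {ψ₁ : N₁ → CSpace ι₁} {ψ₂ : N₂ → CSpace ι₂} {γ₁ γ₂ : ℝ → ℂ} {J : Set ℝ}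

theorem contMDiffOn_coneMap (hψ₁ : ContMDiff (𝓡 n₁) 𝓘(ℝ, CSpace ι₁) ∞ ψ₁)
    (hψ₂ : ContMDiff (𝓡 n₂) 𝓘(ℝ, CSpace ι₂) ∞ ψ₂) (hγ₁ : ContDiffOn ℝ ∞ γ₁ J)
    (hγ₂ : ContDiffOn ℝ ∞ γ₂ J) :
    ContMDiffOn (coneModel n₁ n₂) 𝓘(ℝ, CSpace (ι₁ ⊕ ι₂)) ∞ (coneMap γ₁ γ₂ ψ₁ ψ₂)
      (coneDomain N₁ N₂ J) := by
  have hΦ : ContDiff ℝ ∞ (fun w : ℝ × (ℂ × ℂ) × CSpace ι₁ × CSpace ι₂ =>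
      pair (((w.1 : ℂ) * w.2.1.1) • w.2.2.1) (((w.1 : ℂ) * w.2.1.2) • w.2.2.2)) := by
    have a1 : ContDiff ℝ ∞ (fun w : ℝ × (ℂ × ℂ) × CSpace ι₁ × CSpace ι₂ => (w.1 : ℂ)) :=
      Complex.ofRealCLM.contDiff.comp contDiff_fst
    have b1 : ContDiff ℝ ∞ (fun w : ℝ × (ℂ × ℂ) × CSpace ι₁ × CSpace ι₂ =>
      ((w.1 : ℂ) * w.2.1.1) • w.2.2.1) := (a1.mul (by fun_prop)).smul (by fun_prop)
    have b2 : ContDiff ℝ ∞ (fun w : ℝ × (ℂ × ℂ) × CSpace ι₁ × CSpace ι₂ =>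
      ((w.1 : ℂ) * w.2.1.2) • w.2.2.2) := (a1.mul (by fun_prop)).smul (by fun_prop)
    exact (pairCLM ι₁ ι₂).contDiff.comp (b1.prodMk b2)
  have m0 : ContMDiff (coneModel n₁ n₂) 𝓘(ℝ, ℝ) ∞ (fun x : ℝ × ℝ × N₁ × N₂ => x.1) :=
    contMDiff_fst
  have m1 : ContMDiff (coneModel n₁ n₂) 𝓘(ℝ, ℝ) ∞ (fun x : ℝ × ℝ × N₁ × N₂ => x.2.1) :=
    contMDiff_fst.comp contMDiff_snd
  have m2 : ContMDiff (coneModel n₁ n₂) (𝓡 n₁) ∞ (fun x : ℝ × ℝ × N₁ × N₂ => x.2.2.1) :=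
    contMDiff_fst.comp (contMDiff_snd.comp contMDiff_snd)
  have m3 : ContMDiff (coneModel n₁ n₂) (𝓡 n₂) ∞ (fun x : ℝ × ℝ × N₁ × N₂ => x.2.2.2) :=
    contMDiff_snd.comp (contMDiff_snd.comp contMDiff_snd)
  have k1 : ContMDiffOn (coneModel n₁ n₂) 𝓘(ℝ, ℂ) ∞ (fun x : ℝ × ℝ × N₁ × N₂ => γ₁ x.2.1)
      (coneDomain N₁ N₂ J) := hγ₁.contMDiffOn.comp m1.contMDiffOn fun x hx => hx
  have k2 : ContMDiffOn (coneModel n₁ n₂) 𝓘(ℝ, ℂ) ∞ (fun x : ℝ × ℝ × N₁ × N₂ => γ₂ x.2.1)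
      (coneDomain N₁ N₂ J) := hγ₂.contMDiffOn.comp m1.contMDiffOn fun x hx => hx
  exact hΦ.contMDiff.comp_contMDiffOn (m0.contMDiffOn.prodMk_space ((k1.prodMk_space k2).prodMk_space
    ((hψ₁.comp m2).contMDiffOn.prodMk_space (hψ₂.comp m3).contMDiffOn)))

theorem linkMap_eq (γ₁ γ₂ : ℝ → ℂ) (ψ₁ : N₁ → CSpace ι₁) (ψ₂ : N₂ → CSpace ι₂) :
    linkMap γ₁ γ₂ ψ₁ ψ₂ = fun x => coneMap γ₁ γ₂ ψ₁ ψ₂ (1, x) := by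
  funext x
  simp [linkMap, coneMap]

theorem coneMap_eq_cone (γ₁ γ₂ : ℝ → ℂ) (ψ₁ : N₁ → CSpace ι₁) (ψ₂ : N₂ → CSpace ι₂) :
    coneMap γ₁ γ₂ ψ₁ ψ₂ = cone (linkMap γ₁ γ₂ ψ₁ ψ₂) := by
  funext x
  exact pair_ext (fun k => by simp [cone, linkMap, coneMap, mul_assoc])
    (fun k => by simp [cone, linkMap, coneMap, mul_assoc])

theorem contMDiffOn_linkMap (hψ₁ : ContMDiff (𝓡 n₁) 𝓘(ℝ, CSpace ι₁) ∞ ψ₁)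
    (hψ₂ : ContMDiff (𝓡 n₂) 𝓘(ℝ, CSpace ι₂) ∞ ψ₂) (hγ₁ : ContDiffOn ℝ ∞ γ₁ J)
    (hγ₂ : ContDiffOn ℝ ∞ γ₂ J) :
    ContMDiffOn (linkModel n₁ n₂) 𝓘(ℝ, CSpace (ι₁ ⊕ ι₂)) ∞ (linkMap γ₁ γ₂ ψ₁ ψ₂)
      {x | x.1 ∈ J} := by
  rw [linkMap_eq]
  exact (contMDiffOn_coneMap hψ₁ hψ₂ hγ₁ hγ₂).comp
    ((contMDiff_const (c := (1 : ℝ))).prodMk contMDiff_id).contMDiffOn fun x hx => hx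

theorem coneDomain_mem_nhds (hJ : IsOpen J) {x : ℝ × ℝ × N₁ × N₂} (hx : x ∈ coneDomain N₁ N₂ J) :
    coneDomain N₁ N₂ J ∈ nhds x :=
  (hJ.preimage (continuous_fst.comp continuous_snd)).mem_nhds hx

end Smoothness

section Cone

variable {n₁ n₂ : ℕ}
  {N₁ : Type*} [TopologicalSpace N₁] [ChartedSpace (EuclideanSpace ℝ (Fin n₁)) N₁]
  [IsManifold (𝓡 n₁) ∞ N₁]
  {N₂ : Type*} [TopologicalSpace N₂] [ChartedSpace (EuclideanSpace ℝ (Fin n₂)) N₂]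
  [IsManifold (𝓡 n₂) ∞ N₂]
  {ι₁ ι₂ : Type*} [Fintype ι₁] [Fintype ι₂]
  {ψ₁ : N₁ → CSpace ι₁} {ψ₂ : N₂ → CSpace ι₂} {γ₁ γ₂ : ℝ → ℂ} {J : Set ℝ}
  (hψ₁ : IsLegendrianImmersionOn (𝓡 n₁) ψ₁ Set.univ)
  (hψ₂ : IsLegendrianImmersionOn (𝓡 n₂) ψ₂ Set.univ)
  (hJ : IsOpen J) (hγ₁ : ContDiffOn ℝ ∞ γ₁ J) (hγ₂ : ContDiffOn ℝ ∞ γ₂ J)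

include hψ₁ hψ₂ hJ hγ₁ hγ₂

theorem push_coneMap {x : ℝ × ℝ × N₁ × N₂} (hx : x ∈ coneDomain N₁ N₂ J)
    (v : TangentSpace (coneModel n₁ n₂) x) :
    push (coneModel n₁ n₂) (coneMap γ₁ γ₂ ψ₁ ψ₂) x v =
      warpedDeriv x.1 1 (γ₁ x.2.1) (deriv γ₁ x.2.1) (γ₂ x.2.1) (deriv γ₂ x.2.1)
        (ψ₁ x.2.2.1) (ψ₂ x.2.2.2)
        (fderiv ℝ (coordRep (𝓡 n₁) ψ₁ x.2.2.1) (extChartAt (𝓡 n₁) x.2.2.1 x.2.2.1))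
        (fderiv ℝ (coordRep (𝓡 n₂) ψ₂ x.2.2.2) (extChartAt (𝓡 n₂) x.2.2.2 x.2.2.2)) v := by
  have h1 := hψ₁.isLocalLegendrian x.2.2.1
  have h2 := hψ₂.isLocalLegendrian x.2.2.2
  rw [push_eq_fderiv (((contMDiffOn_coneMap (contMDiffOn_univ.1 hψ₁.smooth)
    (contMDiffOn_univ.1 hψ₂.smooth) hγ₁ hγ₂).contMDiffAt
      (coneDomain_mem_nhds hJ hx)).mdifferentiableAt (by simp))]
  have h := fderiv_coneMap (γ₁ := γ₁) (γ₂ := γ₂)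
    (p := (x.1, x.2.1, extChartAt (𝓡 n₁) x.2.2.1 x.2.2.1, extChartAt (𝓡 n₂) x.2.2.2 x.2.2.2))
    ((hγ₁.contDiffAt (hJ.mem_nhds hx)).differentiableAt (by simp))
    ((hγ₂.contDiffAt (hJ.mem_nhds hx)).differentiableAt (by simp))
    (h1.hasFDerivAt (mem_extChartAt_target x.2.2.1)).differentiableAt
    (h2.hasFDerivAt (mem_extChartAt_target x.2.2.2)).differentiableAt
  rw [coordRep_apply_self, coordRep_apply_self] at h
  exact DFunLike.congr_fun h v

theorem push_linkMap {x : ℝ × N₁ × N₂} (hx : x.1 ∈ J) (v : TangentSpace (linkModel n₁ n₂) x) :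
    push (linkModel n₁ n₂) (linkMap γ₁ γ₂ ψ₁ ψ₂) x v =
      warpedDeriv 1 1 (γ₁ x.1) (deriv γ₁ x.1) (γ₂ x.1) (deriv γ₂ x.1)
        (ψ₁ x.2.1) (ψ₂ x.2.2)
        (fderiv ℝ (coordRep (𝓡 n₁) ψ₁ x.2.1) (extChartAt (𝓡 n₁) x.2.1 x.2.1))
        (fderiv ℝ (coordRep (𝓡 n₂) ψ₂ x.2.2) (extChartAt (𝓡 n₂) x.2.2 x.2.2)) (0, v) := by
  have hx' : ((1 : ℝ), x) ∈ coneDomain N₁ N₂ J := hx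
  have hd : MDifferentiableAt (coneModel n₁ n₂) 𝓘(ℝ, CSpace (ι₁ ⊕ ι₂)) (coneMap γ₁ γ₂ ψ₁ ψ₂)
      ((1 : ℝ), x) := ((contMDiffOn_coneMap (contMDiffOn_univ.1 hψ₁.smooth)
    (contMDiffOn_univ.1 hψ₂.smooth) hγ₁ hγ₂).contMDiffAt
      (coneDomain_mem_nhds hJ hx')).mdifferentiableAt (by simp)
  have hi := (hasMFDerivAt_const (I := linkModel n₁ n₂) (I' := 𝓘(ℝ, ℝ)) (1 : ℝ) x).prodMk
    (hasMFDerivAt_id (I := linkModel n₁ n₂) x)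
  have h := (hd.hasMFDerivAt.comp x hi).mfderiv
  have h2 := push_coneMap hψ₁ hψ₂ hJ hγ₁ hγ₂ hx' (0, v)
  rw [linkMap_eq]
  exact (DFunLike.congr_fun h v).trans h2

end Cone

section ConeOverCurve

/-- The curves `γ` from which the cones are built: solutions of
`γ_j' conj(γ_j) = ± i exp(iμt) conj(γ₁)^(n₁+1) conj(γ₂)^(n₂+1)` in the unit sphere of `ℂ²`. -/
structure IsGeneratingCurve (n₁ n₂ : ℕ) (μ : ℝ) (γ₁ γ₂ : ℝ → ℂ) (J : Set ℝ) : Prop where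
  isOpen : IsOpen J
  smooth₁ : ContDiffOn ℝ ∞ γ₁ J
  smooth₂ : ContDiffOn ℝ ∞ γ₂ J
  norm_eq : ∀ t ∈ J, ‖γ₁ t‖ ^ 2 + ‖γ₂ t‖ ^ 2 = 1
  ode₁ : ∀ t ∈ J, deriv γ₁ t * (starRingEnd ℂ) (γ₁ t) =
    Complex.I * Complex.exp (Complex.I * (μ * t)) *
      (starRingEnd ℂ) (γ₁ t) ^ (n₁ + 1) * (starRingEnd ℂ) (γ₂ t) ^ (n₂ + 1)
  ode₂ : ∀ t ∈ J, deriv γ₂ t * (starRingEnd ℂ) (γ₂ t) =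
    -(Complex.I * Complex.exp (Complex.I * (μ * t)) *
      (starRingEnd ℂ) (γ₁ t) ^ (n₁ + 1) * (starRingEnd ℂ) (γ₂ t) ^ (n₂ + 1))

theorem IsGeneratingCurve.jet {n₁ n₂ : ℕ} {μ : ℝ} {γ₁ γ₂ : ℝ → ℂ} {J : Set ℝ} {t : ℝ}
    (h : IsGeneratingCurve n₁ n₂ μ γ₁ γ₂ J) (ht : t ∈ J) :
    IsCurveJet (γ₁ t) (deriv γ₁ t) (γ₂ t) (deriv γ₂ t) :=
  ⟨h.norm_eq t ht, by rw [h.ode₁ t ht, h.ode₂ t ht, add_neg_cancel]⟩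

theorem IsGeneratingCurve.exists_isReducedCurve {n₁ n₂ : ℕ} {μ : ℝ} {γ₁ γ₂ : ℝ → ℂ} {J : Set ℝ}
    {t : ℝ} (h : IsGeneratingCurve n₁ n₂ μ γ₁ γ₂ J) (ht : t ∈ J)
    (h₁ : n₁ = 0 ∨ γ₁ t ≠ 0) (h₂ : n₂ = 0 ∨ γ₂ t ≠ 0)
    (h' : (γ₁ t ≠ 0 ∧ γ₂ t ≠ 0) ∨ deriv γ₁ t ≠ 0 ∨ deriv γ₂ t ≠ 0) :
    ∃ T, t ∈ T ∧ IsReducedCurve n₁ n₂ μ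
      (fun t => Complex.I * Complex.exp (Complex.I * (μ * t))) γ₁ γ₂ T := by
  refine LagCone.exists_isReducedCurve h.isOpen h.smooth₁ h.smooth₂ h.norm_eq μ h.ode₁ h.ode₂ ht
    h₁ h₂ ?_ ?_
  · by_contra! h0
    have hn := h.norm_eq t ht
    have hγ : γ₂ t ≠ 0 := by
      intro h1
      simp [h0.1, h1] at hn
    have hd := h.ode₂ t ht
    rw [h0.1, map_zero] at hd
    simp [hγ] at hd
    simp [h0.1, h0.2, hd] at h'
  · by_contra! h0
    have hn := h.norm_eq t ht
    have hγ : γ₁ t ≠ 0 := by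
      intro h1
      simp [h0.1, h1] at hn
    have hd := h.ode₁ t ht
    rw [h0.1, map_zero] at hd
    simp [hγ] at hd
    simp [h0.1, h0.2, hd] at h'

variable {n₁ n₂ : ℕ}
  {N₁ : Type*} [TopologicalSpace N₁] [ChartedSpace (EuclideanSpace ℝ (Fin n₁)) N₁]
  [IsManifold (𝓡 n₁) ∞ N₁]
  {N₂ : Type*} [TopologicalSpace N₂] [ChartedSpace (EuclideanSpace ℝ (Fin n₂)) N₂]
  [IsManifold (𝓡 n₂) ∞ N₂]
  {ψ₁ : N₁ → CSpace (Fin (n₁ + 1))} {ψ₂ : N₂ → CSpace (Fin (n₂ + 1))}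
  {μ : ℝ} {γ₁ γ₂ : ℝ → ℂ} {J : Set ℝ}

theorem IsLegendrianImmersionOn.jet {E : Type*} [NormedAddCommGroup E] [NormedSpace ℝ E]
    [FiniteDimensional ℝ E] {H : Type*} [TopologicalSpace H] {I : ModelWithCorners ℝ E H}
    [I.Boundaryless] {M : Type*} [TopologicalSpace M] [ChartedSpace H M] [IsManifold I ∞ M]
    {ι : Type*} [Fintype ι] {f : M → CSpace ι} (h : IsLegendrianImmersionOn I f Set.univ) (x : M) :
    IsLegendrianJet (f x) (fderiv ℝ (coordRep I f x) (extChartAt I x x)) := by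
  have := (h.isLocalLegendrian x).jet (mem_extChartAt_target x)
  rwa [coordRep_apply_self] at this

variable (hψ₁ : IsLegendrianImmersionOn (𝓡 n₁) ψ₁ Set.univ)
  (hψ₂ : IsLegendrianImmersionOn (𝓡 n₂) ψ₂ Set.univ)
  (hγ : IsGeneratingCurve n₁ n₂ μ γ₁ γ₂ J)

include hψ₁ hψ₂ hγ

theorem isIsotropicAt_coneMap {x : ℝ × ℝ × N₁ × N₂} (hx : x ∈ coneDomain N₁ N₂ J) :
    IsIsotropicAt (coneModel n₁ n₂) (coneMap γ₁ γ₂ ψ₁ ψ₂) x := by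
  intro u v
  rw [push_coneMap hψ₁ hψ₂ hγ.isOpen hγ.smooth₁ hγ.smooth₂ hx,
    push_coneMap hψ₁ hψ₂ hγ.isOpen hγ.smooth₁ hγ.smooth₂ hx]
  exact warpedDeriv_isotropic (hγ.jet hx) (hψ₁.jet _) (hψ₂.jet _) u v

theorem push_coneMap_injective {x : ℝ × ℝ × N₁ × N₂} (hx : x ∈ coneDomain N₁ N₂ J)
    (hs : x.1 ≠ 0) (h₁ : γ₁ x.2.1 ≠ 0) (h₂ : γ₂ x.2.1 ≠ 0) :
    Function.Injective (push (coneModel n₁ n₂) (coneMap γ₁ γ₂ ψ₁ ψ₂) x) := by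
  obtain ⟨T, hT, hr⟩ := hγ.exists_isReducedCurve hx (Or.inr h₁) (Or.inr h₂) (Or.inl ⟨h₁, h₂⟩)
  intro u v huv
  rw [push_coneMap hψ₁ hψ₂ hγ.isOpen hγ.smooth₁ hγ.smooth₂ hx,
    push_coneMap hψ₁ hψ₂ hγ.isOpen hγ.smooth₁ hγ.smooth₂ hx] at huv
  exact warpedDeriv_injective (hγ.jet hx) (hψ₁.jet _) (hψ₂.jet _) hs (hr.speedSq_ne_zero hT)
    (Or.inl h₁) (Or.inl h₂) huv

theorem isLegendrianImmersionOn_linkMap :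
    IsLegendrianImmersionOn (linkModel n₁ n₂) (linkMap γ₁ γ₂ ψ₁ ψ₂)
      {x | x.1 ∈ J ∧ γ₁ x.1 ≠ 0 ∧ γ₂ x.1 ≠ 0} where
  dim := by
    simp
    omega
  smooth := (contMDiffOn_linkMap (contMDiffOn_univ.1 hψ₁.smooth) (contMDiffOn_univ.1 hψ₂.smooth)
    hγ.smooth₁ hγ.smooth₂).mono fun x hx => hx.1
  mem_sphere x hx := by
    have h := inner_real_warpedDeriv (s := 1) (hγ.jet hx.1) (hψ₁.jet x.2.1) (hψ₂.jet x.2.2)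
      (1, 0, 0, 0) (1, 0, 0, 0)
    have h' : linkMap γ₁ γ₂ ψ₁ ψ₂ x = warpedDeriv 1 1 (γ₁ x.1) (deriv γ₁ x.1) (γ₂ x.1)
        (deriv γ₂ x.1) (ψ₁ x.2.1) (ψ₂ x.2.2)
        (fderiv ℝ (coordRep (𝓡 n₁) ψ₁ x.2.1) (extChartAt (𝓡 n₁) x.2.1 x.2.1))
        (fderiv ℝ (coordRep (𝓡 n₂) ψ₂ x.2.2) (extChartAt (𝓡 n₂) x.2.2 x.2.2)) (1, 0, 0, 0) := by
      simp [warpedDeriv_apply, linkMap]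
    rw [← h', real_inner_self_eq_norm_sq] at h
    rw [mem_sphere_zero_iff_norm]
    exact (pow_eq_one_iff_of_nonneg (norm_nonneg _) two_ne_zero).1 (by simpa using h)
  immersion x hx := by
    obtain ⟨T, hT, hr⟩ := hγ.exists_isReducedCurve hx.1 (Or.inr hx.2.1) (Or.inr hx.2.2)
      (Or.inl hx.2)
    intro u v huv
    rw [push_linkMap hψ₁ hψ₂ hγ.isOpen hγ.smooth₁ hγ.smooth₂ hx.1,
      push_linkMap hψ₁ hψ₂ hγ.isOpen hγ.smooth₁ hγ.smooth₂ hx.1] at huv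
    exact congrArg Prod.snd (warpedDeriv_injective (hγ.jet hx.1) (hψ₁.jet x.2.1) (hψ₂.jet x.2.2)
      one_ne_zero (hr.speedSq_ne_zero hT) (Or.inl hx.2.1) (Or.inl hx.2.2) huv)
  legendrian x hx v := by
    have h := warpedDeriv_isotropic (s := 1) (hγ.jet hx.1) (hψ₁.jet x.2.1) (hψ₂.jet x.2.2)
      (1, 0, 0, 0) (0, v)
    have h' : linkMap γ₁ γ₂ ψ₁ ψ₂ x = warpedDeriv 1 1 (γ₁ x.1) (deriv γ₁ x.1) (γ₂ x.1)
        (deriv γ₂ x.1) (ψ₁ x.2.1) (ψ₂ x.2.2)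
        (fderiv ℝ (coordRep (𝓡 n₁) ψ₁ x.2.1) (extChartAt (𝓡 n₁) x.2.1 x.2.1))
        (fderiv ℝ (coordRep (𝓡 n₂) ψ₂ x.2.2) (extChartAt (𝓡 n₂) x.2.2 x.2.2)) (1, 0, 0, 0) := by
      simp [warpedDeriv_apply, linkMap]
    rw [push_linkMap hψ₁ hψ₂ hγ.isOpen hγ.smooth₁ hγ.smooth₂ hx.1, h', real_inner_comm]
    exact h

theorem exists_isReducedCurve_of_mem_regularSet {x : ℝ × ℝ × N₁ × N₂}
    (hx : x ∈ regularSet γ₁ γ₂ ψ₁ ψ₂ J) :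
    x.1 ≠ 0 ∧ ∃ T, x.2.1 ∈ T ∧ IsReducedCurve n₁ n₂ μ
      (fun t => Complex.I * Complex.exp (Complex.I * (μ * t))) γ₁ γ₂ T := by
  have hinj : Function.Injective (warpedDeriv x.1 1 (γ₁ x.2.1) (deriv γ₁ x.2.1) (γ₂ x.2.1)
      (deriv γ₂ x.2.1) (ψ₁ x.2.2.1) (ψ₂ x.2.2.2)
      (fderiv ℝ (coordRep (𝓡 n₁) ψ₁ x.2.2.1) (extChartAt (𝓡 n₁) x.2.2.1 x.2.2.1))
      (fderiv ℝ (coordRep (𝓡 n₂) ψ₂ x.2.2.2) (extChartAt (𝓡 n₂) x.2.2.2 x.2.2.2))) := by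
    intro u v huv
    exact hx.2 ((push_coneMap hψ₁ hψ₂ hγ.isOpen hγ.smooth₁ hγ.smooth₂ hx.1 u).trans
      (huv.trans (push_coneMap hψ₁ hψ₂ hγ.isOpen hγ.smooth₁ hγ.smooth₂ hx.1 v).symm))
  obtain ⟨hs, h₁, h₂, hd⟩ := nondegenerate_of_warpedDeriv_injective hinj
  have hdim : ∀ n : ℕ, Subsingleton (EuclideanSpace ℝ (Fin n)) → n = 0 := fun n hn => by
    simpa using Module.finrank_zero_iff (R := ℝ) (M := EuclideanSpace ℝ (Fin n)) |>.2 hn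
  exact ⟨hs, hγ.exists_isReducedCurve hx.1 (h₁.symm.imp_left (hdim _)) (h₂.symm.imp_left (hdim _))
    (Or.inr hd)⟩

theorem isLagrangianImmersionOn_coneMap :
    IsLagrangianImmersionOn (coneModel n₁ n₂) (coneMap γ₁ γ₂ ψ₁ ψ₂)
      (regularSet γ₁ γ₂ ψ₁ ψ₂ J) where
  dim := by
    simp
    omega
  smooth := (contMDiffOn_coneMap (contMDiffOn_univ.1 hψ₁.smooth) (contMDiffOn_univ.1 hψ₂.smooth)
    hγ.smooth₁ hγ.smooth₂).mono fun x hx => hx.1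
  immersion x hx := hx.2
  isotropic x hx := isIsotropicAt_coneMap hψ₁ hψ₂ hγ hx.1

omit hψ₁ hψ₂ in
theorem isHMinimalLagrangianOn_coneMap (hψ₁ : IsCMinimalLegendrianOn (𝓡 n₁) ψ₁ Set.univ)
    (hψ₂ : IsCMinimalLegendrianOn (𝓡 n₂) ψ₂ Set.univ) :
    IsHMinimalLagrangianOn (coneModel n₁ n₂) (coneMap γ₁ γ₂ ψ₁ ψ₂)
      (regularSet γ₁ γ₂ ψ₁ ψ₂ J) where
  toIsLagrangianImmersionOn := isLagrangianImmersionOn_coneMap hψ₁.toIsLegendrianImmersionOn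
    hψ₂.toIsLegendrianImmersionOn hγ
  hminimal x hx := by
    obtain ⟨hs, T, hT, hr⟩ := exists_isReducedCurve_of_mem_regularSet
      hψ₁.toIsLegendrianImmersionOn hψ₂.toIsLegendrianImmersionOn hγ hx
    have hc : IsConeCurve (Module.finrank ℝ (EuclideanSpace ℝ (Fin n₁)))
        (Module.finrank ℝ (EuclideanSpace ℝ (Fin n₂))) μ γ₁ γ₂ (conjInv n₁ γ₁) (conjInv n₂ γ₂)
        T := by
      rw [finrank_euclideanSpace_fin, finrank_euclideanSpace_fin]
      exact hr.isConeCurve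
    exact tangentialDivergence_cone
      (p := (x.1, x.2.1, extChartAt (𝓡 n₁) x.2.2.1 x.2.2.1, extChartAt (𝓡 n₂) x.2.2.2 x.2.2.2)) hc
      (hψ₁.toIsLegendrianImmersionOn.isLocalLegendrian x.2.2.1)
      (hψ₂.toIsLegendrianImmersionOn.isLocalLegendrian x.2.2.2)
      ⟨hs, hT, mem_extChartAt_target x.2.2.1, mem_extChartAt_target x.2.2.2⟩
      (hψ₁.cminimal _ (Set.mem_univ _)) (hψ₂.cminimal _ (Set.mem_univ _))

end ConeOverCurve

section ComplexVolume

variable {κ : Type*} [Fintype κ] [DecidableEq κ]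

/-- The complex volume form `dz_1 ∧ ⋯ ∧ dz_n` as an alternating map. -/
def volumeForm (κ : Type*) [Fintype κ] [DecidableEq κ] : CSpace κ [⋀^κ]→ₗ[ℂ] ℂ :=
  Matrix.detRowAlternating.compLinearMap (WithLp.linearEquiv 2 ℂ (κ → ℂ)).toLinearMap

theorem complexVolume_eq_volumeForm (v : κ → CSpace κ) : complexVolume v = volumeForm κ v :=
  Matrix.det_transpose _

theorem det_inner_eq (w v : κ → CSpace κ) :
    (Matrix.of fun i j => inner ℂ (w i) (v j)).det =
      (starRingEnd ℂ) (complexVolume w) * complexVolume v := by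
  have h : (Matrix.of fun i j => inner ℂ (w i) (v j)) =
      (Matrix.of fun k j => w j k).conjTranspose * Matrix.of fun k j => v j k := by
    ext i j
    simp [Matrix.mul_apply, PiLp.inner_apply, mul_comm]
  rw [h, Matrix.det_mul, Matrix.det_conjTranspose]
  rfl

theorem norm_complexVolume_eq_one {v : κ → CSpace κ}
    (h : ∀ i j, inner ℂ (v i) (v j) = if i = j then 1 else 0) : ‖complexVolume v‖ = 1 := by
  have hd := det_inner_eq v v
  have h1 : (Matrix.of fun i j => inner ℂ (v i) (v j)) = 1 := by
    ext i j
    simp [h, Matrix.one_apply]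
  rw [h1, Matrix.det_one, Complex.conj_mul'] at hd
  exact (pow_eq_one_iff_of_nonneg (norm_nonneg _) two_ne_zero).1 (by exact_mod_cast hd.symm)

theorem complexVolume_ne_zero {v : κ → CSpace κ} (hv : LinearIndependent ℝ v)
    (hreal : ∀ i j, (inner ℂ (v i) (v j)).im = 0) : complexVolume v ≠ 0 := by
  have hd := det_inner_eq v v
  have h1 : (Matrix.of fun i j => inner ℂ (v i) (v j)) =
      Complex.ofRealHom.mapMatrix (Matrix.gram ℝ v) := by
    ext i j
    exact Complex.ext (by simp [Matrix.gram, inner_real_eq_re]) (by simp [Matrix.gram, hreal])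
  intro h0
  rw [h1, ← RingHom.map_det, h0, mul_zero, map_eq_zero] at hd
  exact (Matrix.posDef_gram_iff_linearIndependent.2 hv).det_pos.ne' hd

theorem map_update_update {R M P ι : Type*} [CommRing R] [AddCommGroup M] [Module R M]
    [AddCommGroup P] [Module R P] [DecidableEq ι] (g : M [⋀^ι]→ₗ[R] P) (w : ι → M) {i j : ι}
    (hij : i ≠ j) (a b c d : R) :
    g (Function.update (Function.update w i (a • w i + b • w j)) j (c • w i + d • w j)) =
      (a * d - b * c) • g w := by
  have hji : Function.update (Function.update w i (w j)) j (w i) = w ∘ Equiv.swap i j := by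
    ext k
    rcases eq_or_ne k j with rfl | hk
    · simp
    · rcases eq_or_ne k i with rfl | hk'
      · simp [hij]
      · simp [hk, hk', Equiv.swap_apply_of_ne_of_ne]
  have h1 : g (Function.update (Function.update w i (w i)) j (w i)) = 0 :=
    g.map_eq_zero_of_eq _ (by simp [hij]) hij
  have h2 : g (Function.update (Function.update w i (w j)) j (w j)) = 0 :=
    g.map_eq_zero_of_eq _ (by simp [hij]) hij
  have h3 : g (Function.update (Function.update w i (w j)) j (w i)) = - g w := by
    rw [hji, g.map_swap w hij]
  have h4 : g (Function.update (Function.update w i (w i)) j (w j)) = g w := by simp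
  rw [g.map_update_add, g.map_update_smul, g.map_update_smul, Function.update_comm hij,
    Function.update_comm hij, g.map_update_add, g.map_update_smul, g.map_update_smul,
    g.map_update_add, g.map_update_smul, g.map_update_smul, Function.update_comm hij.symm,
    Function.update_comm hij.symm, Function.update_comm hij.symm, Function.update_comm hij.symm,
    h1, h2, h3, h4]
  module

/-- The phase of the square of a complex number. -/
def phaseSq (z : ℂ) : ℂ := z / (starRingEnd ℂ) z

theorem phaseSq_mul (z w : ℂ) : phaseSq (z * w) = phaseSq z * phaseSq w := by
  simp [phaseSq, mul_div_mul_comm]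

theorem phaseSq_of_norm_eq_one {z : ℂ} (hz : ‖z‖ = 1) : phaseSq z = z ^ 2 := by
  have h := Complex.mul_conj' z
  rw [hz] at h
  have h0 : z ≠ 0 := by
    rintro rfl
    simp at hz
  rw [phaseSq, div_eq_iff ((map_ne_zero _).2 h0), pow_two, mul_assoc, h]
  simp

theorem phaseSq_ofReal {r : ℝ} (hr : r ≠ 0) : phaseSq r = 1 := by
  rw [phaseSq, Complex.conj_ofReal, div_self (by exact_mod_cast hr)]

theorem phaseSq_conj_mul_self {z : ℂ} (hz : z ≠ 0) :
    phaseSq ((starRingEnd ℂ) z) * phaseSq z = 1 := by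
  have := (map_ne_zero (starRingEnd ℂ)).2 hz
  rw [phaseSq, phaseSq, Complex.conj_conj]
  field_simp

theorem norm_phaseSq {z : ℂ} (hz : z ≠ 0) : ‖phaseSq z‖ = 1 := by
  rw [phaseSq, norm_div, RCLike.norm_conj, div_self (norm_ne_zero_iff.2 hz)]

theorem phaseSq_complexVolume_congr {v w : κ → CSpace κ} (hv : complexVolume v ≠ 0)
    (hw : complexVolume w ≠ 0) (hreal : ∀ i j, (inner ℂ (w i) (v j)).im = 0) :
    phaseSq (complexVolume v) = phaseSq (complexVolume w) := by
  have hd := det_inner_eq w v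
  have h1 : (Matrix.of fun i j => inner ℂ (w i) (v j)) =
      Complex.ofRealHom.mapMatrix (Matrix.of fun i j => inner ℝ (w i) (v j)) := by
    ext i j
    exact Complex.ext (by simp [inner_real_eq_re]) (by simp [hreal])
  rw [h1, ← RingHom.map_det] at hd
  have hne : (Matrix.of fun i j => inner ℝ (w i) (v j)).det ≠ 0 := by
    intro h0
    rw [h0, map_zero] at hd
    exact mul_ne_zero ((map_ne_zero _).2 hw) hv hd.symm
  have h2 := congrArg phaseSq hd
  rw [phaseSq_mul] at h2
  have h3 := phaseSq_conj_mul_self hw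
  have h4 := (h2.symm.trans (phaseSq_ofReal hne)).trans h3.symm
  exact mul_left_cancel₀ (left_ne_zero_of_mul_eq_one h3) h4

variable {X : Type*} [NormedAddCommGroup X] [NormedSpace ℝ X]

theorem hasFDerivAt_det_of_eq_one {A : X → Matrix κ κ ℂ} {A' : κ → κ → X →L[ℝ] ℂ} {x : X}
    (hA : ∀ i j, HasFDerivAt (fun x => A x i j) (A' i j) x) (h1 : A x = 1) :
    HasFDerivAt (fun x => (A x).det) (∑ i, A' i i) x := by
  have hσ : ∀ σ : Equiv.Perm κ, HasFDerivAt
      (fun x => Equiv.Perm.sign σ • ∏ i, A x (σ i) i)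
      (if σ = 1 then ∑ i, A' i i else 0) x := by
    intro σ
    have hp := (HasFDerivAt.finsetProd (u := Finset.univ)
      fun i _ => hA (σ i) i).const_smul (Equiv.Perm.sign σ)
    refine hp.congr_fderiv ?_
    split_ifs with hs
    · subst hs
      rw [Equiv.Perm.sign_one, one_smul]
      refine Finset.sum_congr rfl fun i _ => ?_
      rw [Finset.prod_eq_one fun j _ => by simp [h1], one_smul, Equiv.Perm.one_apply]
    · rw [Finset.sum_eq_zero, smul_zero]
      intro i _
      have : ∃ j, j ≠ i ∧ σ j ≠ j := by
        by_contra! hcon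
        refine hs (Equiv.ext fun j => ?_)
        rcases eq_or_ne j i with rfl | hj
        · by_contra hne
          exact hne (σ.injective (hcon _ hne))
        · exact hcon j hj
      obtain ⟨j, hj, hj'⟩ := this
      have h0 : ∏ j ∈ Finset.univ.erase i, A x (σ j) j = 0 :=
        Finset.prod_eq_zero (Finset.mem_erase.2 ⟨hj, Finset.mem_univ j⟩) (by simp [h1, hj'])
      rw [h0]
      exact zero_smul ℂ (A' (σ i) i)
  simp only [Matrix.det_apply]
  refine (HasFDerivAt.fun_sum fun σ _ => hσ σ).congr_fderiv ?_
  simp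

theorem hasFDerivAt_phaseSq {g : X → ℂ} {g' : X →L[ℝ] ℂ} {x : X} (hg : HasFDerivAt g g' x)
    (h1 : g x = 1) (him : ∀ v, (g' v).im = 0) :
    HasFDerivAt (fun x => phaseSq (g x)) (0 : X →L[ℝ] ℂ) x := by
  have hc : HasFDerivAt (fun x => (starRingEnd ℂ) (g x))
      ((Complex.conjCLE : ℂ →L[ℝ] ℂ).comp g') x := Complex.conjCLE.hasFDerivAt.comp x hg
  have hc1 : (starRingEnd ℂ) (g x) ≠ 0 := by simp [h1]
  have hi := hg.mul ((hasFDerivAt_inv' (𝕜 := ℝ) hc1).comp x hc)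
  refine hi.congr_fderiv ?_
  ext v
  have : (starRingEnd ℂ) (g' v) = g' v := Complex.conj_eq_iff_im.2 (him v)
  simp [h1, this]

end ComplexVolume

section LegendrianPhase

set_option linter.unusedSectionVars false

variable {n : ℕ} {E : Type*} [NormedAddCommGroup E] [NormedSpace ℝ E]
  {E' : Type*} [NormedAddCommGroup E'] [NormedSpace ℝ E']

/-- The frame `(x, L b_1, …, L b_n)` of `ℂ^(n+1)` that consists of the position vector and the
tangent vectors of an immersed manifold of dimension `n`. -/
def positionFrame (x : CSpace (Fin (n + 1))) (L : E →L[ℝ] CSpace (Fin (n + 1)))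
    (b : Module.Basis (Fin n) ℝ E) : Fin (n + 1) → CSpace (Fin (n + 1)) :=
  Fin.cons x fun a => L (b a)

@[simp] theorem positionFrame_zero (x : CSpace (Fin (n + 1))) (L : E →L[ℝ] CSpace (Fin (n + 1)))
    (b : Module.Basis (Fin n) ℝ E) : positionFrame x L b 0 = x := rfl

@[simp] theorem positionFrame_succ (x : CSpace (Fin (n + 1))) (L : E →L[ℝ] CSpace (Fin (n + 1)))
    (b : Module.Basis (Fin n) ℝ E) (a : Fin n) : positionFrame x L b a.succ = L (b a) := rfl

theorem IsLegendrianJet.inner_positionFrame_im {x : CSpace (Fin (n + 1))}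
    {L : E →L[ℝ] CSpace (Fin (n + 1))} {L' : E' →L[ℝ] CSpace (Fin (n + 1))}
    (h : IsLegendrianJet x L) (h' : IsLegendrianJet x L') (b : Module.Basis (Fin n) ℝ E)
    (b' : Module.Basis (Fin n) ℝ E') (hreal : ∀ u v, (inner ℂ (L u) (L' v)).im = 0)
    (i j : Fin (n + 1)) : (inner ℂ (positionFrame x L b i) (positionFrame x L' b' j)).im = 0 := by
  refine Fin.cases ?_ (fun a => ?_) i <;> refine Fin.cases ?_ (fun c => ?_) j
  · rw [positionFrame_zero, positionFrame_zero, h.inner_self, Complex.one_im]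
  · simp [h'.inner_right]
  · simp [h.inner_left]
  · exact hreal _ _

theorem IsLegendrianJet.complexVolume_positionFrame_ne_zero {x : CSpace (Fin (n + 1))}
    {L : E →L[ℝ] CSpace (Fin (n + 1))} (h : IsLegendrianJet x L)
    (b : Module.Basis (Fin n) ℝ E) : complexVolume (positionFrame x L b) ≠ 0 := by
  refine complexVolume_ne_zero (LinearIndependent.finCons ?_ ?_)
    (h.inner_positionFrame_im h b b fun u v => by rw [h.inner_real, Complex.ofReal_im])
  · exact b.linearIndependent.map' (L : E →ₗ[ℝ] CSpace (Fin (n + 1)))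
      (LinearMap.ker_eq_bot.2 h.injective)
  · intro hx
    have hle : Submodule.span ℝ (Set.range fun a => L (b a)) ≤
        LinearMap.range (L : E →ₗ[ℝ] CSpace (Fin (n + 1))) :=
      Submodule.span_le.2 (by rintro _ ⟨a, rfl⟩; exact ⟨b a, rfl⟩)
    obtain ⟨u, hu⟩ := hle hx
    have h1 := h.inner_left u
    rw [show L u = x from hu, h.inner_self] at h1
    exact one_ne_zero h1

theorem IsLegendrianJet.phaseSq_congr {x : CSpace (Fin (n + 1))}
    {L : E →L[ℝ] CSpace (Fin (n + 1))} {L' : E' →L[ℝ] CSpace (Fin (n + 1))}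
    (h : IsLegendrianJet x L) (h' : IsLegendrianJet x L') (b : Module.Basis (Fin n) ℝ E)
    (b' : Module.Basis (Fin n) ℝ E') (hreal : ∀ u v, (inner ℂ (L u) (L' v)).im = 0) :
    phaseSq (complexVolume (positionFrame x L' b')) =
      phaseSq (complexVolume (positionFrame x L b)) :=
  phaseSq_complexVolume_congr (h'.complexVolume_positionFrame_ne_zero b')
    (h.complexVolume_positionFrame_ne_zero b) (h.inner_positionFrame_im h' b b' hreal)

variable [FiniteDimensional ℝ E]

theorem IsLocalLegendrian.inner_hessianTrace_fderiv_im {ι : Type*} [Fintype ι] {f : E → CSpace ι}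
    {U : Set E} {y : E} (h : IsLocalLegendrian f U) (hy : y ∈ U) (hτ : sphericalTrace f y = 0)
    (v : E) : (inner ℂ (hessianTrace f y) (fderiv ℝ f y v)).im = 0 := by
  have h1 := h.sphericalTrace_eq hy
  rw [hτ, eq_comm, sub_eq_zero, ← eq_sub_iff_add_eq] at h1
  rw [h1, inner_sub_left, RCLike.real_smul_eq_coe_smul (K := ℂ), inner_smul_left,
    h.inner_self_fderiv hy, h.inner_fderiv_fderiv hy]
  simp

theorem IsLocalLegendrian.hasFDerivAt_phaseSq {f : E → CSpace (Fin (n + 1))}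
    {U : Set E} {y : E} (h : IsLocalLegendrian f U) (hy : y ∈ U) (hτ : sphericalTrace f y = 0)
    (b : Module.Basis (Fin n) ℝ E) :
    HasFDerivAt (fun z => phaseSq (complexVolume (positionFrame (f z) (fderiv ℝ f z) b)))
      (0 : E →L[ℝ] ℂ) y := by
  obtain ⟨b₁, hb₁⟩ := exists_orthonormal_frame _ (h.immersion y hy)
  have hn : Module.finrank ℝ E = n := by simp [Module.finrank_eq_card_basis b]
  subst hn
  set w := positionFrame (f y) (fderiv ℝ f y) b₁ with hw
  have hjet := h.jet hy
  have hunit : ∀ i j, inner ℂ (w i) (w j) = if i = j then 1 else 0 := by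
    intro i j
    refine Fin.cases ?_ (fun a => ?_) i <;> refine Fin.cases ?_ (fun c => ?_) j
    · rw [hw, positionFrame_zero, hjet.inner_self, if_pos rfl]
    · simp [hw, hjet.inner_right, (Fin.succ_ne_zero c).symm]
    · simp [hw, hjet.inner_left]
    · rw [hw, positionFrame_succ, positionFrame_succ, hjet.inner_real,
        orthonormal_iff_ite.1 hb₁ a c]
      split_ifs <;> simp_all
  have hA : ∀ i j, HasFDerivAt
      (fun z => inner ℂ (w i) (positionFrame (f z) (fderiv ℝ f z) b₁ j))
      (((innerSL ℂ (w i)).restrictScalars ℝ).comp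
        (Fin.cases (motive := fun _ => E →L[ℝ] CSpace (Fin (Module.finrank ℝ E + 1)))
          (fderiv ℝ f y) (fun a => (fderiv ℝ (fderiv ℝ f) y).flip (b₁ a)) j)) y := by
    intro i j
    refine Fin.cases ?_ (fun a => ?_) j
    · exact ((innerSL ℂ (w i)).restrictScalars ℝ).hasFDerivAt.comp y (h.hasFDerivAt hy)
    · exact ((innerSL ℂ (w i)).restrictScalars ℝ).hasFDerivAt.comp y (h.hasFDerivAt_fderiv hy (b₁ a))
  have hd := hasFDerivAt_det_of_eq_one
    (A := fun z => Matrix.of fun i j => inner ℂ (w i) (positionFrame (f z) (fderiv ℝ f z) b₁ j))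
    hA (by ext i j; exact (hunit i j).trans (by rw [Matrix.one_apply]))
  have hp := LagCone.hasFDerivAt_phaseSq hd
    (by rw [show (Matrix.of fun i j => inner ℂ (w i) (positionFrame (f y) (fderiv ℝ f y) b₁ j)) = 1
          from by ext i j; exact (hunit i j).trans (by rw [Matrix.one_apply])]; exact Matrix.det_one)
    (fun v => by
      have h1 := h.inner_hessianTrace_fderiv_im hy hτ v
      rw [hessianTrace, frameTrace_eq_sum _ _ b₁ hb₁, sum_inner, Complex.im_sum] at h1
      rw [sum_apply, Fin.sum_univ_succ, Complex.add_im, Complex.im_sum]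
      have h2 : (inner ℂ (f y) (fderiv ℝ f y v)).im = 0 := by simp [hjet.inner_right]
      have h3 : ∀ a, (inner ℂ (fderiv ℝ f y (b₁ a)) (fderiv ℝ (fderiv ℝ f) y v (b₁ a))).im =
          -(inner ℂ (hessian f y (b₁ a) (b₁ a)) (fderiv ℝ f y v)).im := by
        intro a
        rw [hessian_apply, h.inner_hessian_fderiv_im hy, h.hessian_symm hy, ← inner_conj_symm,
          Complex.conj_im]
      refine (congrArg₂ (· + ·) h2 (Finset.sum_congr rfl fun a _ => h3 a)).trans ?_
      rw [Finset.sum_neg_distrib, h1]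
      simp)
  have hvol : complexVolume w ≠ 0 := hjet.complexVolume_positionFrame_ne_zero b₁
  have hp' := hp.const_mul (phaseSq (complexVolume w))
  refine (hp'.congr_fderiv (ContinuousLinearMap.ext fun _ => mul_zero _)).congr_of_eventuallyEq ?_
  filter_upwards [h.isOpen.mem_nhds hy] with z hz
  rw [(h.jet hz).phaseSq_congr (h.jet hz) b₁ b
    (fun u v => by rw [(h.jet hz).inner_real, Complex.ofReal_im]), det_inner_eq, phaseSq_mul,
    ← mul_assoc, mul_comm (phaseSq _) (phaseSq _), phaseSq_conj_mul_self hvol, one_mul]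

end LegendrianPhase

section ManifoldPhase

variable {n : ℕ} {M : Type*} [TopologicalSpace M] [ChartedSpace (EuclideanSpace ℝ (Fin n)) M]

/-- The squared phase of the complex volume of the frames `(f x, f_* b_1, …, f_* b_n)`, that is,
`exp(2iβ)` for the Legendrian angle `β` of `f`. -/
def legendrianPhase (f : M → CSpace (Fin (n + 1))) (x : M) : ℂ :=
  phaseSq (complexVolume (positionFrame (f x)
    (fderiv ℝ (coordRep (𝓡 n) f x) (extChartAt (𝓡 n) x x)) (PiLp.basisFun 2 ℝ (Fin n))))

variable [IsManifold (𝓡 n) ∞ M] {f : M → CSpace (Fin (n + 1))}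

theorem IsLegendrianImmersionOn.norm_legendrianPhase
    (h : IsLegendrianImmersionOn (𝓡 n) f Set.univ) (x : M) : ‖legendrianPhase f x‖ = 1 :=
  norm_phaseSq ((h.jet x).complexVolume_positionFrame_ne_zero _)

theorem IsLegendrianImmersionOn.legendrianPhase_symm
    (h : IsLegendrianImmersionOn (𝓡 n) f Set.univ) (x : M) {y : EuclideanSpace ℝ (Fin n)}
    (hy : y ∈ (extChartAt (𝓡 n) x).target) :
    legendrianPhase f ((extChartAt (𝓡 n) x).symm y) =
      phaseSq (complexVolume (positionFrame (coordRep (𝓡 n) f x y)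
        (fderiv ℝ (coordRep (𝓡 n) f x) y) (PiLp.basisFun 2 ℝ (Fin n)))) := by
  obtain ⟨A, -, hA⟩ := exists_fderiv_coordRep (contMDiffOn_univ.1 h.smooth) x hy
  refine ((h.isLocalLegendrian x).jet hy).phaseSq_congr (h.jet _) _ _ fun u v => ?_
  have hA' := (hA u).trans (congrFun (push_eq_fderiv
    ((contMDiffOn_univ.1 h.smooth).mdifferentiableAt (by simp))) (A u))
  refine (congrArg (fun z => (inner ℂ z _).im) hA').trans ?_
  exact (congrArg Complex.im ((h.jet _).inner_real (A u) v)).trans (Complex.ofReal_im _)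

theorem IsMinimalLegendrianOn.hasMFDerivAt_legendrianPhase
    (h : IsMinimalLegendrianOn (𝓡 n) f Set.univ) (x : M) :
    HasMFDerivAt (𝓡 n) 𝓘(ℝ, ℂ) (legendrianPhase f) x (0 : EuclideanSpace ℝ (Fin n) →L[ℝ] ℂ) := by
  have hl := h.toIsLegendrianImmersionOn
  have hτ : sphericalTrace (coordRep (𝓡 n) f x) (extChartAt (𝓡 n) x x) = 0 := by
    rw [sphericalTrace_eq_smul, h.minimal x (Set.mem_univ _), smul_zero]
  have hd := (hl.isLocalLegendrian x).hasFDerivAt_phaseSq (mem_extChartAt_target x) hτ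
    (PiLp.basisFun 2 ℝ (Fin n))
  have hsymm : HasFDerivAt (legendrianPhase f ∘ (extChartAt (𝓡 n) x).symm)
      (0 : EuclideanSpace ℝ (Fin n) →L[ℝ] ℂ) (extChartAt (𝓡 n) x x) := by
    refine hd.congr_of_eventuallyEq ?_
    filter_upwards [(isOpen_extChartAt_target x).mem_nhds (mem_extChartAt_target x)] with y hy
    exact hl.legendrianPhase_symm x hy
  refine ⟨?_, hsymm.hasFDerivWithinAt⟩
  refine (hsymm.continuousAt.comp (continuousAt_extChartAt x)).congr ?_
  filter_upwards [extChartAt_source_mem_nhds (I := 𝓡 n) x] with z hz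
  exact congrArg (legendrianPhase f) ((extChartAt (𝓡 n) x).left_inv hz)

theorem IsMinimalLegendrianOn.legendrianPhase_eq [PreconnectedSpace M]
    (h : IsMinimalLegendrianOn (𝓡 n) f Set.univ) (x x' : M) :
    legendrianPhase f x = legendrianPhase f x' := by
  refine IsLocallyConstant.apply_eq_of_preconnectedSpace
    ((IsLocallyConstant.iff_eventually_eq _).2 fun x => ?_) x x'
  have hd : ∀ y ∈ (extChartAt (𝓡 n) x).target,
      HasFDerivAt (legendrianPhase f ∘ (extChartAt (𝓡 n) x).symm)
        (0 : EuclideanSpace ℝ (Fin n) →L[ℝ] ℂ) y := by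
    intro y hy
    have hsymm : MDifferentiableAt 𝓘(ℝ, EuclideanSpace ℝ (Fin n)) (𝓡 n)
        (extChartAt (𝓡 n) x).symm y :=
      ((contMDiffOn_extChartAt_symm (n := ∞) x).contMDiffAt
        ((isOpen_extChartAt_target x).mem_nhds hy)).mdifferentiableAt (by simp)
    have hc := (h.hasMFDerivAt_legendrianPhase _).comp y hsymm.hasMFDerivAt
    exact hc.hasFDerivAt.congr_fderiv (ContinuousLinearMap.zero_comp _)
  have ho := (isOpen_extChartAt_target (I := 𝓡 n) x).isOpen_inter_preimage_of_fderiv_eq_zero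
    (fun y hy => (hd y hy).differentiableAt.differentiableWithinAt) (fun y hy => (hd y hy).fderiv)
    {legendrianPhase f x}
  have hmem := (continuousAt_extChartAt (I := 𝓡 n) x).preimage_mem_nhds (ho.mem_nhds
    ⟨mem_extChartAt_target x, congrArg (legendrianPhase f) (extChartAt_to_inv x)⟩)
  filter_upwards [hmem, extChartAt_source_mem_nhds (I := 𝓡 n) x] with z hz hz'
  exact (congrArg (legendrianPhase f) ((extChartAt (𝓡 n) x).left_inv hz').symm).trans hz.2

end ManifoldPhase

section ConeVolume

variable {n₁ n₂ : ℕ} {E₁ : Type*} [NormedAddCommGroup E₁] [NormedSpace ℝ E₁]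
  {E₂ : Type*} [NormedAddCommGroup E₂] [NormedSpace ℝ E₂]

/-- The basis of `ℝ × ℝ × E₁ × E₂` that consists of the two coordinate vectors and of bases of `E₁`
and `E₂`. -/
def coneFrame (b₁ : Module.Basis (Fin n₁) ℝ E₁) (b₂ : Module.Basis (Fin n₂) ℝ E₂) :
    Fin (n₁ + 1) ⊕ Fin (n₂ + 1) → ℝ × ℝ × E₁ × E₂ :=
  Sum.elim (Fin.cons (1, 0, 0, 0) fun a => (0, 0, b₁ a, 0))
    (Fin.cons (0, 1, 0, 0) fun c => (0, 0, 0, b₂ c))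

theorem complexVolume_sumElim_pair (v : Fin (n₁ + 1) → CSpace (Fin (n₁ + 1)))
    (w : Fin (n₂ + 1) → CSpace (Fin (n₂ + 1))) :
    complexVolume (Sum.elim (fun i => pair (v i) 0) (fun j => pair 0 (w j))) =
      complexVolume v * complexVolume w := by
  refine Eq.trans ?_ (Matrix.det_fromBlocks_zero₂₁ _ 0 _)
  refine congrArg Matrix.det ?_
  ext (i | i) (j | j) <;> simp

theorem complexVolume_warpedDeriv (s : ℝ) (g₁ g₁' g₂ g₂' : ℂ) (x₁ : CSpace (Fin (n₁ + 1)))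
    (x₂ : CSpace (Fin (n₂ + 1))) (L₁ : E₁ →L[ℝ] CSpace (Fin (n₁ + 1)))
    (L₂ : E₂ →L[ℝ] CSpace (Fin (n₂ + 1))) (b₁ : Module.Basis (Fin n₁) ℝ E₁)
    (b₂ : Module.Basis (Fin n₂) ℝ E₂) :
    complexVolume (fun k => warpedDeriv s 1 g₁ g₁' g₂ g₂' x₁ x₂ L₁ L₂ (coneFrame b₁ b₂ k)) =
      s * (g₁ * g₂' - g₂ * g₁') * (s * g₁) ^ n₁ * (s * g₂) ^ n₂ *
        (complexVolume (positionFrame x₁ L₁ b₁) * complexVolume (positionFrame x₂ L₂ b₂)) := by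
  set V : Fin (n₁ + 1) ⊕ Fin (n₂ + 1) → CSpace (Fin (n₁ + 1) ⊕ Fin (n₂ + 1)) :=
    Sum.elim (fun i => pair (positionFrame x₁ L₁ b₁ i) 0)
      (fun j => pair 0 (positionFrame x₂ L₂ b₂ j)) with hV
  set c : Fin (n₁ + 1) ⊕ Fin (n₂ + 1) → ℂ :=
    Sum.elim (Fin.cons 1 fun _ => s * g₁) (Fin.cons 1 fun _ => s * g₂) with hc
  set W := fun k => c k • V k with hW
  have hu : (fun k => warpedDeriv s 1 g₁ g₁' g₂ g₂' x₁ x₂ L₁ L₂ (coneFrame b₁ b₂ k)) =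
      Function.update (Function.update W (Sum.inl 0)
        (g₁ • W (Sum.inl 0) + g₂ • W (Sum.inr 0))) (Sum.inr 0)
        ((s * g₁') • W (Sum.inl 0) + (s * g₂') • W (Sum.inr 0)) := by
    funext k
    rcases k with k | k <;> refine Fin.cases ?_ (fun a => ?_) k
    · refine pair_ext (fun k => ?_) (fun k => ?_) <;>
        simp [warpedDeriv_apply, coneFrame, hW, hV, hc]
    · refine pair_ext (fun k => ?_) (fun k => ?_) <;>
        simp [warpedDeriv_apply, coneFrame, hW, hV, hc]
    · refine pair_ext (fun k => ?_) (fun k => ?_) <;>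
        simp [warpedDeriv_apply, coneFrame, hW, hV, hc]
    · refine pair_ext (fun k => ?_) (fun k => ?_) <;>
        simp [warpedDeriv_apply, coneFrame, hW, hV, hc]
  rw [hu, complexVolume_eq_volumeForm, map_update_update _ _ (by simp), hW,
    AlternatingMap.map_smul_univ, ← complexVolume_eq_volumeForm, hV, complexVolume_sumElim_pair]
  simp only [hc, Fintype.prod_sum_type, Sum.elim_inl, Sum.elim_inr, Fin.prod_univ_succ,
    Fin.cons_zero, Fin.cons_succ, Finset.prod_const, Finset.card_univ, Fintype.card_fin,
    smul_eq_mul]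
  ring

theorem phaseSq_complexVolume_warpedDeriv {a b : ℝ → ℂ} {μ : ℝ} {e : ℝ → ℂ} {T : Set ℝ} {s t : ℝ}
    (hr : IsReducedCurve n₁ n₂ μ e a b T) (ht : t ∈ T) (he : e t = Complex.I) (hs : s ≠ 0)
    {x₁ : CSpace (Fin (n₁ + 1))} {x₂ : CSpace (Fin (n₂ + 1))}
    {L₁ : E₁ →L[ℝ] CSpace (Fin (n₁ + 1))} {L₂ : E₂ →L[ℝ] CSpace (Fin (n₂ + 1))}
    (h₁ : IsLegendrianJet x₁ L₁) (h₂ : IsLegendrianJet x₂ L₂)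
    (b₁ : Module.Basis (Fin n₁) ℝ E₁) (b₂ : Module.Basis (Fin n₂) ℝ E₂) :
    complexVolume (fun k => warpedDeriv s 1 (a t) (deriv a t) (b t) (deriv b t) x₁ x₂ L₁ L₂
        (coneFrame b₁ b₂ k)) ≠ 0 ∧
      phaseSq (complexVolume (fun k => warpedDeriv s 1 (a t) (deriv a t) (b t) (deriv b t)
        x₁ x₂ L₁ L₂ (coneFrame b₁ b₂ k))) =
      -(phaseSq (complexVolume (positionFrame x₁ L₁ b₁)) *
        phaseSq (complexVolume (positionFrame x₂ L₂ b₂))) := by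
  set r : ℝ := s ^ (n₁ + n₂ + 1) * (‖a t‖ ^ 2) ^ n₁ * (‖b t‖ ^ 2) ^ n₂ with hrdef
  have hne : r ≠ 0 := by
    have k₁ : (‖a t‖ ^ 2) ^ n₁ ≠ 0 := by
      rcases hr.ne_zero₁ t ht with h | h
      · simp [h]
      · exact pow_ne_zero _ (pow_ne_zero _ (norm_ne_zero_iff.2 h))
    have k₂ : (‖b t‖ ^ 2) ^ n₂ ≠ 0 := by
      rcases hr.ne_zero₂ t ht with h | h
      · simp [h]
      · exact pow_ne_zero _ (pow_ne_zero _ (norm_ne_zero_iff.2 h))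
    exact mul_ne_zero (mul_ne_zero (pow_ne_zero _ hs) k₁) k₂
  have hvol : complexVolume (fun k => warpedDeriv s 1 (a t) (deriv a t) (b t) (deriv b t)
      x₁ x₂ L₁ L₂ (coneFrame b₁ b₂ k)) = r * -Complex.I *
        (complexVolume (positionFrame x₁ L₁ b₁) * complexVolume (positionFrame x₂ L₂ b₂)) := by
    have hra : (r : ℂ) = s ^ (n₁ + n₂ + 1) * (a t * (starRingEnd ℂ) (a t)) ^ n₁ *
        (b t * (starRingEnd ℂ) (b t)) ^ n₂ := by
      rw [Complex.mul_conj', Complex.mul_conj', hrdef]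
      push_cast
      ring
    rw [complexVolume_warpedDeriv, hra, hr.deriv₁ t ht, hr.deriv₂ t ht, he]
    linear_combination (-Complex.I * s ^ (n₁ + n₂ + 1) * (a t * (starRingEnd ℂ) (a t)) ^ n₁ *
        (b t * (starRingEnd ℂ) (b t)) ^ n₂ * (complexVolume (positionFrame x₁ L₁ b₁) *
          complexVolume (positionFrame x₂ L₂ b₂))) * hr.norm_mul_conj ht
  have hI : phaseSq (-Complex.I) = -1 := by
    rw [phaseSq_of_norm_eq_one (by simp)]
    simp
  rw [hvol]
  constructor
  · exact mul_ne_zero (mul_ne_zero (by exact_mod_cast hne) (neg_ne_zero.2 Complex.I_ne_zero))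
      (mul_ne_zero (h₁.complexVolume_positionFrame_ne_zero b₁)
        (h₂.complexVolume_positionFrame_ne_zero b₂))
  · rw [phaseSq_mul, phaseSq_mul, phaseSq_mul, phaseSq_ofReal hne, hI]
    ring

theorem complexVolume_sq_of_orthonormal {a b : ℝ → ℂ} {μ : ℝ} {e : ℝ → ℂ} {T : Set ℝ} {s t : ℝ}
    (hr : IsReducedCurve n₁ n₂ μ e a b T) (ht : t ∈ T) (he : e t = Complex.I) (hs : s ≠ 0)
    (hj : IsCurveJet (a t) (deriv a t) (b t) (deriv b t))
    {x₁ : CSpace (Fin (n₁ + 1))} {x₂ : CSpace (Fin (n₂ + 1))}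
    {L₁ : E₁ →L[ℝ] CSpace (Fin (n₁ + 1))} {L₂ : E₂ →L[ℝ] CSpace (Fin (n₂ + 1))}
    (h₁ : IsLegendrianJet x₁ L₁) (h₂ : IsLegendrianJet x₂ L₂)
    (b₁ : Module.Basis (Fin n₁) ℝ E₁) (b₂ : Module.Basis (Fin n₂) ℝ E₂)
    {f : Fin (n₁ + 1) ⊕ Fin (n₂ + 1) → ℝ × ℝ × E₁ × E₂}
    (hf : Orthonormal ℝ fun k => warpedDeriv s 1 (a t) (deriv a t) (b t) (deriv b t)
      x₁ x₂ L₁ L₂ (f k)) :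
    complexVolume (fun k => warpedDeriv s 1 (a t) (deriv a t) (b t) (deriv b t)
      x₁ x₂ L₁ L₂ (f k)) ^ 2 =
      -(phaseSq (complexVolume (positionFrame x₁ L₁ b₁)) *
        phaseSq (complexVolume (positionFrame x₂ L₂ b₂))) := by
  have him : ∀ u v, (inner ℂ (warpedDeriv s 1 (a t) (deriv a t) (b t) (deriv b t) x₁ x₂ L₁ L₂ u)
      (warpedDeriv s 1 (a t) (deriv a t) (b t) (deriv b t) x₁ x₂ L₁ L₂ v)).im = 0 := fun u v => by
    rw [inner_warpedDeriv hj h₁ h₂, Complex.ofReal_im]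
  have hn := norm_complexVolume_eq_one (v := fun k => warpedDeriv s 1 (a t) (deriv a t) (b t)
    (deriv b t) x₁ x₂ L₁ L₂ (f k)) fun i j => by
      refine Complex.ext ?_ ((him _ _).trans (by split_ifs <;> rfl))
      rw [← inner_real_eq_re, orthonormal_iff_ite.1 hf i j]
      split_ifs <;> rfl
  obtain ⟨hne, hp⟩ := phaseSq_complexVolume_warpedDeriv hr ht he hs h₁ h₂ b₁ b₂
  rw [← hp, ← phaseSq_of_norm_eq_one hn]
  refine phaseSq_complexVolume_congr (fun h0 => ?_) hne fun i j => him _ _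
  rw [h0, norm_zero] at hn
  exact zero_ne_one hn

end ConeVolume

section SpecialLagrangian

variable {n₁ n₂ : ℕ}
  {N₁ : Type*} [TopologicalSpace N₁] [ChartedSpace (EuclideanSpace ℝ (Fin n₁)) N₁]
  [IsManifold (𝓡 n₁) ∞ N₁]
  {N₂ : Type*} [TopologicalSpace N₂] [ChartedSpace (EuclideanSpace ℝ (Fin n₂)) N₂]
  [IsManifold (𝓡 n₂) ∞ N₂]
  {ψ₁ : N₁ → CSpace (Fin (n₁ + 1))} {ψ₂ : N₂ → CSpace (Fin (n₂ + 1))}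
  {γ₁ γ₂ : ℝ → ℂ} {J : Set ℝ}

theorem complexVolume_push_coneMap_sq (hψ₁ : IsLegendrianImmersionOn (𝓡 n₁) ψ₁ Set.univ)
    (hψ₂ : IsLegendrianImmersionOn (𝓡 n₂) ψ₂ Set.univ)
    (hγ : IsGeneratingCurve n₁ n₂ 0 γ₁ γ₂ J) {x : ℝ × ℝ × N₁ × N₂}
    (hx : x ∈ regularSet γ₁ γ₂ ψ₁ ψ₂ J)
    {e : Fin (n₁ + 1) ⊕ Fin (n₂ + 1) → TangentSpace (coneModel n₁ n₂) x}
    (he : Orthonormal ℝ fun k => push (coneModel n₁ n₂) (coneMap γ₁ γ₂ ψ₁ ψ₂) x (e k)) :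
    complexVolume (fun k => push (coneModel n₁ n₂) (coneMap γ₁ γ₂ ψ₁ ψ₂) x (e k)) ^ 2 =
      -(legendrianPhase ψ₁ x.2.2.1 * legendrianPhase ψ₂ x.2.2.2) := by
  obtain ⟨hs, T, hT, hr⟩ := exists_isReducedCurve_of_mem_regularSet hψ₁ hψ₂ hγ hx
  have h := fun k => push_coneMap hψ₁ hψ₂ hγ.isOpen hγ.smooth₁ hγ.smooth₂ hx.1 (e k)
  rw [funext h] at he ⊢
  exact complexVolume_sq_of_orthonormal hr hT (by simp) hs (hγ.jet hx.1) (hψ₁.jet _) (hψ₂.jet _)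
    _ _ he

theorem isSpecialLagrangianOn_coneMap [PreconnectedSpace N₁] [PreconnectedSpace N₂]
    (hγ : IsGeneratingCurve n₁ n₂ 0 γ₁ γ₂ J) (hψ₁ : IsMinimalLegendrianOn (𝓡 n₁) ψ₁ Set.univ)
    (hψ₂ : IsMinimalLegendrianOn (𝓡 n₂) ψ₂ Set.univ) :
    IsSpecialLagrangianOn (coneModel n₁ n₂) (coneMap γ₁ γ₂ ψ₁ ψ₂)
      (regularSet γ₁ γ₂ ψ₁ ψ₂ J) where
  toIsLagrangianImmersionOn := isLagrangianImmersionOn_coneMap hψ₁.toIsLegendrianImmersionOn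
    hψ₂.toIsLegendrianImmersionOn hγ
  phase := by
    rcases isEmpty_or_nonempty (N₁ × N₂) with hN | ⟨p, q⟩
    · exact ⟨0, fun x => (hN.false x.2.2).elim⟩
    set c := -(legendrianPhase ψ₁ p * legendrianPhase ψ₂ q) with hc
    have hnorm : ‖c‖ = 1 := by
      rw [hc, norm_neg, norm_mul, hψ₁.toIsLegendrianImmersionOn.norm_legendrianPhase,
        hψ₂.toIsLegendrianImmersionOn.norm_legendrianPhase, mul_one]
    refine ⟨c.arg / 2, fun x hx e he => ?_⟩
    rw [← sq_eq_sq_iff_eq_or_eq_neg, complexVolume_push_coneMap_sq hψ₁.toIsLegendrianImmersionOn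
      hψ₂.toIsLegendrianImmersionOn hγ hx he, hψ₁.legendrianPhase_eq _ p,
      hψ₂.legendrianPhase_eq _ q, ← hc, ← Complex.exp_nat_mul]
    have h := Complex.norm_mul_exp_arg_mul_I c
    rw [hnorm, Complex.ofReal_one, one_mul] at h
    refine h.symm.trans (congrArg Complex.exp ?_)
    push_cast
    ring

end SpecialLagrangian

end LagCone

end

theorem corollary6 {n₁ n₂ : ℕ}
    {N₁ : Type*} [TopologicalSpace N₁] [ChartedSpace (EuclideanSpace ℝ (Fin n₁)) N₁]
    [IsManifold (𝓡 n₁) ∞ N₁]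
    {N₂ : Type*} [TopologicalSpace N₂] [ChartedSpace (EuclideanSpace ℝ (Fin n₂)) N₂]
    [IsManifold (𝓡 n₂) ∞ N₂]
    -- Legendrian immersions of `N₁`, `N₂` into the unit spheres of `ℂ^(n₁+1)`, `ℂ^(n₂+1)`
    (ψ₁ : N₁ → LagCone.CSpace (Fin (n₁ + 1))) (ψ₂ : N₂ → LagCone.CSpace (Fin (n₂ + 1)))
    (hψ₁ : LagCone.IsLegendrianImmersionOn (𝓡 n₁) ψ₁ Set.univ)
    (hψ₂ : LagCone.IsLegendrianImmersionOn (𝓡 n₂) ψ₂ Set.univ)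
    -- the curve `γ = (γ₁, γ₂)` in the unit sphere of `ℂ²`, defined on the open interval `J`
    (J : Set ℝ) (hJ : IsOpen J) (hJ' : J.OrdConnected)
    (γ₁ γ₂ : ℝ → ℂ) (hγ₁ : ContDiffOn ℝ ∞ γ₁ J) (hγ₂ : ContDiffOn ℝ ∞ γ₂ J)
    (hsphere : ∀ t ∈ J, ‖γ₁ t‖ ^ 2 + ‖γ₂ t‖ ^ 2 = 1)
    -- the two differential equations
    (μ : ℝ)
    (hode₁ : ∀ t ∈ J, deriv γ₁ t * (starRingEnd ℂ) (γ₁ t) =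
      Complex.I * Complex.exp (Complex.I * (μ * t)) *
        (starRingEnd ℂ) (γ₁ t) ^ (n₁ + 1) * (starRingEnd ℂ) (γ₂ t) ^ (n₂ + 1))
    (hode₂ : ∀ t ∈ J, deriv γ₂ t * (starRingEnd ℂ) (γ₂ t) =
      -(Complex.I * Complex.exp (Complex.I * (μ * t)) *
        (starRingEnd ℂ) (γ₁ t) ^ (n₁ + 1) * (starRingEnd ℂ) (γ₂ t) ^ (n₂ + 1))) :
    -- `ψ` is the cone with link `φ`, and `φ` is a Legendrian immersion where `γ₁ γ₂ ≠ 0`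
    LagCone.coneMap γ₁ γ₂ ψ₁ ψ₂ = LagCone.cone (LagCone.linkMap γ₁ γ₂ ψ₁ ψ₂) ∧
    LagCone.IsLegendrianImmersionOn (LagCone.linkModel n₁ n₂) (LagCone.linkMap γ₁ γ₂ ψ₁ ψ₂)
      {x | x.1 ∈ J ∧ γ₁ x.1 ≠ 0 ∧ γ₂ x.1 ≠ 0} ∧
    -- `ψ` is smooth and isotropic on `ℝ × J × N₁ × N₂`, and regular where `s γ₁ γ₂ ≠ 0`
    ContMDiffOn (LagCone.coneModel n₁ n₂) 𝓘(ℝ, LagCone.CSpace (Fin (n₁ + 1) ⊕ Fin (n₂ + 1))) ∞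
      (LagCone.coneMap γ₁ γ₂ ψ₁ ψ₂) (LagCone.coneDomain N₁ N₂ J) ∧
    (∀ x ∈ LagCone.coneDomain N₁ N₂ J,
      LagCone.IsIsotropicAt (LagCone.coneModel n₁ n₂) (LagCone.coneMap γ₁ γ₂ ψ₁ ψ₂) x) ∧
    (∀ x ∈ LagCone.coneDomain N₁ N₂ J, x.1 ≠ 0 → γ₁ x.2.1 ≠ 0 → γ₂ x.2.1 ≠ 0 →
      x ∈ LagCone.regularSet γ₁ γ₂ ψ₁ ψ₂ J) ∧
    -- if `ψ₁`, `ψ₂` are C-minimal, then `ψ` is H-minimal Lagrangian on the set of regular points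
    (LagCone.IsCMinimalLegendrianOn (𝓡 n₁) ψ₁ Set.univ →
      LagCone.IsCMinimalLegendrianOn (𝓡 n₂) ψ₂ Set.univ →
      LagCone.IsHMinimalLagrangianOn (LagCone.coneModel n₁ n₂) (LagCone.coneMap γ₁ γ₂ ψ₁ ψ₂)
        (LagCone.regularSet γ₁ γ₂ ψ₁ ψ₂ J)) ∧
    -- if `ψ₁`, `ψ₂` are minimal and `μ = 0`, then `ψ` is special Lagrangian there
    (μ = 0 → PreconnectedSpace N₁ → PreconnectedSpace N₂ →
      LagCone.IsMinimalLegendrianOn (𝓡 n₁) ψ₁ Set.univ →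
      LagCone.IsMinimalLegendrianOn (𝓡 n₂) ψ₂ Set.univ →
      LagCone.IsSpecialLagrangianOn (LagCone.coneModel n₁ n₂) (LagCone.coneMap γ₁ γ₂ ψ₁ ψ₂)
        (LagCone.regularSet γ₁ γ₂ ψ₁ ψ₂ J)) := by
  have hγ : LagCone.IsGeneratingCurve n₁ n₂ μ γ₁ γ₂ J := ⟨hJ, hγ₁, hγ₂, hsphere, hode₁, hode₂⟩
  refine ⟨LagCone.coneMap_eq_cone γ₁ γ₂ ψ₁ ψ₂,
    LagCone.isLegendrianImmersionOn_linkMap hψ₁ hψ₂ hγ,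
    LagCone.contMDiffOn_coneMap (contMDiffOn_univ.1 hψ₁.smooth) (contMDiffOn_univ.1 hψ₂.smooth)
      hγ₁ hγ₂,
    fun x hx => LagCone.isIsotropicAt_coneMap hψ₁ hψ₂ hγ hx,
    fun x hx hs h₁ h₂ => ⟨hx, LagCone.push_coneMap_injective hψ₁ hψ₂ hγ hx hs h₁ h₂⟩,
    fun h₁ h₂ => LagCone.isHMinimalLagrangianOn_coneMap hγ h₁ h₂, ?_⟩
  intro hμ _ _ h₁ h₂
  subst hμ
  exact LagCone.isSpecialLagrangianOn_coneMap hγ h₁ h₂
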